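/- Let $a\in\mathbb C$ be generic, i.e. nonzero and not a root of unity, and put $q=a^2$. **The categories $\mathcal S(a)$ and $\mathcal V(a)$.** For $k,l\ge 0$ let $E_{k,l}$ be the complex vector space spanned by the diagrams (generically immersed compact $1$-manifolds with over/under information at the double points) in a horizontal strip with $k$ endpoints at the bottom and $l$ at the top, modulo planar isotopy, the relation $D\sqcup\bigcirc=-(a^2+a^{-2})D$, and the Kauffman relation $\text{crossing}=a\cdot(\text{two vertical strands})+a^{-1}\cdot(\text{minimum above maximum})$ (with $a^{-1},a$ for the opposite crossing). Stacking diagrams gives a category $\mathcal S(a)$ with objects the integers $n\ge0$, and juxtaposition gives a tensor product on it. In $E_{n,n}$, let $e_1,\dots,e_{n-1}$ be the standard generators ($e_i$ is a minimum above a maximum on the strands $i,i+1$, the other strands being vertical). An element $f_n\in E_{n,n}$ such that $f_n-1_n$ is a noncommutative polynomial without constant term in the $e_i$ and $f_ne_i=e_if_n=0$ for all $i$ is called a Jones–Wenzl idempotent. The category $\mathcal V(a)$ has as objects the finite (possibly empty) sequences $s=(n_1,\dots,n_m)$ of integers $\ge1$. Put $|s|=n_1+\dots+n_m$ and $f_s=f_{n_1}\otimes\cdots\otimes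 f_{n_m}\in E_{|s|,|s|}$; then $\mathrm{Hom}_{\mathcal V(a)}(s,t)=\{f_t\,g\,f_s : g\in E_{|s|,|t|}\}$, with composition that of $\mathcal S(a)$ and $\mathrm{id}_s=f_s$. **The category $\mathcal R(q)$.** $U_q(sl_2)$ is the algebra generated by $K,K^{-1},X,Y$ with $KK^{-1}=K^{-1}K=1$, $KXK^{-1}=q^2X$, $KYK^{-1}=q^{-2}Y$, $XY-YX=(K-K^{-1})/(q-q^{-1})$; it acts on tensor products through $\Delta(K)=K\otimes K$, $\Delta(X)=1\otimes X+X\otimes K$, $\Delta(Y)=K^{-1}\otimes Y+Y\otimes1$, and on $\mathbb C$ through $\varepsilon(K)=1$, $\varepsilon(X)=\varepsilon(Y)=0$. For $n\ge0$ let $V_n$ be the module with basis $v_0,\dots,v_n$ and $Kv_i=q^{n-2i}v_i$, $Xv_i=[n-i+1]v_{i-1}$, $Yv_i=[i+1]v_{i+1}$ (with $v_{-1}=v_{n+1}=0$), where $[k]=(q^k-q^{-k})/(q-q^{-1})$. Then $\mathcal R(q)$ is the full subcategory of finite-dimensional $U_q(sl_2)$-modules whose objects are the modules isomorphic to a tensor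 product $V_{n_1}\otimes\cdots\otimes V_{n_m}$ with $m\ge0$ (the empty product being $\mathbb C$). **The functor $\mathcal F$.** Let $V=V_1$, let $b:\mathbb C\to V\otimes V$ be given by $b(1)=v_1\otimes v_0-q\,v_0\otimes v_1$, and let $d:V\otimes V\to\mathbb C$ be given by $d(v_0\otimes v_1)=1$, $d(v_1\otimes v_0)=-q^{-1}$, $d(v_0\otimes v_0)=d(v_1\otimes v_1)=0$. There is a unique tensor-preserving linear functor $\mathcal F$ from $\mathcal S(a)$ to finite-dimensional $U_q(sl_2)$-modules with $\mathcal F(1)=V$ that sends the minimum to $b$ and the maximum to $d$. It induces a functor $\mathcal F$ on $\mathcal V(a)$ with $\mathcal F(s)=\mathcal F(f_s)\,V^{\otimes|s|}$, sending a morphism $f:s\to t$ to the restriction of $\mathcal F(f):V^{\otimes|s|}\to V^{\otimes|t|}$. **Theorem.** For every $n\ge0$ there is exactly one Jones–Wenzl idempotent $f_n\in E_{n,n}$, so that $\mathcal V(a)$ and $\mathcal F$ are well defined; the functor $\mathcal F$ takes its values in $\mathcal R(q)$; and for all objects $s,t$ of $\mathcal V(a)$ the map $$\mathcal F:\mathrm{Hom}_{\mathcal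 V(a)}(s,t)\longrightarrow\mathrm{Hom}_{\mathcal R(q)}(\mathcal F(s),\mathcal F(t))$$ is an isomorphism of complex vector spaces. That is, $\mathcal F:\mathcal V(a)\to\mathcal R(q)$ is fully faithful. -/

import Mathlib

open CategoryTheory TensorProduct

noncomputable section

/-! ### The quantum enveloping algebra of `sl₂` -/

/-- A generic complex number: nonzero and not a root of unity. -/
def IsGeneric (z : ℂ) : Prop := z ≠ 0 ∧ ∀ n : ℕ, 0 < n → z ^ n ≠ 1

theorem IsGeneric.sq {z : ℂ} (h : IsGeneric z) : IsGeneric (z ^ 2) :=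
  ⟨pow_ne_zero 2 h.1, fun n hn => by rw [← pow_mul]; exact h.2 _ (by omega)⟩

theorem IsGeneric.sub_inv_ne_zero {q : ℂ} (h : IsGeneric q) : q - q⁻¹ ≠ 0 := by
  intro h0
  refine h.2 2 (by norm_num) ?_
  have h1 := h.1
  field_simp at h0
  linear_combination h0

/-- The four generators of `U_q(sl₂)`. -/
inductive UqGen
  | K | Kinv | X | Y

open FreeAlgebra in
/-- The defining relations of `U_q(sl₂)`. -/
inductive UqRel (q : ℂ) : FreeAlgebra ℂ UqGen → FreeAlgebra ℂ UqGen → Prop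
  | K_Kinv : UqRel q (ι ℂ .K * ι ℂ .Kinv) 1
  | Kinv_K : UqRel q (ι ℂ .Kinv * ι ℂ .K) 1
  | K_X : UqRel q (ι ℂ .K * ι ℂ .X * ι ℂ .Kinv) (q ^ 2 • ι ℂ .X)
  | K_Y : UqRel q (ι ℂ .K * ι ℂ .Y * ι ℂ .Kinv) ((q ^ 2)⁻¹ • ι ℂ .Y)
  | X_Y : UqRel q (ι ℂ .X * ι ℂ .Y - ι ℂ .Y * ι ℂ .X)
      ((q - q⁻¹)⁻¹ • (ι ℂ .K - ι ℂ .Kinv))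

/-- The algebra `U_q(sl₂)`. -/
def Uq (q : ℂ) : Type := RingQuot (UqRel q)

instance (q : ℂ) : Ring (Uq q) := inferInstanceAs (Ring (RingQuot (UqRel q)))
instance (q : ℂ) : Algebra ℂ (Uq q) := inferInstanceAs (Algebra ℂ (RingQuot (UqRel q)))

namespace Uq

/-- The projection from the free algebra. -/
def mk (q : ℂ) : FreeAlgebra ℂ UqGen →ₐ[ℂ] Uq q := RingQuot.mkAlgHom ℂ (UqRel q)

theorem mk_rel {q : ℂ} {x y : FreeAlgebra ℂ UqGen} (h : UqRel q x y) : mk q x = mk q y :=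
  RingQuot.mkAlgHom_rel ℂ h

/-- The image in `U_q(sl₂)` of a generator. -/
def gen (q : ℂ) (g : UqGen) : Uq q := mk q (FreeAlgebra.ι ℂ g)

theorem K_Kinv (q : ℂ) : gen q .K * gen q .Kinv = 1 := by
  simpa only [gen, map_mul, map_one] using mk_rel (UqRel.K_Kinv (q := q))

theorem Kinv_K (q : ℂ) : gen q .Kinv * gen q .K = 1 := by
  simpa only [gen, map_mul, map_one] using mk_rel (UqRel.Kinv_K (q := q))

theorem K_X (q : ℂ) : gen q .K * gen q .X * gen q .Kinv = q ^ 2 • gen q .X := by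
  simpa only [gen, map_mul, map_smul] using mk_rel (UqRel.K_X (q := q))

theorem K_Y (q : ℂ) : gen q .K * gen q .Y * gen q .Kinv = (q ^ 2)⁻¹ • gen q .Y := by
  simpa only [gen, map_mul, map_smul] using mk_rel (UqRel.K_Y (q := q))

theorem X_Y (q : ℂ) : gen q .X * gen q .Y - gen q .Y * gen q .X
    = (q - q⁻¹)⁻¹ • (gen q .K - gen q .Kinv) := by
  simpa only [gen, map_mul, map_smul, map_sub] using mk_rel (UqRel.X_Y (q := q))

/-- The universal property of `U_q(sl₂)`. -/
def lift {q : ℂ} {A : Type} [Ring A] [Algebra ℂ A] (K Kinv X Y : A)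
    (h₁ : K * Kinv = 1) (h₂ : Kinv * K = 1) (h₃ : K * X * Kinv = q ^ 2 • X)
    (h₄ : K * Y * Kinv = (q ^ 2)⁻¹ • Y) (h₅ : X * Y - Y * X = (q - q⁻¹)⁻¹ • (K - Kinv)) :
    Uq q →ₐ[ℂ] A :=
  RingQuot.liftAlgHom ℂ
    ⟨FreeAlgebra.lift ℂ (fun g => match g with
      | .K => K | .Kinv => Kinv | .X => X | .Y => Y), by
      intro x y h
      cases h <;> simp only [map_mul, map_one, map_sub, map_smul, FreeAlgebra.lift_ι_apply] <;>
        assumption⟩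

section
variable {q : ℂ} {A : Type} [Ring A] [Algebra ℂ A] (K Kinv X Y : A)
    (h₁ : K * Kinv = 1) (h₂ : Kinv * K = 1) (h₃ : K * X * Kinv = q ^ 2 • X)
    (h₄ : K * Y * Kinv = (q ^ 2)⁻¹ • Y) (h₅ : X * Y - Y * X = (q - q⁻¹)⁻¹ • (K - Kinv))

theorem lift_gen (g : UqGen) : lift K Kinv X Y h₁ h₂ h₃ h₄ h₅ (gen q g) =
    match g with
    | .K => K | .Kinv => Kinv | .X => X | .Y => Y := by
  unfold lift gen mk
  refine (RingQuot.liftAlgHom_mkAlgHom_apply ℂ _ _ _).trans ?_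
  rw [FreeAlgebra.lift_ι_apply]
end

/-- To prove a property closed under the algebra operations, check it on the generators. -/
theorem induction {q : ℂ} {p : Uq q → Prop} (scalar : ∀ c : ℂ, p (algebraMap ℂ _ c))
    (gens : ∀ g, p (gen q g)) (mul : ∀ u v, p u → p v → p (u * v))
    (add : ∀ u v, p u → p v → p (u + v)) (u : Uq q) : p u := by
  obtain ⟨x, rfl⟩ := RingQuot.mkAlgHom_surjective ℂ (UqRel q) u
  induction x using FreeAlgebra.induction with
  | grade0 c => rw [AlgHom.commutes]; exact scalar c
  | grade1 g => exact gens g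
  | mul x y hx hy => rw [map_mul]; exact mul _ _ hx hy
  | add x y hx hy => rw [map_add]; exact add _ _ hx hy

/-- The counit. -/
def counit (q : ℂ) : Uq q →ₐ[ℂ] ℂ :=
  lift 1 1 0 0 (by simp) (by simp) (by simp) (by simp) (by simp)

theorem Kinv_X (q : ℂ) (hq : q ≠ 0) :
    gen q .Kinv * gen q .X = (q ^ 2)⁻¹ • (gen q .X * gen q .Kinv) := by
  have h := congrArg (fun t => (q ^ 2)⁻¹ • (gen q .Kinv * t)) (K_X q)
  simp only [← mul_assoc, Kinv_K, one_mul, mul_smul_comm, smul_smul] at h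
  rw [inv_mul_cancel₀ (pow_ne_zero 2 hq), one_smul] at h
  exact h.symm

theorem Y_K (q : ℂ) (hq : q ≠ 0) :
    gen q .Y * gen q .K = q ^ 2 • (gen q .K * gen q .Y) := by
  have h := congrArg (fun t => q ^ 2 • (t * gen q .K)) (K_Y q)
  simp only [mul_assoc, Kinv_K, mul_one, smul_mul_assoc, smul_smul] at h
  rw [mul_inv_cancel₀ (pow_ne_zero 2 hq), one_smul] at h
  exact h.symm

/-- The comultiplication: `Δ(K) = K ⊗ K`, `Δ(X) = 1 ⊗ X + X ⊗ K`, `Δ(Y) = K⁻¹ ⊗ Y + Y ⊗ 1`. -/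
def comul {q : ℂ} (hq : IsGeneric q) : Uq q →ₐ[ℂ] Uq q ⊗[ℂ] Uq q :=
  lift (gen q .K ⊗ₜ gen q .K) (gen q .Kinv ⊗ₜ gen q .Kinv)
    (1 ⊗ₜ gen q .X + gen q .X ⊗ₜ gen q .K)
    (gen q .Kinv ⊗ₜ gen q .Y + gen q .Y ⊗ₜ 1)
    (by simp [K_Kinv, Algebra.TensorProduct.one_def])
    (by simp [Kinv_K, Algebra.TensorProduct.one_def])
    (by simp [mul_add, add_mul, K_Kinv, K_X, smul_tmul', tmul_smul, mul_assoc (gen q .K) (gen q .K)])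
    (by simp [mul_add, add_mul, K_Kinv, K_Y, smul_tmul', tmul_smul])
    (by
      have e := X_Y q
      have e1 := Kinv_X q hq.1
      have e2 := Y_K q hq.1
      have e3 : gen q .X * gen q .Y
          = gen q .Y * gen q .X + (q - q⁻¹)⁻¹ • (gen q .K - gen q .Kinv) := by
        rw [← e]; abel
      simp only [mul_add, add_mul, Algebra.TensorProduct.tmul_mul_tmul, one_mul, mul_one, e1, e2,
        e3, tmul_add, add_tmul, tmul_sub, sub_tmul, smul_tmul', tmul_smul, smul_sub, smul_smul,
        mul_inv_cancel₀ (pow_ne_zero 2 hq.1), one_smul]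
      abel)

end Uq

/-! ### Finite-dimensional modules over `U_q(sl₂)` -/

/-- A finite-dimensional `U_q(sl₂)`-module. -/
structure UqMod (q : ℂ) where
  carrier : Type
  [addCommGroup : AddCommGroup carrier]
  [module : Module ℂ carrier]
  [finite : Module.Finite ℂ carrier]
  ρ : Uq q →ₐ[ℂ] Module.End ℂ carrier

namespace UqMod

attribute [instance] addCommGroup module finite

variable {q : ℂ}

instance : CoeSort (UqMod q) Type := ⟨carrier⟩

/-- The space of `U_q(sl₂)`-linear maps. -/
def homs (M N : UqMod q) : Submodule ℂ (M →ₗ[ℂ] N) where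
  carrier := {f | ∀ (u : Uq q) (x : M), f (M.ρ u x) = N.ρ u (f x)}
  add_mem' hf hg u x := by simp [hf u x, hg u x]
  zero_mem' u x := by simp
  smul_mem' c f hf u x := by simp [hf u x]

instance : Category (UqMod q) where
  Hom M N := homs M N
  id M := ⟨LinearMap.id, fun _ _ => rfl⟩
  comp f g := ⟨g.1 ∘ₗ f.1, fun u x => by
    simp only [LinearMap.comp_apply]; rw [f.2 u x, g.2 u (f.1 x)]⟩

/-- The linear map underlying a morphism of modules. -/
def lin {M N : UqMod q} (f : M ⟶ N) : M →ₗ[ℂ] N := f.1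

theorem lin_comm {M N : UqMod q} (f : M ⟶ N) (u : Uq q) (x : M) :
    lin f (M.ρ u x) = N.ρ u (lin f x) := f.2 u x

@[ext] theorem hom_ext {M N : UqMod q} {f g : M ⟶ N} (h : lin f = lin g) : f = g := Subtype.ext h

@[simp] theorem lin_id (M : UqMod q) : lin (𝟙 M) = LinearMap.id := rfl
@[simp] theorem lin_comp {M N P : UqMod q} (f : M ⟶ N) (g : N ⟶ P) :
    lin (f ≫ g) = lin g ∘ₗ lin f := rfl

instance : Preadditive (UqMod q) where
  homGroup M N := inferInstanceAs (AddCommGroup (homs M N))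
  add_comp _ _ _ f f' g := Subtype.ext (LinearMap.comp_add f.1 f'.1 g.1)
  comp_add _ _ _ f g g' := Subtype.ext (LinearMap.add_comp f.1 g'.1 g.1)

instance : Linear ℂ (UqMod q) where
  homModule M N := inferInstanceAs (Module ℂ (homs M N))
  smul_comp _ _ _ c f g := Subtype.ext (LinearMap.ext fun x => map_smul g.1 c (f.1 x))
  comp_smul _ _ _ _ _ _ := rfl

@[simp] theorem lin_add {M N : UqMod q} (f g : M ⟶ N) : lin (f + g) = lin f + lin g := rfl
@[simp] theorem lin_smul {M N : UqMod q} (c : ℂ) (f : M ⟶ N) : lin (c • f) = c • lin f := rfl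
@[simp] theorem lin_zero {M N : UqMod q} : lin (0 : M ⟶ N) = 0 := rfl

/-- A linear map commuting with the generators is a morphism. -/
def ofGens {M N : UqMod q} (f : M →ₗ[ℂ] N)
    (h : ∀ g x, f (M.ρ (Uq.gen q g) x) = N.ρ (Uq.gen q g) (f x)) : M ⟶ N :=
  ⟨f, fun u => by
    induction u using Uq.induction with
    | scalar c => intro x; simp [Algebra.algebraMap_eq_smul_one]
    | gens g => exact h g
    | mul u v hu hv => intro x; simp [hu, hv]
    | add u v hu hv => intro x; simp [hu, hv]⟩

@[simp] theorem lin_ofGens {M N : UqMod q} (f : M →ₗ[ℂ] N)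
    (h : ∀ g x, f (M.ρ (Uq.gen q g) x) = N.ρ (Uq.gen q g) (f x)) : lin (ofGens f h) = f := rfl

/-- The trivial module. -/
abbrev triv (q : ℂ) : UqMod q where
  carrier := ℂ
  ρ := (Algebra.lmul ℂ ℂ).comp (Uq.counit q)

/-- The tensor product of two modules, with the action given by the comultiplication. -/
abbrev tensor (hq : IsGeneric q) (M N : UqMod q) : UqMod q where
  carrier := M ⊗[ℂ] N
  ρ := Module.endTensorEndAlgHom.comp ((Algebra.TensorProduct.map M.ρ N.ρ).comp (Uq.comul hq))

/-- The tensor product of two morphisms. -/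
def tensorHom (hq : IsGeneric q) {M N M' N' : UqMod q} (f : M ⟶ M') (g : N ⟶ N') :
    tensor hq M N ⟶ tensor hq M' N' :=
  ⟨TensorProduct.map (lin f) (lin g), by
    intro u x
    change TensorProduct.map (lin f) (lin g) (Module.endTensorEndAlgHom
        (Algebra.TensorProduct.map M.ρ N.ρ (Uq.comul hq u)) x)
      = Module.endTensorEndAlgHom
        (Algebra.TensorProduct.map M'.ρ N'.ρ (Uq.comul hq u)) (TensorProduct.map (lin f) (lin g) x)
    refine LinearMap.congr_fun (f := TensorProduct.map (lin f) (lin g) ∘ₗ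
      Module.endTensorEndAlgHom (Algebra.TensorProduct.map M.ρ N.ρ (Uq.comul hq u)))
      (g := Module.endTensorEndAlgHom (Algebra.TensorProduct.map M'.ρ N'.ρ (Uq.comul hq u)) ∘ₗ
        TensorProduct.map (lin f) (lin g)) ?_ x
    induction Uq.comul hq u with
    | zero => simp
    | add a b ha hb => rw [map_add, map_add, map_add, map_add, LinearMap.comp_add,
        LinearMap.add_comp, ha, hb]
    | tmul a b =>
      refine TensorProduct.ext' fun x y => ?_
      simp [Module.endTensorEndAlgHom_apply, lin_comm]⟩

@[simp] theorem lin_tensorHom (hq : IsGeneric q) {M N M' N' : UqMod q} (f : M ⟶ M') (g : N ⟶ N') :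
    lin (tensorHom hq f g) = TensorProduct.map (lin f) (lin g) := rfl

/-- The action of the generators on a tensor product. -/
theorem tensor_ρ (hq : IsGeneric q) (M N : UqMod q) (g : UqGen) (x : M) (y : N) :
    (tensor hq M N).ρ (Uq.gen q g) (x ⊗ₜ y : M ⊗[ℂ] N) =
    (match g with
    | .K => M.ρ (Uq.gen q .K) x ⊗ₜ N.ρ (Uq.gen q .K) y
    | .Kinv => M.ρ (Uq.gen q .Kinv) x ⊗ₜ N.ρ (Uq.gen q .Kinv) y
    | .X => x ⊗ₜ N.ρ (Uq.gen q .X) y + M.ρ (Uq.gen q .X) x ⊗ₜ N.ρ (Uq.gen q .K) y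
    | .Y => M.ρ (Uq.gen q .Kinv) x ⊗ₜ N.ρ (Uq.gen q .Y) y + M.ρ (Uq.gen q .Y) x ⊗ₜ y :
    M ⊗[ℂ] N) := by
  change Module.endTensorEndAlgHom (Algebra.TensorProduct.map M.ρ N.ρ
    (Uq.comul hq (Uq.gen q g))) (x ⊗ₜ y : M ⊗[ℂ] N) = _
  unfold Uq.comul
  rw [Uq.lift_gen]
  cases g <;> simp [Module.endTensorEndAlgHom_apply]

/-- The quantum integer `[n] = (qⁿ - q⁻ⁿ) / (q - q⁻¹)`. -/
def qint (q : ℂ) (n : ℕ) : ℂ := (q ^ n - q⁻¹ ^ n) / (q - q⁻¹)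

/-- The operator `v_i ↦ c_i v_i` on `ℂ^{n+1}`, with basis `v_0, …, v_n`. -/
def diagOp (n : ℕ) (c : ℕ → ℂ) : Module.End ℂ (Fin (n + 1) → ℂ) where
  toFun w i := c i * w i
  map_add' w w' := by ext i; simp [mul_add]
  map_smul' r w := by ext i; simp; ring

/-- The operator `v_i ↦ [n - i + 1] v_{i-1}`, `v_0 ↦ 0`. -/
def raiseOp (q : ℂ) (n : ℕ) : Module.End ℂ (Fin (n + 1) → ℂ) where
  toFun w i := if h : (i : ℕ) + 1 < n + 1 then qint q (n - i) * w ⟨i + 1, h⟩ else 0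
  map_add' w w' := by ext i; simp only [Pi.add_apply]; split_ifs <;> ring
  map_smul' r w := by
    ext i; simp only [Pi.smul_apply, smul_eq_mul, RingHom.id_apply]; split_ifs <;> ring

/-- The operator `v_i ↦ [i + 1] v_{i+1}`, `v_n ↦ 0`. -/
def lowerOp (q : ℂ) (n : ℕ) : Module.End ℂ (Fin (n + 1) → ℂ) where
  toFun w i := if 0 < (i : ℕ) then qint q i * w ⟨i - 1, by omega⟩ else 0
  map_add' w w' := by ext i; simp only [Pi.add_apply]; split_ifs <;> ring
  map_smul' r w := by
    ext i; simp only [Pi.smul_apply, smul_eq_mul, RingHom.id_apply]; split_ifs <;> ring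

/-- The action of `U_q(sl₂)` on `ℂ^{n+1}`, with basis `v_0, …, v_n`, given by
`K v_i = q^{n-2i} v_i`, `X v_i = [n-i+1] v_{i-1}`, `Y v_i = [i+1] v_{i+1}`. -/
def simpleAct (hq : IsGeneric q) (n : ℕ) : Uq q →ₐ[ℂ] Module.End ℂ (Fin (n + 1) → ℂ) :=
  Uq.lift (diagOp n fun i => q ^ ((n : ℤ) - 2 * i)) (diagOp n fun i => q ^ (2 * i - (n : ℤ)))
    (raiseOp q n) (lowerOp q n)
    (by
      refine LinearMap.ext fun w => funext fun i => ?_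
      simp only [diagOp, Module.End.mul_apply, LinearMap.coe_mk, AddHom.coe_mk,
        Module.End.one_apply, ← mul_assoc]
      rw [← zpow_add₀ hq.1]; simp)
    (by
      refine LinearMap.ext fun w => funext fun i => ?_
      simp only [diagOp, Module.End.mul_apply, LinearMap.coe_mk, AddHom.coe_mk,
        Module.End.one_apply, ← mul_assoc]
      rw [← zpow_add₀ hq.1]; simp)
    (by
      refine LinearMap.ext fun w => funext fun i => ?_
      simp only [diagOp, raiseOp, Module.End.mul_apply, LinearMap.coe_mk, AddHom.coe_mk,
        LinearMap.smul_apply, Pi.smul_apply, smul_eq_mul]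
      split_ifs with h
      · have : q ^ ((n : ℤ) - 2 * (i : ℕ)) * q ^ (2 * ((i : ℕ) + 1 : ℕ) - (n : ℤ)) = q ^ 2 := by
          rw [← zpow_add₀ hq.1, ← zpow_natCast]; congr 1; push_cast; ring
        linear_combination (qint q (n - i) * w ⟨i + 1, h⟩) * this
      · simp)
    (by
      refine LinearMap.ext fun w => funext fun i => ?_
      simp only [diagOp, lowerOp, Module.End.mul_apply, LinearMap.coe_mk, AddHom.coe_mk,
        LinearMap.smul_apply, Pi.smul_apply, smul_eq_mul]
      split_ifs with h
      · have : q ^ ((n : ℤ) - 2 * (i : ℕ)) * q ^ (2 * ((i : ℕ) - 1 : ℕ) - (n : ℤ))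
            = (q ^ 2)⁻¹ := by
          rw [← zpow_add₀ hq.1, ← zpow_natCast, ← zpow_neg]; congr 1
          rw [Nat.cast_sub (by omega)]; push_cast; ring
        linear_combination (qint q i * w ⟨i - 1, by omega⟩) * this
      · simp)
    (by
      have hq0 := hq.1
      have hd := hq.sub_inv_ne_zero
      refine LinearMap.ext fun w => funext fun i => ?_
      obtain ⟨i, hi⟩ := i
      simp only [diagOp, raiseOp, lowerOp, Module.End.mul_apply, LinearMap.coe_mk, AddHom.coe_mk,
        LinearMap.smul_apply, LinearMap.sub_apply, Pi.sub_apply, Pi.smul_apply, smul_eq_mul]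
      obtain ⟨j, rfl⟩ : ∃ j, n = i + j := ⟨n - i, by omega⟩
      have key : qint q j * qint q (i + 1) - qint q i * qint q (j + 1)
          = (q - q⁻¹)⁻¹ * (q ^ (((i + j : ℕ) : ℤ) - 2 * i) - q ^ (2 * i - ((i + j : ℕ) : ℤ))) := by
        have e1 : q ^ (((i + j : ℕ) : ℤ) - 2 * i) = q ^ j * q⁻¹ ^ i := by
          rw [← zpow_natCast, ← zpow_natCast, inv_zpow', ← zpow_add₀ hq0]; congr 1
          push_cast; ring
        have e2 : q ^ (2 * i - ((i + j : ℕ) : ℤ)) = q ^ i * q⁻¹ ^ j := by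
          rw [← zpow_natCast, ← zpow_natCast, inv_zpow', ← zpow_add₀ hq0]; congr 1
          push_cast; ring
        rw [e1, e2]
        unfold qint
        have h1 : q * q⁻¹ = 1 := mul_inv_cancel₀ hq0
        generalize q⁻¹ = p at *
        field_simp
        ring
      have e3 : i + j - i = j := by omega
      have hA : (if h : i + 1 < i + j + 1 then qint q (i + j - i) *
          (if 0 < i + 1 then qint q (i + 1) * w ⟨i + 1 - 1, by omega⟩ else 0) else 0)
          = qint q j * qint q (i + 1) * w ⟨i, hi⟩ := by
        rw [e3]
        split_ifs with h h'
        · simp [mul_assoc]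
        · omega
        · have : j = 0 := by omega
          subst this; simp [qint]
      have hB : (if 0 < i then qint q i * (if h : i - 1 + 1 < i + j + 1 then
          qint q (i + j - (i - 1)) * w ⟨i - 1 + 1, h⟩ else 0) else 0)
          = qint q i * qint q (j + 1) * w ⟨i, hi⟩ := by
        split_ifs with h h'
        · have : i + j - (i - 1) = j + 1 := by omega
          rw [this]; simp only [Nat.sub_add_cancel h, mul_assoc]
        · omega
        · have : i = 0 := by omega
          subst this; simp [qint]
      rw [hA, hB]
      linear_combination (w ⟨i, hi⟩) * key)

/-- The simple module `V_n` of dimension `n + 1`. -/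
abbrev simple (hq : IsGeneric q) (n : ℕ) : UqMod q where
  carrier := Fin (n + 1) → ℂ
  ρ := simpleAct hq n

/-- The action of the generators on `V_n`. -/
theorem simple_ρ (hq : IsGeneric q) (n : ℕ) (g : UqGen) : (simple hq n).ρ (Uq.gen q g) =
    (match g with
    | .K => diagOp n fun i => q ^ ((n : ℤ) - 2 * i)
    | .Kinv => diagOp n fun i => q ^ (2 * i - (n : ℤ))
    | .X => raiseOp q n
    | .Y => lowerOp q n) := by
  change simpleAct hq n (Uq.gen q g) = _
  unfold simpleAct
  rw [Uq.lift_gen]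

end UqMod


/-! ### Diagrams in the strip, up to planar isotopy -/

/-- The elementary pieces of a diagram: a local minimum, a local maximum, and the two crossings.
In `pos` the strand going from bottom left to top right passes over, in `neg` it passes under. -/
inductive Piece
  | cup | cap | pos | neg

/-- The number of inputs of a piece. -/
def Piece.src : Piece → ℕ
  | cup => 0 | cap => 2 | pos => 2 | neg => 2

/-- The number of outputs of a piece. -/
def Piece.tgt : Piece → ℕ
  | cup => 2 | cap => 0 | pos => 2 | neg => 2

/-- A diagram with `k` inputs (at the bottom) and `l` outputs (at the top), in general position with
respect to the height: finitely many horizontal slices stacked on top of each other, each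
consisting of one elementary piece with `i` vertical strands on its left and `j` on its right. -/
inductive Diagram : ℕ → ℕ → Type
  | vert (n : ℕ) : Diagram n n
  | stack {k n m : ℕ} (D : Diagram k n) (i : ℕ) (g : Piece) (j : ℕ)
      (hn : n = i + g.src + j) (hm : m = i + g.tgt + j) : Diagram k m

namespace Diagram

/-- A single slice. -/
def slice (i : ℕ) (g : Piece) (j : ℕ) : Diagram (i + g.src + j) (i + g.tgt + j) :=
  stack (vert _) i g j rfl rfl

/-- `D.comp D'` is obtained by placing `D` on top of `D'`. -/
def comp {k l : ℕ} : {m : ℕ} → Diagram l m → Diagram k l → Diagram k m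
  | _, vert _, D' => D'
  | _, stack D i g j hn hm, D' => stack (comp D D') i g j hn hm

/-- Adding `p` vertical strands on the left. -/
def whiskerLeft (p : ℕ) {k : ℕ} : {l : ℕ} → Diagram k l → Diagram (p + k) (p + l)
  | _, vert _ => vert (p + k)
  | _, stack D i g j hn hm =>
      stack (whiskerLeft p D) (p + i) g j (by omega) (by omega)

/-- Adding `p` vertical strands on the right. -/
def whiskerRight (p : ℕ) {k : ℕ} : {l : ℕ} → Diagram k l → Diagram (k + p) (l + p)
  | _, vert _ => vert (k + p)
  | _, stack D i g j hn hm =>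
      stack (whiskerRight p D) i g (j + p) (by omega) (by omega)

/-- The positive crossing. -/
def crossPos : Diagram 2 2 := slice 0 .pos 0

/-- The negative crossing. -/
def crossNeg : Diagram 2 2 := slice 0 .neg 0

/-- The diagram consisting of a minimum above a maximum. -/
def cupCap : Diagram 2 2 := comp (slice 0 .cup 0 : Diagram 0 2) (slice 0 .cap 0 : Diagram 2 0)

/-- The diagram consisting of one circle. -/
def circ : Diagram 0 0 := comp (slice 0 .cap 0 : Diagram 2 0) (slice 0 .cup 0 : Diagram 0 2)

theorem comp_vert {k l : ℕ} (D : Diagram k l) : D.comp (vert k) = D := by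
  induction D with
  | vert => rfl
  | stack D i g j hn hm ih => simp only [comp, ih]

theorem comp_assoc {k l m n : ℕ} (D : Diagram m n) (D' : Diagram l m) (D'' : Diagram k l) :
    (D.comp D').comp D'' = D.comp (D'.comp D'') := by
  induction D with
  | vert => rfl
  | stack D i g j hn hm ih => simp only [comp, ih]

theorem whiskerLeft_comp {k l m : ℕ} (p : ℕ) (D : Diagram l m) (D' : Diagram k l) :
    (D.comp D').whiskerLeft p = (D.whiskerLeft p).comp (D'.whiskerLeft p) := by
  induction D with
  | vert => rfl
  | stack D i g j hn hm ih => simp only [comp, whiskerLeft, ih]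

theorem whiskerRight_comp {k l m : ℕ} (p : ℕ) (D : Diagram l m) (D' : Diagram k l) :
    (D.comp D').whiskerRight p = (D.whiskerRight p).comp (D'.whiskerRight p) := by
  induction D with
  | vert => rfl
  | stack D i g j hn hm ih => simp only [comp, whiskerRight, ih]

end Diagram

open Diagram in
/-- Planar isotopy of diagrams, relative to the boundary and preserving the crossings: the
congruence generated by the exchange of the heights of two disjoint parts, the cancellation of a
minimum against an adjacent maximum, and the rotation of a crossing past a maximum or a minimum. -/
inductive Isotopic : {k l : ℕ} → Diagram k l → Diagram k l → Prop
  | refl {k l : ℕ} (D : Diagram k l) : Isotopic D D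
  | symm {k l : ℕ} {D D' : Diagram k l} : Isotopic D D' → Isotopic D' D
  | trans {k l : ℕ} {D D' D'' : Diagram k l} : Isotopic D D' → Isotopic D' D'' → Isotopic D D''
  | comp {k l m : ℕ} {D D' : Diagram l m} {F F' : Diagram k l} :
      Isotopic D D' → Isotopic F F' → Isotopic (D.comp F) (D'.comp F')
  | whiskerLeft (p : ℕ) {k l : ℕ} {D D' : Diagram k l} :
      Isotopic D D' → Isotopic (D.whiskerLeft p) (D'.whiskerLeft p)
  | whiskerRight (p : ℕ) {k l : ℕ} {D D' : Diagram k l} :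
      Isotopic D D' → Isotopic (D.whiskerRight p) (D'.whiskerRight p)
  | exchange {k l m n : ℕ} (D : Diagram k l) (F : Diagram m n) :
      Isotopic ((F.whiskerLeft l).comp (D.whiskerRight m))
        ((D.whiskerRight n).comp (F.whiskerLeft k))
  | zigzag_left : Isotopic ((slice 0 .cap 1).comp (slice 1 .cup 0)) (vert 1)
  | zigzag_right : Isotopic ((slice 1 .cap 0).comp (slice 0 .cup 1)) (vert 1)
  | cap_pos : Isotopic ((slice 0 .cap 1).comp (slice 1 .pos 0))
      ((slice 1 .cap 0).comp (slice 0 .neg 1))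
  | cap_neg : Isotopic ((slice 0 .cap 1).comp (slice 1 .neg 0))
      ((slice 1 .cap 0).comp (slice 0 .pos 1))
  | cup_pos : Isotopic ((slice 1 .pos 0).comp (slice 0 .cup 1))
      ((slice 0 .neg 1).comp (slice 1 .cup 0))
  | cup_neg : Isotopic ((slice 1 .neg 0).comp (slice 0 .cup 1))
      ((slice 0 .pos 1).comp (slice 1 .cup 0))

/-! ### The Temperley–Lieb category -/

open Diagram in
/-- The relations imposed on linear combinations of diagrams: planar isotopy, removal of a circle,
and the Kauffman relation for both crossings, applied anywhere inside a diagram. -/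
inductive SkeinRel (a : ℂ) : {k l : ℕ} → (Diagram k l →₀ ℂ) → Prop
  | isotopy {k l : ℕ} {D D' : Diagram k l} : Isotopic D D' →
      SkeinRel a (Finsupp.single D 1 - Finsupp.single D' 1)
  | circle : SkeinRel a (Finsupp.single circ 1
      + (a ^ 2 + (a ^ 2)⁻¹) • Finsupp.single (vert 0) 1)
  | kauffman_pos : SkeinRel a (Finsupp.single crossPos (1 : ℂ)
      - a • Finsupp.single (vert 2) (1 : ℂ)
      - a⁻¹ • Finsupp.single cupCap (1 : ℂ))
  | kauffman_neg : SkeinRel a (Finsupp.single crossNeg (1 : ℂ)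
      - a⁻¹ • Finsupp.single (vert 2) (1 : ℂ)
      - a • Finsupp.single cupCap (1 : ℂ))
  | comp_left {k l m : ℕ} (D : Diagram l m) {x : Diagram k l →₀ ℂ} :
      SkeinRel a x → SkeinRel a (Finsupp.lmapDomain ℂ ℂ (fun F => D.comp F) x)
  | comp_right {k l m : ℕ} (D : Diagram k l) {x : Diagram l m →₀ ℂ} :
      SkeinRel a x → SkeinRel a (Finsupp.lmapDomain ℂ ℂ (fun F => F.comp D) x)
  | whiskerLeft (p : ℕ) {k l : ℕ} {x : Diagram k l →₀ ℂ} :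
      SkeinRel a x → SkeinRel a (Finsupp.lmapDomain ℂ ℂ (fun F => F.whiskerLeft p) x)
  | whiskerRight (p : ℕ) {k l : ℕ} {x : Diagram k l →₀ ℂ} :
      SkeinRel a x → SkeinRel a (Finsupp.lmapDomain ℂ ℂ (fun F => F.whiskerRight p) x)

/-- The subspace spanned by the relations. -/
def skeinSub (a : ℂ) (k l : ℕ) : Submodule ℂ (Diagram k l →₀ ℂ) :=
  Submodule.span ℂ {x | SkeinRel a x}

/-- The skein space `E_{k,l}`. -/
def Skein (a : ℂ) (k l : ℕ) : Type := (Diagram k l →₀ ℂ) ⧸ skeinSub a k l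

namespace Skein

variable {a : ℂ} {k l m n : ℕ}

instance : AddCommGroup (Skein a k l) :=
  inferInstanceAs (AddCommGroup ((Diagram k l →₀ ℂ) ⧸ skeinSub a k l))
instance : Module ℂ (Skein a k l) :=
  inferInstanceAs (Module ℂ ((Diagram k l →₀ ℂ) ⧸ skeinSub a k l))

/-- The projection from linear combinations of diagrams. -/
def proj (a : ℂ) (k l : ℕ) : (Diagram k l →₀ ℂ) →ₗ[ℂ] Skein a k l := (skeinSub a k l).mkQ

/-- The class of a diagram. -/
def of (a : ℂ) (D : Diagram k l) : Skein a k l := proj a k l (Finsupp.single D 1)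

theorem proj_eq_zero {x : Diagram k l →₀ ℂ} (h : SkeinRel a x) : proj a k l x = 0 :=
  (Submodule.Quotient.mk_eq_zero _).2 (Submodule.subset_span h)

theorem of_eq {D D' : Diagram k l} (h : Isotopic D D') : of a D = of a D' := by
  have := proj_eq_zero (a := a) (SkeinRel.isotopy h)
  rwa [map_sub, sub_eq_zero] at this

/-- A linear map out of a skein space. -/
def desc {M : Type*} [AddCommGroup M] [Module ℂ M] (f : (Diagram k l →₀ ℂ) →ₗ[ℂ] M)
    (h : ∀ x, SkeinRel a x → f x = 0) : Skein a k l →ₗ[ℂ] M :=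
  (skeinSub a k l).liftQ f (Submodule.span_le.2 h)

theorem desc_proj {M : Type*} [AddCommGroup M] [Module ℂ M] (f : (Diagram k l →₀ ℂ) →ₗ[ℂ] M)
    (h : ∀ x, SkeinRel a x → f x = 0) (x : Diagram k l →₀ ℂ) : desc f h (proj a k l x) = f x := rfl

theorem desc_of {M : Type*} [AddCommGroup M] [Module ℂ M] (f : (Diagram k l →₀ ℂ) →ₗ[ℂ] M)
    (h : ∀ x, SkeinRel a x → f x = 0) (D : Diagram k l) :
    desc f h (of a D) = f (Finsupp.single D 1) := rfl

/-- Linear maps out of a skein space are determined by their values on diagrams. -/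
theorem hom_ext {M : Type*} [AddCommGroup M] [Module ℂ M] {f g : Skein a k l →ₗ[ℂ] M}
    (h : ∀ D, f (of a D) = g (of a D)) : f = g := by
  apply Submodule.linearMap_qext
  refine Finsupp.lhom_ext' fun D => LinearMap.ext_ring ?_
  exact h D

/-- Composition of skeins. -/
def comp : Skein a l m →ₗ[ℂ] Skein a k l →ₗ[ℂ] Skein a k m :=
  (desc (a := a) (k := k) (l := l)
    (desc (a := a) (k := l) (l := m)
      (Finsupp.linearCombination ℂ fun D : Diagram l m =>
        proj a k m ∘ₗ Finsupp.lmapDomain ℂ ℂ (fun F => D.comp F))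
      (fun x hx => by
        refine Finsupp.lhom_ext' fun F => LinearMap.ext_ring ?_
        refine Eq.trans ?_ (proj_eq_zero (SkeinRel.comp_right F hx))
        clear hx
        induction x using Finsupp.induction_linear with
        | zero => simp
        | add x y hx hy => rw [map_add, map_add, map_add, ← hx, ← hy]; rfl
        | single D c => simp [Finsupp.lmapDomain_apply, ← map_smul])).flip
    (fun x hx => by
      refine hom_ext fun D => ?_
      refine Eq.trans ?_ (proj_eq_zero (SkeinRel.comp_left D hx))
      rw [LinearMap.flip_apply, desc_of]
      simp)).flip

@[simp] theorem comp_of (D : Diagram l m) (F : Diagram k l) :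
    comp (of a D) (of a F) = of a (D.comp F) := by
  change Finsupp.linearCombination ℂ (fun D : Diagram l m =>
        proj a k m ∘ₗ Finsupp.lmapDomain ℂ ℂ (fun F => D.comp F)) (Finsupp.single D 1)
        (Finsupp.single F 1) = _
  simp [Finsupp.lmapDomain_apply, of]

/-- Adding `p` vertical strands on the left. -/
def whiskerLeft (p : ℕ) : Skein a k l →ₗ[ℂ] Skein a (p + k) (p + l) :=
  desc (proj a _ _ ∘ₗ Finsupp.lmapDomain ℂ ℂ (fun F => F.whiskerLeft p))
    fun _ hx => proj_eq_zero (SkeinRel.whiskerLeft p hx)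

/-- Adding `p` vertical strands on the right. -/
def whiskerRight (p : ℕ) : Skein a k l →ₗ[ℂ] Skein a (k + p) (l + p) :=
  desc (proj a _ _ ∘ₗ Finsupp.lmapDomain ℂ ℂ (fun F => F.whiskerRight p))
    fun _ hx => proj_eq_zero (SkeinRel.whiskerRight p hx)

@[simp] theorem whiskerLeft_of (p : ℕ) (D : Diagram k l) :
    whiskerLeft p (of a D) = of a (D.whiskerLeft p) := by
  simp [whiskerLeft, desc_of, Finsupp.lmapDomain_apply]; rfl

@[simp] theorem whiskerRight_of (p : ℕ) (D : Diagram k l) :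
    whiskerRight p (of a D) = of a (D.whiskerRight p) := by
  simp [whiskerRight, desc_of, Finsupp.lmapDomain_apply]; rfl

/-- The tensor product of skeins: `x` is placed on the left of `y`. -/
def tensor (x : Skein a k l) (y : Skein a m n) : Skein a (k + m) (l + n) :=
  comp (whiskerLeft l y) (whiskerRight m x)

/-- The vertical strands. -/
def one (a : ℂ) (n : ℕ) : Skein a n n := of a (.vert n)

/-- To prove an additive property of skeins, check it on multiples of diagrams. -/
theorem induction {p : Skein a k l → Prop} (zero : p 0)
    (add : ∀ x y, p x → p y → p (x + y)) (smul : ∀ (c : ℂ) D, p (c • of a D)) (x : Skein a k l) : p x := by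
  obtain ⟨x, rfl⟩ := Submodule.mkQ_surjective _ x
  induction x using Finsupp.induction_linear with
  | zero => rw [map_zero]; exact zero
  | add x y hx hy => rw [map_add]; exact add _ _ hx hy
  | single D c =>
    have := smul c D
    rwa [of, ← map_smul, Finsupp.smul_single, smul_eq_mul, mul_one] at this

theorem add_comp (x y : Skein a l m) (z : Skein a k l) :
    comp (x + y) z = comp x z + comp y z := LinearMap.map_add₂ comp x y z

theorem smul_comp (c : ℂ) (x : Skein a l m) (z : Skein a k l) :
    comp (c • x) z = c • comp x z := LinearMap.map_smul₂ comp c x z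

theorem one_comp (x : Skein a k l) : comp (one a l) x = x := by
  induction x using Skein.induction with
  | zero => simp
  | add x y hx hy => rw [map_add, hx, hy]
  | smul c D => rw [map_smul, one, comp_of]; rfl

theorem comp_one (x : Skein a k l) : comp x (one a k) = x := by
  induction x using Skein.induction with
  | zero => simp
  | add x y hx hy => rw [map_add, LinearMap.add_apply, hx, hy]
  | smul c D => rw [map_smul, LinearMap.smul_apply, one, comp_of, Diagram.comp_vert]

theorem comp_assoc (x : Skein a m n) (y : Skein a l m) (z : Skein a k l) :
    comp (comp x y) z = comp x (comp y z) := by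
  induction x using Skein.induction with
  | zero => simp
  | add x x' hx hx' => simp only [map_add, LinearMap.add_apply, hx, hx']
  | smul c D =>
    induction y using Skein.induction with
    | zero => simp
    | add y y' hy hy' => simp only [map_add, LinearMap.add_apply, hy, hy']
    | smul d F =>
      induction z using Skein.induction with
      | zero => simp
      | add z z' hz hz' => simp only [map_add, hz, hz']
      | smul e G => simp only [map_smul, LinearMap.smul_apply, comp_of, Diagram.comp_assoc]

theorem whiskerLeft_comp (p : ℕ) (x : Skein a l m) (y : Skein a k l) :
    whiskerLeft p (comp x y) = comp (whiskerLeft p x) (whiskerLeft p y) := by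
  induction x using Skein.induction with
  | zero => simp
  | add x x' hx hx' => simp only [map_add, LinearMap.add_apply, hx, hx']
  | smul c D =>
    induction y using Skein.induction with
    | zero => simp
    | add y y' hy hy' => simp only [map_add, hy, hy']
    | smul d F => simp only [map_smul, LinearMap.smul_apply, comp_of, whiskerLeft_of,
        Diagram.whiskerLeft_comp]

theorem whiskerRight_comp (p : ℕ) (x : Skein a l m) (y : Skein a k l) :
    whiskerRight p (comp x y) = comp (whiskerRight p x) (whiskerRight p y) := by
  induction x using Skein.induction with
  | zero => simp
  | add x x' hx hx' => simp only [map_add, LinearMap.add_apply, hx, hx']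
  | smul c D =>
    induction y using Skein.induction with
    | zero => simp
    | add y y' hy hy' => simp only [map_add, hy, hy']
    | smul d F => simp only [map_smul, LinearMap.smul_apply, comp_of, whiskerRight_of,
        Diagram.whiskerRight_comp]

theorem exchange (x : Skein a k l) (y : Skein a m n) :
    comp (whiskerLeft l y) (whiskerRight m x) = comp (whiskerRight n x) (whiskerLeft k y) := by
  induction x using Skein.induction with
  | zero => simp
  | add x x' hx hx' => simp only [map_add, LinearMap.add_apply, hx, hx']
  | smul c D =>
    induction y using Skein.induction with
    | zero => simp
    | add y y' hy hy' => simp only [map_add, LinearMap.add_apply, hy, hy']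
    | smul d F =>
      simp only [map_smul, LinearMap.smul_apply, comp_of, whiskerRight_of, whiskerLeft_of,
        of_eq (Isotopic.exchange D F)]
      rw [smul_comm]

theorem tensor_comp_tensor {k' l' m' : ℕ} (x : Skein a l m) (x' : Skein a l' m')
    (y : Skein a k l) (y' : Skein a k' l') :
    comp (tensor x x') (tensor y y') = tensor (comp x y) (comp x' y') := by
  simp only [tensor, whiskerLeft_comp, whiskerRight_comp, comp_assoc]
  rw [← comp_assoc (whiskerRight l' x), ← exchange x y']
  simp only [comp_assoc]

end Skein

/-- The Temperley–Lieb category `𝒮(a)`; its objects are the natural numbers. -/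
structure TL (a : ℂ) where
  strands : ℕ

namespace TL

variable {a : ℂ}

instance : Category (TL a) where
  Hom k l := Skein a k.strands l.strands
  id k := Skein.one a k.strands
  comp f g := Skein.comp g f
  id_comp f := Skein.comp_one f
  comp_id f := Skein.one_comp f
  assoc f g h := (Skein.comp_assoc h g f).symm

instance : Preadditive (TL a) where
  homGroup k l := inferInstanceAs (AddCommGroup (Skein a k.strands l.strands))
  add_comp _ _ _ f f' g := LinearMap.map_add (Skein.comp g) f f'
  comp_add k l m f g g' := by exact Skein.add_comp g g' f

instance : Linear ℂ (TL a) where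
  homModule k l := inferInstanceAs (Module ℂ (Skein a k.strands l.strands))
  smul_comp _ _ _ c f g := LinearMap.map_smul (Skein.comp g) c f
  comp_smul _ _ _ f c g := by exact Skein.smul_comp c g f

end TL

/-! ### Jones–Wenzl idempotents and Turaev's category -/

/-- The generator `e_{i+1}` of the Temperley–Lieb algebra `E_n`, for `0 ≤ i ≤ n - 2`: a maximum
joining the inputs `i+1` and `i+2` below a minimum joining the outputs `i+1` and `i+2`. -/
def tlGen (a : ℂ) (n : ℕ) (i : Fin (n - 1)) : End (⟨n⟩ : TL a) :=
  Skein.of a (.stack (.stack (.vert n) i .cap (n - 2 - i)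
      (by have := i.2; simp only [Piece.src]; omega) rfl) i .cup (n - 2 - i)
    (by simp only [Piece.src, Piece.tgt]) (by have := i.2; simp only [Piece.tgt]; omega))

/-- `f` is the Jones–Wenzl idempotent of `E_n`: the element `f - 1` is a noncommutative polynomial
without constant term in the generators `e_i`, and `f e_i = e_i f = 0` for all `i`. -/
def IsJonesWenzl (a : ℂ) (n : ℕ) (f : End (⟨n⟩ : TL a)) : Prop :=
  f - 1 ∈ NonUnitalAlgebra.adjoin ℂ (Set.range (tlGen a n)) ∧
    ∀ i, f * tlGen a n i = 0 ∧ tlGen a n i * f = 0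

theorem IsJonesWenzl.mul_eq {a : ℂ} {n : ℕ} {f g : End (⟨n⟩ : TL a)} (hf : IsJonesWenzl a n f)
    (hg : IsJonesWenzl a n g) : f * g = f := by
  have : ∀ x ∈ NonUnitalAlgebra.adjoin ℂ (Set.range (tlGen a n)), f * x = 0 := by
    intro x hx
    induction hx using NonUnitalAlgebra.adjoin_induction with
    | mem x hx => obtain ⟨i, rfl⟩ := hx; exact (hf.2 i).1
    | add x y _ _ hx hy => rw [mul_add, hx, hy, add_zero]
    | zero => rw [mul_zero]
    | mul x y _ _ hx hy => rw [← mul_assoc, hx, zero_mul]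
    | smul c x _ hx => rw [mul_smul_comm, hx, smul_zero]
  have h := this _ hg.1
  rwa [mul_sub, mul_one, sub_eq_zero] at h

open Classical in
/-- The Jones–Wenzl idempotent `f_n`. -/
def jonesWenzl (a : ℂ) (n : ℕ) : End (⟨n⟩ : TL a) :=
  if h : ∃ f, IsJonesWenzl a n f then h.choose else 1

theorem jonesWenzl_idem (a : ℂ) (n : ℕ) : jonesWenzl a n * jonesWenzl a n = jonesWenzl a n := by
  unfold jonesWenzl
  split_ifs with h
  · exact h.choose_spec.mul_eq h.choose_spec
  · exact mul_one 1

/-- The objects of Turaev's category `𝒱(a)` for generic `a`: finite sequences of positive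
integers. -/
structure TuraevCat (a : ℂ) where
  seq : List ℕ+

namespace TuraevCat

/-- The sum of a sequence. -/
def size : List ℕ+ → ℕ
  | [] => 0
  | n :: s => n + size s

/-- The idempotent `f_s = f_{n₁} ⊗ ⋯ ⊗ f_{n_m}`. -/
def idem (a : ℂ) : (s : List ℕ+) → Skein a (size s) (size s)
  | [] => Skein.one a 0
  | n :: s => Skein.tensor (jonesWenzl a n) (idem a s)

theorem idem_comp_idem (a : ℂ) (s : List ℕ+) : Skein.comp (idem a s) (idem a s) = idem a s := by
  induction s with
  | nil => exact Skein.one_comp _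
  | cons n s ih =>
    refine (Skein.tensor_comp_tensor _ _ _ _).trans ?_
    rw [ih]
    exact congrArg (fun f => Skein.tensor f (idem a s)) (jonesWenzl_idem a n)

/-- The map `g ↦ ĝ = f_t g f_s` on `E_{|s|,|t|}`. -/
def hat (a : ℂ) (s t : List ℕ+) :
    Skein a (size s) (size t) →ₗ[ℂ] Skein a (size s) (size t) :=
  Skein.comp (idem a t) ∘ₗ (Skein.comp.flip (idem a s))

theorem hat_apply (a : ℂ) (s t : List ℕ+) (g : Skein a (size s) (size t)) :
    hat a s t g = Skein.comp (idem a t) (Skein.comp g (idem a s)) := rfl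

/-- The morphisms `s ⟶ t` in `𝒱(a)`: the elements `ĝ` of `E_{|s|,|t|}`. -/
def homs (a : ℂ) (s t : List ℕ+) : Submodule ℂ (Skein a (size s) (size t)) :=
  LinearMap.range (hat a s t)

variable {a : ℂ} {r s t : List ℕ+}

theorem idem_comp {x : Skein a (size s) (size t)} (hx : x ∈ homs a s t) :
    Skein.comp (idem a t) x = x := by
  obtain ⟨g, rfl⟩ := hx
  rw [hat_apply, ← Skein.comp_assoc, idem_comp_idem]

theorem comp_idem {x : Skein a (size s) (size t)} (hx : x ∈ homs a s t) :
    Skein.comp x (idem a s) = x := by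
  obtain ⟨g, rfl⟩ := hx
  rw [hat_apply, Skein.comp_assoc, Skein.comp_assoc, idem_comp_idem]

theorem idem_mem (a : ℂ) (s : List ℕ+) : idem a s ∈ homs a s s :=
  ⟨idem a s, by rw [hat_apply, idem_comp_idem, idem_comp_idem]⟩

theorem comp_mem {x : Skein a (size s) (size t)} {y : Skein a (size r) (size s)}
    (hx : x ∈ homs a s t) (hy : y ∈ homs a r s) : Skein.comp x y ∈ homs a r t :=
  ⟨Skein.comp x y, by
    rw [hat_apply, Skein.comp_assoc, comp_idem hy, ← Skein.comp_assoc, idem_comp hx]⟩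

instance : Category (TuraevCat a) where
  Hom s t := homs a s.seq t.seq
  id s := ⟨idem a s.seq, idem_mem a s.seq⟩
  comp f g := ⟨Skein.comp g.1 f.1, comp_mem g.2 f.2⟩
  id_comp f := Subtype.ext (comp_idem f.2)
  comp_id f := Subtype.ext (idem_comp f.2)
  assoc f g h := Subtype.ext (Skein.comp_assoc h.1 g.1 f.1).symm

instance : Preadditive (TuraevCat a) where
  homGroup s t := inferInstanceAs (AddCommGroup (homs a s.seq t.seq))
  add_comp _ _ _ f f' g := Subtype.ext (map_add (Skein.comp g.1) f.1 f'.1)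
  comp_add _ _ _ f g g' := Subtype.ext (Skein.add_comp g.1 g'.1 f.1)

instance : Linear ℂ (TuraevCat a) where
  homModule s t := inferInstanceAs (Module ℂ (homs a s.seq t.seq))
  smul_comp _ _ _ c f g := Subtype.ext (map_smul (Skein.comp g.1) c f.1)
  comp_smul _ _ _ f c g := Subtype.ext (Skein.smul_comp c g.1 f.1)

end TuraevCat


/-! ### The functor to `U_q(sl₂)`-modules -/

namespace UqMod

variable {q : ℂ} (hq : IsGeneric q)

theorem tensor_K (M N : UqMod q) (x : M) (y : N) :
    (tensor hq M N).ρ (Uq.gen q .K) (x ⊗ₜ y : M ⊗[ℂ] N) =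
      (M.ρ (Uq.gen q .K) x ⊗ₜ N.ρ (Uq.gen q .K) y : M ⊗[ℂ] N) := tensor_ρ hq M N .K x y

theorem tensor_Kinv (M N : UqMod q) (x : M) (y : N) :
    (tensor hq M N).ρ (Uq.gen q .Kinv) (x ⊗ₜ y : M ⊗[ℂ] N) =
      (M.ρ (Uq.gen q .Kinv) x ⊗ₜ N.ρ (Uq.gen q .Kinv) y : M ⊗[ℂ] N) := tensor_ρ hq M N .Kinv x y

theorem tensor_X (M N : UqMod q) (x : M) (y : N) :
    (tensor hq M N).ρ (Uq.gen q .X) (x ⊗ₜ y : M ⊗[ℂ] N) =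
      (x ⊗ₜ N.ρ (Uq.gen q .X) y + M.ρ (Uq.gen q .X) x ⊗ₜ N.ρ (Uq.gen q .K) y : M ⊗[ℂ] N) :=
  tensor_ρ hq M N .X x y

theorem tensor_Y (M N : UqMod q) (x : M) (y : N) :
    (tensor hq M N).ρ (Uq.gen q .Y) (x ⊗ₜ y : M ⊗[ℂ] N) =
      (M.ρ (Uq.gen q .Kinv) x ⊗ₜ N.ρ (Uq.gen q .Y) y + M.ρ (Uq.gen q .Y) x ⊗ₜ y : M ⊗[ℂ] N) :=
  tensor_ρ hq M N .Y x y

/-- The unit isomorphism `M ⊗ ℂ → M`. -/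
def rightUnit (M : UqMod q) : tensor hq M (triv q) ⟶ M :=
  ofGens (TensorProduct.rid ℂ M).toLinearMap (by
    intro g x
    refine LinearMap.congr_fun (f := (TensorProduct.rid ℂ M).toLinearMap ∘ₗ
      (tensor hq M (triv q)).ρ (Uq.gen q g)) (g := M.ρ (Uq.gen q g) ∘ₗ
      (TensorProduct.rid ℂ M).toLinearMap) (TensorProduct.ext' fun x c => ?_) x
    rw [LinearMap.comp_apply, tensor_ρ]
    cases g <;> simp [triv, Uq.counit, Uq.lift_gen])

/-- The inverse of the unit isomorphism. -/
def rightUnitInv (M : UqMod q) : M ⟶ tensor hq M (triv q) :=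
  ofGens (TensorProduct.rid ℂ M).symm.toLinearMap (by
    intro g x
    refine (TensorProduct.rid ℂ M).injective ?_
    have := lin_comm (rightUnit hq M) (Uq.gen q g) ((TensorProduct.rid ℂ M).symm x)
    simp only [rightUnit, lin_ofGens, LinearEquiv.coe_coe, LinearEquiv.apply_symm_apply] at this ⊢
    exact this.symm)

/-- The associativity isomorphism. -/
def assoc (M N P : UqMod q) :
    tensor hq (tensor hq M N) P ⟶ tensor hq M (tensor hq N P) :=
  ofGens (TensorProduct.assoc ℂ M N P).toLinearMap (by
    intro g x
    refine LinearMap.congr_fun (f := (TensorProduct.assoc ℂ M N P).toLinearMap ∘ₗ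
      (tensor hq (tensor hq M N) P).ρ (Uq.gen q g))
      (g := (tensor hq M (tensor hq N P)).ρ (Uq.gen q g) ∘ₗ
      (TensorProduct.assoc ℂ M N P).toLinearMap) (TensorProduct.ext_threefold fun x y z => ?_) x
    rw [LinearMap.comp_apply, LinearMap.comp_apply, LinearEquiv.coe_coe,
      TensorProduct.assoc_tmul]
    cases g with
    | K => rw [tensor_K, tensor_K, tensor_K, tensor_K, TensorProduct.assoc_tmul]
    | Kinv =>
      rw [tensor_Kinv, tensor_Kinv, tensor_Kinv, tensor_Kinv, TensorProduct.assoc_tmul]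
    | X =>
      rw [tensor_X, tensor_X, tensor_X, tensor_X, tensor_K, TensorProduct.add_tmul,
        TensorProduct.tmul_add, map_add, map_add, TensorProduct.assoc_tmul,
        TensorProduct.assoc_tmul, TensorProduct.assoc_tmul, add_assoc]
    | Y =>
      rw [tensor_Y, tensor_Y, tensor_Y, tensor_Y, tensor_Kinv, TensorProduct.add_tmul,
        TensorProduct.tmul_add, map_add, map_add, TensorProduct.assoc_tmul,
        TensorProduct.assoc_tmul, TensorProduct.assoc_tmul, add_assoc])

/-- The inverse of the associativity isomorphism. -/
def assocInv (M N P : UqMod q) :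
    tensor hq M (tensor hq N P) ⟶ tensor hq (tensor hq M N) P :=
  ofGens (TensorProduct.assoc ℂ M N P).symm.toLinearMap (by
    intro g x
    refine (TensorProduct.assoc ℂ M N P).injective ?_
    have := lin_comm (assoc hq M N P) (Uq.gen q g) ((TensorProduct.assoc ℂ M N P).symm x)
    simp only [assoc, lin_ofGens, LinearEquiv.coe_coe, LinearEquiv.apply_symm_apply] at this ⊢
    exact this.symm)

/-- The fundamental module `V = V_1`. -/
abbrev fund : UqMod q := simple hq 1

/-- The basis vector `v_0` of `V`. -/
def v0 : fund hq := (Pi.single 0 1 : Fin 2 → ℂ)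

/-- The basis vector `v_1` of `V`. -/
def v1 : fund hq := (Pi.single 1 1 : Fin 2 → ℂ)

theorem fund_eq (w : fund hq) : w = (show Fin 2 → ℂ from w) 0 • v0 hq
    + (show Fin 2 → ℂ from w) 1 • v1 hq := by
  refine funext (α := Fin 2) fun i => ?_
  change _ = (show Fin 2 → ℂ from w) 0 * (Pi.single 0 1 : Fin 2 → ℂ) i
    + (show Fin 2 → ℂ from w) 1 * (Pi.single 1 1 : Fin 2 → ℂ) i
  fin_cases i <;> simp

theorem qint_one (hq : IsGeneric q) : qint q 1 = 1 := by
  simp [qint, div_self hq.sub_inv_ne_zero]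

theorem fund_K (w : Fin 2 → ℂ) :
    (fund hq).ρ (Uq.gen q .K) w = (![q * w 0, q⁻¹ * w 1] : Fin 2 → ℂ) := by
  refine (LinearMap.congr_fun (simple_ρ hq 1 _) w).trans (funext (α := Fin 2) fun i => ?_)
  fin_cases i <;> simp [diagOp]

theorem fund_Kinv (w : Fin 2 → ℂ) :
    (fund hq).ρ (Uq.gen q .Kinv) w = (![q⁻¹ * w 0, q * w 1] : Fin 2 → ℂ) := by
  refine (LinearMap.congr_fun (simple_ρ hq 1 _) w).trans (funext (α := Fin 2) fun i => ?_)
  fin_cases i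
  · simp [diagOp]
  · norm_num [diagOp]

theorem fund_X (w : Fin 2 → ℂ) :
    (fund hq).ρ (Uq.gen q .X) w = (![w 1, 0] : Fin 2 → ℂ) := by
  refine (LinearMap.congr_fun (simple_ρ hq 1 _) w).trans (funext (α := Fin 2) fun i => ?_)
  fin_cases i <;> simp [raiseOp, qint_one hq]

theorem fund_Y (w : Fin 2 → ℂ) :
    (fund hq).ρ (Uq.gen q .Y) w = (![0, w 0] : Fin 2 → ℂ) := by
  refine (LinearMap.congr_fun (simple_ρ hq 1 _) w).trans (funext (α := Fin 2) fun i => ?_)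
  fin_cases i <;> simp [lowerOp, qint_one hq]

theorem triv_ρ (g : UqGen) (c : ℂ) : (triv q).ρ (Uq.gen q g) c = (match g with
    | .K => c | .Kinv => c | .X => 0 | .Y => 0 : ℂ) := by
  cases g <;> simp [triv, Uq.counit, Uq.lift_gen]

/-- The bilinear form underlying `d`: `d(v_0 ⊗ v_1) = 1`, `d(v_1 ⊗ v_0) = -q⁻¹`,
`d(v_0 ⊗ v_0) = d(v_1 ⊗ v_1) = 0`. -/
def dForm (q : ℂ) : (Fin 2 → ℂ) →ₗ[ℂ] (Fin 2 → ℂ) →ₗ[ℂ] ℂ :=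
  LinearMap.mk₂ ℂ (fun w w' => w 0 * w' 1 - q⁻¹ * (w 1 * w' 0))
    (by intros; simp; ring) (by intros; simp; ring) (by intros; simp; ring) (by intros; simp; ring)

/-- The morphism `d : V ⊗ V → ℂ`. -/
def dHom : tensor hq (fund hq) (fund hq) ⟶ triv q :=
  ofGens (TensorProduct.lift (dForm q)) (by
    intro g x
    refine LinearMap.congr_fun (f := TensorProduct.lift (dForm q) ∘ₗ
      (tensor hq (fund hq) (fund hq)).ρ (Uq.gen q g)) (g := (triv q).ρ (Uq.gen q g) ∘ₗ
      TensorProduct.lift (dForm q)) (TensorProduct.ext' fun w w' => ?_) x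
    rw [LinearMap.comp_apply, LinearMap.comp_apply, TensorProduct.lift.tmul, triv_ρ]
    have h := hq.1
    cases g with
    | K =>
      rw [tensor_K, fund_K, fund_K, TensorProduct.lift.tmul]
      simp only [dForm, LinearMap.mk₂_apply, Matrix.cons_val_zero, Matrix.cons_val_one]
      field_simp
    | Kinv =>
      rw [tensor_Kinv, fund_Kinv, fund_Kinv, TensorProduct.lift.tmul]
      simp only [dForm, LinearMap.mk₂_apply, Matrix.cons_val_zero, Matrix.cons_val_one]
      field_simp
    | X =>
      rw [tensor_X, fund_X, fund_X, fund_K, map_add, TensorProduct.lift.tmul,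
        TensorProduct.lift.tmul]
      simp only [dForm, LinearMap.mk₂_apply, Matrix.cons_val_zero, Matrix.cons_val_one]
      ring
    | Y =>
      rw [tensor_Y, fund_Y, fund_Y, fund_Kinv, map_add, TensorProduct.lift.tmul,
        TensorProduct.lift.tmul]
      simp only [dForm, LinearMap.mk₂_apply, Matrix.cons_val_zero, Matrix.cons_val_one]
      ring)

/-- The vector `v_1 ⊗ v_0 - q v_0 ⊗ v_1`. -/
def bVec : fund hq ⊗[ℂ] fund hq := v1 hq ⊗ₜ v0 hq - q • (v0 hq ⊗ₜ v1 hq)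

theorem bVec_ρ (g : UqGen) :
    (tensor hq (fund hq) (fund hq)).ρ (Uq.gen q g) (bVec hq) =
    (match g with
    | .K => bVec hq | .Kinv => bVec hq | .X => 0 | .Y => 0 : fund hq ⊗[ℂ] fund hq) := by
  have h := hq.1
  have K0 : (fund hq).ρ (Uq.gen q .K) (v0 hq) = q • v0 hq := by
    rw [v0, fund_K]; refine funext (α := Fin 2) fun i => ?_; fin_cases i <;> simp
  have K1 : (fund hq).ρ (Uq.gen q .K) (v1 hq) = q⁻¹ • v1 hq := by
    rw [v1, fund_K]; refine funext (α := Fin 2) fun i => ?_; fin_cases i <;> simp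
  have L0 : (fund hq).ρ (Uq.gen q .Kinv) (v0 hq) = q⁻¹ • v0 hq := by
    rw [v0, fund_Kinv]; refine funext (α := Fin 2) fun i => ?_; fin_cases i <;> simp
  have L1 : (fund hq).ρ (Uq.gen q .Kinv) (v1 hq) = q • v1 hq := by
    rw [v1, fund_Kinv]; refine funext (α := Fin 2) fun i => ?_; fin_cases i <;> simp
  have X0 : (fund hq).ρ (Uq.gen q .X) (v0 hq) = 0 := by
    rw [v0, fund_X]; refine funext (α := Fin 2) fun i => ?_; fin_cases i <;> simp <;> rfl
  have X1 : (fund hq).ρ (Uq.gen q .X) (v1 hq) = v0 hq := by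
    rw [v1, fund_X, v0]; refine funext (α := Fin 2) fun i => ?_; fin_cases i <;> simp
  have Y0 : (fund hq).ρ (Uq.gen q .Y) (v0 hq) = v1 hq := by
    rw [v0, fund_Y, v1]; refine funext (α := Fin 2) fun i => ?_; fin_cases i <;> simp
  have Y1 : (fund hq).ρ (Uq.gen q .Y) (v1 hq) = 0 := by
    rw [v1, fund_Y]; refine funext (α := Fin 2) fun i => ?_; fin_cases i <;> simp <;> rfl
  unfold bVec
  cases g with
  | K =>
    rw [map_sub, map_smul, tensor_K, tensor_K, K0, K1]
    simp [TensorProduct.smul_tmul', TensorProduct.tmul_smul, smul_smul, h]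
  | Kinv =>
    rw [map_sub, map_smul, tensor_Kinv, tensor_Kinv, L0, L1]
    simp [TensorProduct.smul_tmul', TensorProduct.tmul_smul, smul_smul, h]
  | X =>
    rw [map_sub, map_smul, tensor_X, tensor_X, X0, X1, K0, K1]
    simp [TensorProduct.smul_tmul']
  | Y =>
    rw [map_sub, map_smul, tensor_Y, tensor_Y, Y0, Y1, L0, L1]
    simp [TensorProduct.smul_tmul', TensorProduct.tmul_smul]

/-- The morphism `b : ℂ → V ⊗ V`, `b(1) = v_1 ⊗ v_0 - q v_0 ⊗ v_1`. -/
def bHom : triv q ⟶ tensor hq (fund hq) (fund hq) :=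
  ofGens (LinearMap.toSpanSingleton ℂ (fund hq ⊗[ℂ] fund hq) (bVec hq)) (by
    intro g c
    rw [triv_ρ, LinearMap.toSpanSingleton_apply, LinearMap.toSpanSingleton_apply, map_smul,
      bVec_ρ]
    cases g <;> simp)

/-- `V^{⊗ n}`. -/
def tpow : ℕ → UqMod q
  | 0 => triv q
  | n + 1 => tensor hq (tpow n) (fund hq)

/-- `id_M ⊗ b : M → M ⊗ V ⊗ V`. -/
def cupHom (M : UqMod q) : M ⟶ tensor hq (tensor hq M (fund hq)) (fund hq) :=
  rightUnitInv hq M ≫ tensorHom hq (𝟙 M) (bHom hq) ≫ assocInv hq M (fund hq) (fund hq)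

/-- `id_M ⊗ d : M ⊗ V ⊗ V → M`. -/
def capHom (M : UqMod q) : tensor hq (tensor hq M (fund hq)) (fund hq) ⟶ M :=
  assoc hq M (fund hq) (fund hq) ≫ tensorHom hq (𝟙 M) (dHom hq) ≫ rightUnit hq M

theorem cupHom_apply (M : UqMod q) (x : M) : lin (cupHom hq M) x =
    ((x ⊗ₜ v1 hq) ⊗ₜ v0 hq - q • ((x ⊗ₜ v0 hq) ⊗ₜ v1 hq) :
      (M ⊗[ℂ] fund hq) ⊗[ℂ] fund hq) := by
  change (TensorProduct.assoc ℂ M (fund hq) (fund hq)).symm (TensorProduct.map LinearMap.id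
    (LinearMap.toSpanSingleton ℂ (fund hq ⊗[ℂ] fund hq) (bVec hq))
    ((TensorProduct.rid ℂ M).symm x)) = _
  simp [bVec, TensorProduct.tmul_sub, TensorProduct.tmul_smul]

theorem capHom_apply (M : UqMod q) (x : M) (w w' : fund hq) :
    lin (capHom hq M) ((x ⊗ₜ w) ⊗ₜ w' : (M ⊗[ℂ] fund hq) ⊗[ℂ] fund hq) = dForm q w w' • x := by
  change (TensorProduct.rid ℂ M) (TensorProduct.map LinearMap.id
    (TensorProduct.lift (dForm q)) ((TensorProduct.assoc ℂ M (fund hq) (fund hq))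
    ((x ⊗ₜ w) ⊗ₜ w'))) = _
  simp

end UqMod

namespace UqMod

section Slices

variable {a : ℂ} (ha : IsGeneric a)

/-- `x ⊗ w ∈ V^{⊗ (k+1)}` for `x ∈ V^{⊗ k}` and `w ∈ V`. -/
def snoc (k : ℕ) : tpow ha.sq k →ₗ[ℂ] fund ha.sq →ₗ[ℂ] tpow ha.sq (k + 1) :=
  TensorProduct.mk ℂ (tpow ha.sq k) (fund ha.sq)

theorem snoc_ext {k : ℕ} {M : Type*} [AddCommGroup M] [Module ℂ M]
    {f g : tpow ha.sq (k + 1) →ₗ[ℂ] M} (h : ∀ x w, f (snoc ha k x w) = g (snoc ha k x w)) :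
    f = g := TensorProduct.ext' h

theorem tmul_snoc_ext {k : ℕ} {M N : Type*} [AddCommGroup M] [Module ℂ M] [AddCommGroup N]
    [Module ℂ N] {f g : N ⊗[ℂ] tpow ha.sq (k + 1) →ₗ[ℂ] M}
    (h : ∀ z x w, f (z ⊗ₜ snoc ha k x w) = g (z ⊗ₜ snoc ha k x w)) : f = g :=
  TensorProduct.ext (LinearMap.ext fun z => snoc_ext ha fun x w => h z x w)

/-- `id ⊗ b : V^{⊗ i} → V^{⊗ (i+2)}`. -/
def cupT (i : ℕ) : tpow ha.sq i ⟶ tpow ha.sq (i + 2) := cupHom ha.sq (tpow ha.sq i)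

/-- `id ⊗ d : V^{⊗ (i+2)} → V^{⊗ i}`. -/
def capT (i : ℕ) : tpow ha.sq (i + 2) ⟶ tpow ha.sq i := capHom ha.sq (tpow ha.sq i)

/-- `f ⊗ id_V`. -/
def strandT {k l : ℕ} (f : tpow ha.sq k ⟶ tpow ha.sq l) :
    tpow ha.sq (k + 1) ⟶ tpow ha.sq (l + 1) := tensorHom ha.sq f (𝟙 (fund ha.sq))

theorem cupT_apply (i : ℕ) (x : tpow ha.sq i) : lin (cupT ha i) x =
    snoc ha (i + 1) (snoc ha i x (v1 ha.sq)) (v0 ha.sq)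
      - (a ^ 2) • snoc ha (i + 1) (snoc ha i x (v0 ha.sq)) (v1 ha.sq) :=
  cupHom_apply ha.sq (tpow ha.sq i) x

theorem capT_apply (i : ℕ) (x : tpow ha.sq i) (w w' : fund ha.sq) :
    lin (capT ha i) (snoc ha (i + 1) (snoc ha i x w) w') = dForm (a ^ 2) w w' • x :=
  capHom_apply ha.sq (tpow ha.sq i) x w w'

theorem strandT_apply {k l : ℕ} (f : tpow ha.sq k ⟶ tpow ha.sq l) (x : tpow ha.sq k)
    (w : fund ha.sq) : lin (strandT ha f) (snoc ha k x w) = snoc ha l (lin f x) w := rfl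

/-- The value of the functor on an elementary piece with `i` strands on its left: `id ⊗ b`,
`id ⊗ d`, and the braiding `c_{V,V} = a id + a⁻¹ b d` and its inverse. -/
def pieceHom (i : ℕ) : (g : Piece) →
    (tpow ha.sq (i + g.src) ⟶ tpow ha.sq (i + g.tgt))
  | .cup => cupT ha i
  | .cap => capT ha i
  | .pos => a • 𝟙 (tpow ha.sq (i + 2)) + a⁻¹ • (capT ha i ≫ cupT ha i)
  | .neg => a⁻¹ • 𝟙 (tpow ha.sq (i + 2)) + a • (capT ha i ≫ cupT ha i)

/-- `f ⊗ id_{V^{⊗ p}}`. -/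
def rightHom {k l : ℕ} (f : tpow ha.sq k ⟶ tpow ha.sq l) :
    (p : ℕ) → (tpow ha.sq (k + p) ⟶ tpow ha.sq (l + p))
  | 0 => f
  | p + 1 => strandT ha (rightHom f p)

/-- The value of the functor on a slice. -/
def sliceHom {n m : ℕ} (i : ℕ) (g : Piece) (j : ℕ) (hn : n = i + g.src + j)
    (hm : m = i + g.tgt + j) : tpow ha.sq n ⟶ tpow ha.sq m :=
  eqToHom (by rw [hn]) ≫ rightHom ha (pieceHom ha i g) j ≫ eqToHom (by rw [hm])

/-- The value of the functor on a diagram. -/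
def diagramHom {k : ℕ} : {l : ℕ} → Diagram k l → (tpow ha.sq k ⟶ tpow ha.sq l)
  | _, .vert _ => 𝟙 _
  | _, .stack D i g j hn hm => diagramHom D ≫ sliceHom ha i g j hn hm

theorem diagramHom_comp {k l m : ℕ} (D : Diagram l m) (D' : Diagram k l) :
    diagramHom ha (D.comp D') = diagramHom ha D' ≫ diagramHom ha D := by
  induction D with
  | vert => simp [diagramHom, Diagram.comp]
  | stack D i g j hn hm ih => simp [diagramHom, Diagram.comp, ih]

theorem diagramHom_slice (i : ℕ) (g : Piece) (j : ℕ) :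
    diagramHom ha (.slice i g j) = rightHom ha (pieceHom ha i g) j := by
  simp [diagramHom, Diagram.slice, sliceHom]

theorem sliceHom_succ {n m : ℕ} (i : ℕ) (g : Piece) (j : ℕ) (hn : n = i + g.src + j)
    (hm : m = i + g.tgt + j) :
    sliceHom ha (n := n + 1) (m := m + 1) i g (j + 1) (congrArg (· + 1) hn)
      (congrArg (· + 1) hm) = strandT ha (sliceHom ha i g j hn hm) := by
  subst hn hm
  have h1 : sliceHom ha i g j rfl rfl = rightHom ha (pieceHom ha i g) j := by
    simp only [sliceHom, eqToHom_refl, Category.id_comp, Category.comp_id]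
  rw [h1]
  change 𝟙 _ ≫ rightHom ha (pieceHom ha i g) (j + 1) ≫ 𝟙 _ = _
  rw [Category.id_comp, Category.comp_id]
  rfl

theorem rightHom_comp {k l m : ℕ} (f : tpow ha.sq k ⟶ tpow ha.sq l)
    (g : tpow ha.sq l ⟶ tpow ha.sq m) (p : ℕ) :
    rightHom ha (f ≫ g) p = rightHom ha f p ≫ rightHom ha g p := by
  induction p with
  | zero => rfl
  | succ p ih =>
    simp only [rightHom, ih]
    exact hom_ext (snoc_ext ha fun x w => rfl)

theorem rightHom_id (k p : ℕ) : rightHom ha (𝟙 (tpow ha.sq k)) p = 𝟙 (tpow ha.sq (k + p)) := by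
  induction p with
  | zero => rfl
  | succ p ih =>
    simp only [rightHom, ih]
    exact hom_ext (snoc_ext ha fun x w => rfl)

theorem rightHom_slice {n m : ℕ} (i : ℕ) (g : Piece) (j p : ℕ) (hn : n = i + g.src + j)
    (hm : m = i + g.tgt + j) :
    rightHom ha (sliceHom ha i g j hn hm) p =
      sliceHom ha i g (j + p) (by omega) (by omega) := by
  induction p with
  | zero => rfl
  | succ p ih => rw [rightHom, ih]; exact (sliceHom_succ ..).symm

theorem diagramHom_whiskerRight {k l : ℕ} (D : Diagram k l) (p : ℕ) :
    diagramHom ha (D.whiskerRight p) = rightHom ha (diagramHom ha D) p := by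
  induction D with
  | vert => exact (rightHom_id ha _ p).symm
  | stack D i g j hn hm ih =>
    simp only [Diagram.whiskerRight, diagramHom, ih, rightHom_comp, rightHom_slice]

/-- The identification `V^{⊗ p} ⊗ V^{⊗ k} = V^{⊗ (p + k)}`. -/
def mulEquiv (p : ℕ) : (k : ℕ) →
    (tpow ha.sq p ⊗[ℂ] tpow ha.sq k) ≃ₗ[ℂ] tpow ha.sq (p + k)
  | 0 => TensorProduct.rid ℂ (tpow ha.sq p)
  | k + 1 => (TensorProduct.assoc ℂ (tpow ha.sq p) (tpow ha.sq k) (fund ha.sq)).symm ≪≫ₗ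
      TensorProduct.congr (mulEquiv p k) (LinearEquiv.refl ℂ (fund ha.sq))

theorem mulEquiv_succ (p k : ℕ) (x : tpow ha.sq p) (y : tpow ha.sq k) (w : fund ha.sq) :
    mulEquiv ha p (k + 1) (x ⊗ₜ snoc ha k y w) =
      snoc ha (p + k) (mulEquiv ha p k (x ⊗ₜ y)) w := rfl

theorem rightHom_mulEquiv {k l : ℕ} (f : tpow ha.sq k ⟶ tpow ha.sq l) (p : ℕ) :
    lin (rightHom ha f p) ∘ₗ (mulEquiv ha k p).toLinearMap =
      (mulEquiv ha l p).toLinearMap ∘ₗ TensorProduct.map (lin f) LinearMap.id := by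
  induction p with
  | zero => exact TensorProduct.ext' fun x c => map_smul (lin f) (show ℂ from c) x
  | succ p ih =>
    refine tmul_snoc_ext ha fun x y w => ?_
    exact congrArg (fun z => snoc ha (l + p) z w) (LinearMap.congr_fun ih (x ⊗ₜ y))

theorem cupT_mulEquiv (p i : ℕ) (x : tpow ha.sq p ⊗[ℂ] tpow ha.sq i) :
    lin (cupT ha (p + i)) (mulEquiv ha p i x) =
      mulEquiv ha p (i + 2) (TensorProduct.map LinearMap.id (lin (cupT ha i)) x) := by
  refine LinearMap.congr_fun (f := lin (cupT ha (p + i)) ∘ₗ (mulEquiv ha p i).toLinearMap)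
    (g := (mulEquiv ha p (i + 2)).toLinearMap ∘ₗ
      TensorProduct.map LinearMap.id (lin (cupT ha i))) (TensorProduct.ext' fun x y => ?_) x
  simp only [LinearMap.comp_apply, LinearEquiv.coe_coe, TensorProduct.map_tmul, cupT_apply,
    TensorProduct.tmul_sub, TensorProduct.tmul_smul, map_sub, map_smul,
    LinearMap.id_apply]
  rfl

theorem capT_mulEquiv (p i : ℕ) (x : tpow ha.sq p ⊗[ℂ] tpow ha.sq (i + 2)) :
    lin (capT ha (p + i)) (mulEquiv ha p (i + 2) x) =
      mulEquiv ha p i (TensorProduct.map LinearMap.id (lin (capT ha i)) x) := by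
  refine LinearMap.congr_fun (f := lin (capT ha (p + i)) ∘ₗ (mulEquiv ha p (i + 2)).toLinearMap)
    (g := (mulEquiv ha p i).toLinearMap ∘ₗ
      TensorProduct.map LinearMap.id (lin (capT ha i)))
    (TensorProduct.ext (LinearMap.ext fun x => snoc_ext ha fun z w' => LinearMap.congr_fun
      (f := ((lin (capT ha (p + i)) ∘ₗ (mulEquiv ha p (i + 2)).toLinearMap) ∘ₗ
        TensorProduct.mk ℂ _ _ x) ∘ₗ (snoc ha (i + 1)).flip w')
      (g := (((mulEquiv ha p i).toLinearMap ∘ₗ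
        TensorProduct.map LinearMap.id (lin (capT ha i))) ∘ₗ
        TensorProduct.mk ℂ _ _ x) ∘ₗ (snoc ha (i + 1)).flip w')
      (snoc_ext ha fun y w => ?_) z)) x
  refine (capT_apply ha (p + i) (mulEquiv ha p i (x ⊗ₜ y)) w w').trans ?_
  refine Eq.trans ?_
    (congrArg (fun z => mulEquiv ha p i (x ⊗ₜ[ℂ] z)) (capT_apply ha i y w w')).symm
  rw [TensorProduct.tmul_smul, map_smul]

theorem mix_mulEquiv (c d : ℂ) (p i : ℕ) (x : tpow ha.sq p ⊗[ℂ] tpow ha.sq (i + 2)) :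
    lin (c • 𝟙 (tpow ha.sq (p + i + 2)) + d • (capT ha (p + i) ≫ cupT ha (p + i)))
      (mulEquiv ha p (i + 2) x) = mulEquiv ha p (i + 2) (TensorProduct.map LinearMap.id
        (lin (c • 𝟙 (tpow ha.sq (i + 2)) + d • (capT ha i ≫ cupT ha i))) x) := by
  have h : TensorProduct.map LinearMap.id (lin (cupT ha i))
      (TensorProduct.map LinearMap.id (lin (capT ha i)) x) =
      TensorProduct.map (LinearMap.id : tpow ha.sq p →ₗ[ℂ] tpow ha.sq p)
        (lin (capT ha i ≫ cupT ha i)) x := by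
    rw [← LinearMap.comp_apply, ← TensorProduct.map_comp]; rfl
  rw [lin_add, lin_smul, lin_smul, lin_id, lin_add, lin_smul, lin_smul, lin_id,
    TensorProduct.map_add_right, TensorProduct.map_smul_right, TensorProduct.map_smul_right,
    TensorProduct.map_id, lin_comp]
  simp only [LinearMap.comp_apply, LinearMap.add_apply, LinearMap.smul_apply, map_add, map_smul,
    LinearMap.id_apply, capT_mulEquiv, cupT_mulEquiv, h]

theorem sliceHom_mulEquiv (p : ℕ) {n m : ℕ} (i : ℕ) (g : Piece) (j : ℕ) (hn : n = i + g.src + j)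
    (hm : m = i + g.tgt + j) :
    lin (sliceHom ha (p + i) g j (n := p + n) (m := p + m) (by omega) (by omega)) ∘ₗ
        (mulEquiv ha p n).toLinearMap =
      (mulEquiv ha p m).toLinearMap ∘ₗ
        TensorProduct.map LinearMap.id (lin (sliceHom ha i g j hn hm)) := by
  subst hn hm
  induction j with
  | zero =>
    refine LinearMap.ext fun x => ?_
    have h1 : ∀ {k l : ℕ} (f : tpow ha.sq k ⟶ tpow ha.sq l), 𝟙 _ ≫ f ≫ 𝟙 _ = f := by
      intro k l f; simp
    cases g with
    | cup => exact ((congrArg (fun f => lin f (mulEquiv ha p i x)) (h1 _)).trans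
        (cupT_mulEquiv ha p i x)).trans (congrArg (fun f => mulEquiv ha p (i + 2)
          (TensorProduct.map LinearMap.id (lin f) x)) (h1 (cupT ha i)).symm)
    | cap => exact ((congrArg (fun f => lin f (mulEquiv ha p (i + 2) x)) (h1 _)).trans
        (capT_mulEquiv ha p i x)).trans (congrArg (fun f => mulEquiv ha p i
          (TensorProduct.map LinearMap.id (lin f) x)) (h1 (capT ha i)).symm)
    | pos => exact ((congrArg (fun f => lin f (mulEquiv ha p (i + 2) x)) (h1 _)).trans
        (mix_mulEquiv ha a a⁻¹ p i x)).trans (congrArg (fun f => mulEquiv ha p (i + 2)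
          (TensorProduct.map LinearMap.id (lin f) x)) (h1 (pieceHom ha i .pos)).symm)
    | neg => exact ((congrArg (fun f => lin f (mulEquiv ha p (i + 2) x)) (h1 _)).trans
        (mix_mulEquiv ha a⁻¹ a p i x)).trans (congrArg (fun f => mulEquiv ha p (i + 2)
          (TensorProduct.map LinearMap.id (lin f) x)) (h1 (pieceHom ha i .neg)).symm)
  | succ j ih =>
    have e1 := congrArg lin (sliceHom_succ ha (n := p + (i + g.src + j))
      (m := p + (i + g.tgt + j)) (p + i) g j (by omega) (by omega))
    have e2 := congrArg lin (sliceHom_succ ha i g j (n := i + g.src + j) (m := i + g.tgt + j)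
      rfl rfl)
    refine tmul_snoc_ext ha (k := i + g.src + j) fun x y w => ?_
    have h := LinearMap.congr_fun ih (x ⊗ₜ y)
    refine (LinearMap.congr_fun e1 (snoc ha _ (mulEquiv ha p _ (x ⊗ₜ y)) w)).trans ?_
    refine Eq.trans ?_ (congrArg (fun z => mulEquiv ha p (i + g.tgt + j + 1) (x ⊗ₜ z))
      (LinearMap.congr_fun e2 (snoc ha _ y w)).symm)
    exact congrArg (fun z => snoc ha _ z w) h

/-- `id_{V^{⊗ p}} ⊗ f`, as a linear map. -/
def leftLin (p : ℕ) {k l : ℕ} (f : tpow ha.sq k →ₗ[ℂ] tpow ha.sq l) :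
    tpow ha.sq (p + k) →ₗ[ℂ] tpow ha.sq (p + l) :=
  (mulEquiv ha p l).toLinearMap ∘ₗ TensorProduct.map LinearMap.id f ∘ₗ
    (mulEquiv ha p k).symm.toLinearMap

theorem leftLin_comp (p : ℕ) {k l m : ℕ} (f : tpow ha.sq k →ₗ[ℂ] tpow ha.sq l)
    (g : tpow ha.sq l →ₗ[ℂ] tpow ha.sq m) :
    leftLin ha p (g ∘ₗ f) = leftLin ha p g ∘ₗ leftLin ha p f := by
  refine LinearMap.ext fun x => ?_
  simp only [leftLin, LinearMap.comp_apply, LinearEquiv.coe_coe, LinearEquiv.symm_apply_apply]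
  rw [← LinearMap.comp_apply (TensorProduct.map _ _), ← TensorProduct.map_comp]
  rfl

theorem diagramHom_whiskerLeft {k l : ℕ} (D : Diagram k l) (p : ℕ) :
    lin (diagramHom ha (D.whiskerLeft p)) = leftLin ha p (lin (diagramHom ha D)) := by
  induction D with
  | vert =>
    refine LinearMap.ext fun x => ?_
    simp only [Diagram.whiskerLeft, diagramHom, lin_id, leftLin, TensorProduct.map_id,
      LinearMap.comp_apply, LinearMap.id_apply, LinearEquiv.coe_coe, LinearEquiv.apply_symm_apply]
  | stack D i g j hn hm ih =>
    simp only [Diagram.whiskerLeft, diagramHom, lin_comp, leftLin_comp, ih]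
    congr 1
    refine LinearMap.ext fun x => ?_
    have := LinearMap.congr_fun (sliceHom_mulEquiv ha p i g j hn hm) ((mulEquiv ha p _).symm x)
    simp only [LinearMap.comp_apply, LinearEquiv.coe_coe, LinearEquiv.apply_symm_apply] at this
    exact this

theorem rightHom_eq {k l : ℕ} (f : tpow ha.sq k ⟶ tpow ha.sq l) (p : ℕ) :
    lin (rightHom ha f p) = (mulEquiv ha l p).toLinearMap ∘ₗ
      TensorProduct.map (lin f) LinearMap.id ∘ₗ (mulEquiv ha k p).symm.toLinearMap := by
  refine LinearMap.ext fun x => ?_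
  have := LinearMap.congr_fun (rightHom_mulEquiv ha f p) ((mulEquiv ha k p).symm x)
  simp only [LinearMap.comp_apply, LinearEquiv.coe_coe, LinearEquiv.apply_symm_apply] at this ⊢
  exact this

theorem zigzag_left : cupT ha 1 ≫ strandT ha (capT ha 0) = 𝟙 (tpow ha.sq 1) := by
  refine hom_ext (snoc_ext ha fun x w => ?_)
  have ha0 := ha.1
  have h2 : dForm (a ^ 2) w (v1 ha.sq) = w 0 := by simp [dForm, v1]
  have h3 : dForm (a ^ 2) w (v0 ha.sq) = - ((a ^ 2)⁻¹ * w 1) := by simp [dForm, v0]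
  have h (u u' : fund ha.sq) :
      lin (strandT ha (capT ha 0)) (snoc ha 2 (snoc ha 1 (snoc ha 0 x w) u) u') =
        snoc ha 0 (dForm (a ^ 2) w u • x) u' :=
    congrArg (fun z => snoc ha 0 z u') (capT_apply ha 0 x w u)
  have e : lin (cupT ha 1 ≫ strandT ha (capT ha 0)) (snoc ha 0 x w) =
      snoc ha 0 (dForm (a ^ 2) w (v1 ha.sq) • x) (v0 ha.sq)
        - (a ^ 2) • snoc ha 0 (dForm (a ^ 2) w (v0 ha.sq) • x) (v1 ha.sq) := by
    rw [← h, ← h]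
    refine (congrArg (lin (strandT ha (capT ha 0))) (cupT_apply ha 1 (snoc ha 0 x w))).trans ?_
    rw [map_sub, map_smul]
  refine e.trans ?_
  change _ = snoc ha 0 x w
  conv_rhs => rw [fund_eq ha.sq w, map_add, map_smul, map_smul]
  rw [h2, h3, map_smul, map_smul, LinearMap.smul_apply, LinearMap.smul_apply, smul_smul,
    sub_eq_add_neg, ← neg_smul]
  congr 2
  field_simp

theorem zigzag_right : strandT ha (cupT ha 0) ≫ capT ha 1 = 𝟙 (tpow ha.sq 1) := by
  refine hom_ext (snoc_ext ha fun x w => ?_)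
  have ha0 := ha.1
  have h2 : dForm (a ^ 2) (v0 ha.sq) w = w 1 := by simp [dForm, v0]
  have h3 : dForm (a ^ 2) (v1 ha.sq) w = - ((a ^ 2)⁻¹ * w 0) := by simp [dForm, v1]
  have h (u u' : fund ha.sq) :
      lin (capT ha 1) (snoc ha 2 (snoc ha 1 (snoc ha 0 x u) u') w) =
        dForm (a ^ 2) u' w • snoc ha 0 x u := capT_apply ha 1 (snoc ha 0 x u) u' w
  have e : lin (strandT ha (cupT ha 0) ≫ capT ha 1) (snoc ha 0 x w) =
      dForm (a ^ 2) (v0 ha.sq) w • snoc ha 0 x (v1 ha.sq)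
        - (a ^ 2) • dForm (a ^ 2) (v1 ha.sq) w • snoc ha 0 x (v0 ha.sq) := by
    rw [← h, ← h]
    refine (congrArg (fun z => lin (capT ha 1) (snoc ha 2 z w)) (cupT_apply ha 0 x)).trans ?_
    rw [map_sub, map_smul, LinearMap.sub_apply, LinearMap.smul_apply, map_sub, map_smul]
  refine e.trans ?_
  change _ = snoc ha 0 x w
  conv_rhs => rw [fund_eq ha.sq w, map_add, map_smul, map_smul]
  rw [h2, h3, smul_smul, sub_eq_add_neg, ← neg_smul]
  refine (add_comm _ _).trans ?_
  congr 2
  field_simp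

theorem cup_cap : cupT ha 0 ≫ capT ha 0 = (-(a ^ 2 + (a ^ 2)⁻¹)) • 𝟙 (tpow ha.sq 0) := by
  refine hom_ext (LinearMap.ext fun x => ?_)
  have h2 : dForm (a ^ 2) (v0 ha.sq) (v1 ha.sq) = 1 := by simp [dForm, v0, v1]
  have h3 : dForm (a ^ 2) (v1 ha.sq) (v0 ha.sq) = - (a ^ 2)⁻¹ := by simp [dForm, v0, v1]
  have h := capT_apply ha 0 x
  refine (congrArg (lin (capT ha 0)) (cupT_apply ha 0 x)).trans ?_
  rw [map_sub, map_smul]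
  refine (congrArg₂ (fun y z => y - a ^ 2 • z) (h (v1 ha.sq) (v0 ha.sq))
    (h (v0 ha.sq) (v1 ha.sq))).trans ?_
  change _ = (-(a ^ 2 + (a ^ 2)⁻¹)) • x
  rw [h2, h3]
  rw [one_smul, ← sub_smul]
  congr 1
  ring

end Slices

end UqMod

namespace UqMod

section Invariance

variable {a : ℂ} (ha : IsGeneric a)

theorem strandT_mix {k l : ℕ} (c d : ℂ) (f : tpow ha.sq k ⟶ tpow ha.sq l)
    (g : tpow ha.sq l ⟶ tpow ha.sq k) :
    strandT ha (c • 𝟙 (tpow ha.sq k) + d • (f ≫ g)) =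
      c • 𝟙 (tpow ha.sq (k + 1)) + d • (strandT ha f ≫ strandT ha g) := by
  refine hom_ext (snoc_ext ha fun x w => ?_)
  rw [strandT_apply]
  simp only [lin_add, lin_smul, lin_id, lin_comp, LinearMap.add_apply, LinearMap.smul_apply,
    LinearMap.id_apply, LinearMap.comp_apply, map_add, map_smul]
  rfl

theorem mix_comp {C : Type*} [Category C] [Preadditive C] [Linear ℂ C] {A B : C} {c₁ c₂ : B ⟶ A}
    {u₁ u₂ : A ⟶ B} (h₁ : u₂ ≫ c₁ = 𝟙 A) (h₂ : u₁ ≫ c₂ = 𝟙 A) (c d : ℂ) :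
    (c • 𝟙 B + d • (c₂ ≫ u₂)) ≫ c₁ = (d • 𝟙 B + c • (c₁ ≫ u₁)) ≫ c₂ := by
  simp [h₁, h₂, add_comm]

theorem comp_mix {C : Type*} [Category C] [Preadditive C] [Linear ℂ C] {A B : C} {c₁ c₂ : B ⟶ A}
    {u₁ u₂ : A ⟶ B} (h₁ : u₂ ≫ c₁ = 𝟙 A) (h₂ : u₁ ≫ c₂ = 𝟙 A) (c d : ℂ) :
    u₁ ≫ (c • 𝟙 B + d • (c₂ ≫ u₂)) = u₂ ≫ (d • 𝟙 B + c • (c₁ ≫ u₁)) := by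
  rw [Preadditive.comp_add, Preadditive.comp_add, Linear.comp_smul, Linear.comp_smul,
    Linear.comp_smul, Linear.comp_smul, ← Category.assoc, ← Category.assoc, h₁, h₂]
  simp [add_comm]

theorem cap_mix (c d : ℂ) :
    (c • 𝟙 (tpow ha.sq 3) + d • (capT ha 1 ≫ cupT ha 1)) ≫ strandT ha (capT ha 0) =
      strandT ha (d • 𝟙 (tpow ha.sq 2) + c • (capT ha 0 ≫ cupT ha 0)) ≫ capT ha 1 := by
  rw [strandT_mix]
  exact mix_comp (zigzag_left ha) (zigzag_right ha) c d

theorem cup_mix (c d : ℂ) :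
    strandT ha (cupT ha 0) ≫ (c • 𝟙 (tpow ha.sq 3) + d • (capT ha 1 ≫ cupT ha 1)) =
      cupT ha 1 ≫ strandT ha (d • 𝟙 (tpow ha.sq 2) + c • (capT ha 0 ≫ cupT ha 0)) := by
  rw [strandT_mix]
  exact comp_mix (zigzag_left ha) (zigzag_right ha) c d

theorem diagramHom_comp_eq {k l m : ℕ} {D : Diagram l m} {D' : Diagram k l}
    {f : tpow ha.sq l ⟶ tpow ha.sq m} {g : tpow ha.sq k ⟶ tpow ha.sq l}
    (h : diagramHom ha D = f) (h' : diagramHom ha D' = g) :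
    diagramHom ha (D.comp D') = g ≫ f := by
  rw [diagramHom_comp, h, h']

theorem diagramHom_isotopic {k l : ℕ} {D D' : Diagram k l} (h : Isotopic D D') :
    diagramHom ha D = diagramHom ha D' := by
  induction h with
  | refl => rfl
  | symm _ ih => exact ih.symm
  | trans _ _ ih ih' => exact ih.trans ih'
  | comp _ _ ih ih' => rw [diagramHom_comp, diagramHom_comp, ih, ih']
  | whiskerLeft p _ ih =>
    exact hom_ext (by rw [diagramHom_whiskerLeft, diagramHom_whiskerLeft, ih])
  | whiskerRight p _ ih => rw [diagramHom_whiskerRight, diagramHom_whiskerRight, ih]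
  | exchange D F =>
    refine hom_ext ?_
    rw [diagramHom_comp, diagramHom_comp, lin_comp, lin_comp, diagramHom_whiskerLeft,
      diagramHom_whiskerLeft, diagramHom_whiskerRight, diagramHom_whiskerRight, rightHom_eq,
      rightHom_eq]
    refine LinearMap.ext fun x => ?_
    simp only [leftLin, LinearMap.comp_apply, LinearEquiv.coe_coe, LinearEquiv.symm_apply_apply]
    rw [← LinearMap.comp_apply (TensorProduct.map _ _), ← TensorProduct.map_comp,
      ← LinearMap.comp_apply (TensorProduct.map _ _), ← TensorProduct.map_comp]
    rfl
  | zigzag_left =>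
    exact (diagramHom_comp_eq ha (diagramHom_slice ha 0 .cap 1)
      (diagramHom_slice ha 1 .cup 0)).trans (zigzag_left ha)
  | zigzag_right =>
    exact (diagramHom_comp_eq ha (diagramHom_slice ha 1 .cap 0)
      (diagramHom_slice ha 0 .cup 1)).trans (zigzag_right ha)
  | cap_pos =>
    exact (diagramHom_comp_eq ha (diagramHom_slice ha 0 .cap 1) (diagramHom_slice ha 1 .pos 0)).trans
      ((cap_mix ha a a⁻¹).trans (diagramHom_comp_eq ha (diagramHom_slice ha 1 .cap 0)
        (diagramHom_slice ha 0 .neg 1)).symm)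
  | cap_neg =>
    exact (diagramHom_comp_eq ha (diagramHom_slice ha 0 .cap 1) (diagramHom_slice ha 1 .neg 0)).trans
      ((cap_mix ha a⁻¹ a).trans (diagramHom_comp_eq ha (diagramHom_slice ha 1 .cap 0)
        (diagramHom_slice ha 0 .pos 1)).symm)
  | cup_pos =>
    exact (diagramHom_comp_eq ha (diagramHom_slice ha 1 .pos 0) (diagramHom_slice ha 0 .cup 1)).trans
      ((cup_mix ha a a⁻¹).trans (diagramHom_comp_eq ha (diagramHom_slice ha 0 .neg 1)
        (diagramHom_slice ha 1 .cup 0)).symm)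
  | cup_neg =>
    exact (diagramHom_comp_eq ha (diagramHom_slice ha 1 .neg 0) (diagramHom_slice ha 0 .cup 1)).trans
      ((cup_mix ha a⁻¹ a).trans (diagramHom_comp_eq ha (diagramHom_slice ha 0 .pos 1)
        (diagramHom_slice ha 1 .cup 0)).symm)

/-- The linear extension of `diagramHom`. -/
def evalLin (k l : ℕ) : (Diagram k l →₀ ℂ) →ₗ[ℂ] (tpow ha.sq k ⟶ tpow ha.sq l) :=
  Finsupp.linearCombination ℂ (diagramHom ha)

theorem evalLin_single {k l : ℕ} (D : Diagram k l) (c : ℂ) :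
    evalLin ha k l (Finsupp.single D c) = c • diagramHom ha D :=
  Finsupp.linearCombination_single ℂ c D

theorem lin_evalLin_whiskerLeft (p : ℕ) {k l : ℕ} (x : Diagram k l →₀ ℂ) :
    lin (evalLin ha _ _ (Finsupp.lmapDomain ℂ ℂ (fun F => F.whiskerLeft p) x)) =
      leftLin ha p (lin (evalLin ha k l x)) := by
  induction x using Finsupp.induction_linear with
  | zero => rw [map_zero, map_zero, map_zero, lin_zero, lin_zero, leftLin,
      TensorProduct.map_zero_right, LinearMap.zero_comp, LinearMap.comp_zero]
  | add x y hx hy =>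
    rw [map_add, map_add, map_add, lin_add, lin_add, hx, hy]
    simp only [leftLin, TensorProduct.map_add_right, LinearMap.add_comp, LinearMap.comp_add]
  | single D c =>
    rw [Finsupp.lmapDomain_apply, Finsupp.mapDomain_single, evalLin_single, evalLin_single,
      lin_smul, lin_smul, diagramHom_whiskerLeft]
    simp only [leftLin, TensorProduct.map_smul_right, LinearMap.smul_comp, LinearMap.comp_smul]

theorem lin_evalLin_whiskerRight (p : ℕ) {k l : ℕ} (x : Diagram k l →₀ ℂ) :
    lin (evalLin ha _ _ (Finsupp.lmapDomain ℂ ℂ (fun F => F.whiskerRight p) x)) =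
      lin (rightHom ha (evalLin ha k l x) p) := by
  rw [rightHom_eq]
  induction x using Finsupp.induction_linear with
  | zero => rw [map_zero, map_zero, map_zero, lin_zero, lin_zero,
      TensorProduct.map_zero_left, LinearMap.zero_comp, LinearMap.comp_zero]
  | add x y hx hy =>
    rw [map_add, map_add, map_add, lin_add, lin_add, hx, hy]
    simp only [TensorProduct.map_add_left, LinearMap.add_comp, LinearMap.comp_add]
  | single D c =>
    rw [Finsupp.lmapDomain_apply, Finsupp.mapDomain_single, evalLin_single, evalLin_single,
      lin_smul, lin_smul, diagramHom_whiskerRight, rightHom_eq]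
    simp only [TensorProduct.map_smul_left, LinearMap.smul_comp, LinearMap.comp_smul]

theorem evalLin_comp_left {k l m : ℕ} (D : Diagram l m) (x : Diagram k l →₀ ℂ) :
    evalLin ha _ _ (Finsupp.lmapDomain ℂ ℂ (fun F => D.comp F) x) =
      evalLin ha k l x ≫ diagramHom ha D := by
  induction x using Finsupp.induction_linear with
  | zero => rw [map_zero, map_zero, map_zero, Limits.zero_comp]
  | add x y hx hy => rw [map_add, map_add, map_add, hx, hy, Preadditive.add_comp]
  | single F c =>
    rw [Finsupp.lmapDomain_apply, Finsupp.mapDomain_single, evalLin_single, evalLin_single,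
      diagramHom_comp, Linear.smul_comp]

theorem evalLin_comp_right {k l m : ℕ} (D : Diagram k l) (x : Diagram l m →₀ ℂ) :
    evalLin ha _ _ (Finsupp.lmapDomain ℂ ℂ (fun F => F.comp D) x) =
      diagramHom ha D ≫ evalLin ha l m x := by
  induction x using Finsupp.induction_linear with
  | zero => rw [map_zero, map_zero, map_zero, Limits.comp_zero]
  | add x y hx hy => rw [map_add, map_add, map_add, hx, hy, Preadditive.comp_add]
  | single F c =>
    rw [Finsupp.lmapDomain_apply, Finsupp.mapDomain_single, evalLin_single, evalLin_single,
      diagramHom_comp, Linear.comp_smul]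

theorem diagramHom_cupCap : diagramHom ha Diagram.cupCap = capT ha 0 ≫ cupT ha 0 :=
  diagramHom_comp_eq ha (diagramHom_slice ha 0 .cup 0) (diagramHom_slice ha 0 .cap 0)

theorem evalLin_skeinRel {k l : ℕ} {x : Diagram k l →₀ ℂ} (h : SkeinRel a x) :
    evalLin ha k l x = 0 := by
  induction h with
  | isotopy h =>
    rw [map_sub, evalLin_single, evalLin_single, diagramHom_isotopic ha h, sub_self]
  | circle =>
    rw [map_add, map_smul, evalLin_single, evalLin_single, one_smul, one_smul]
    have h : diagramHom ha Diagram.circ = cupT ha 0 ≫ capT ha 0 :=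
      diagramHom_comp_eq ha (diagramHom_slice ha 0 .cap 0) (diagramHom_slice ha 0 .cup 0)
    rw [h, cup_cap]
    change _ + _ • 𝟙 (tpow ha.sq 0) = 0
    rw [← add_smul, neg_add_cancel, zero_smul]
  | kauffman_pos =>
    rw [map_sub, map_sub, map_smul, map_smul, evalLin_single, evalLin_single, evalLin_single,
      one_smul, one_smul, one_smul, diagramHom_cupCap, sub_sub, sub_eq_zero]
    exact diagramHom_slice ha 0 .pos 0
  | kauffman_neg =>
    rw [map_sub, map_sub, map_smul, map_smul, evalLin_single, evalLin_single, evalLin_single,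
      one_smul, one_smul, one_smul, diagramHom_cupCap, sub_sub, sub_eq_zero]
    exact diagramHom_slice ha 0 .neg 0
  | comp_left D _ ih => rw [evalLin_comp_left, ih, Limits.zero_comp]
  | comp_right D _ ih => rw [evalLin_comp_right, ih, Limits.comp_zero]
  | whiskerLeft p _ ih =>
    refine hom_ext ?_
    rw [lin_evalLin_whiskerLeft, ih, lin_zero, lin_zero, leftLin, TensorProduct.map_zero_right,
      LinearMap.zero_comp, LinearMap.comp_zero]
  | whiskerRight p _ ih =>
    refine hom_ext ?_
    rw [lin_evalLin_whiskerRight, ih, rightHom_eq, lin_zero, lin_zero,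
      TensorProduct.map_zero_left, LinearMap.zero_comp, LinearMap.comp_zero]

/-- The functor `ℱ` on morphisms of the Temperley–Lieb category. -/
def skeinHom {k l : ℕ} : Skein a k l →ₗ[ℂ] (tpow ha.sq k ⟶ tpow ha.sq l) :=
  Skein.desc (evalLin ha k l) fun _ => evalLin_skeinRel ha

theorem skeinHom_of {k l : ℕ} (D : Diagram k l) :
    skeinHom ha (Skein.of a D) = diagramHom ha D :=
  (Skein.desc_of _ _ D).trans ((evalLin_single ha D 1).trans (one_smul _ _))

theorem skeinHom_one (n : ℕ) : skeinHom ha (Skein.one a n) = 𝟙 (tpow ha.sq n) :=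
  skeinHom_of ha _

theorem skeinHom_comp {k l m : ℕ} (x : Skein a l m) (y : Skein a k l) :
    skeinHom ha (Skein.comp x y) = skeinHom ha y ≫ skeinHom ha x := by
  induction x using Skein.induction with
  | zero => simp
  | add x x' hx hx' =>
    rw [map_add, LinearMap.add_apply, map_add, map_add, hx, hx', Preadditive.comp_add]
  | smul c D =>
    induction y using Skein.induction with
    | zero => simp
    | add y y' hy hy' => rw [map_add, map_add, map_add, hy, hy', Preadditive.add_comp]
    | smul d F =>
      simp only [map_smul, LinearMap.smul_apply, Skein.comp_of, skeinHom_of, diagramHom_comp,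
        Linear.smul_comp, Linear.comp_smul]
      rw [smul_comm]

/-- The image of an endomorphism, as a submodule. -/
def image {q : ℂ} {M : UqMod q} (f : M ⟶ M) : UqMod q where
  carrier := LinearMap.range (lin f)
  ρ := AlgHom.ofLinearMap
    { toFun := fun u => (M.ρ u).restrict (p := LinearMap.range (lin f))
        (q := LinearMap.range (lin f)) (by
          rintro _ ⟨x, rfl⟩
          exact ⟨M.ρ u x, lin_comm f u x⟩)
      map_add' := fun u v => LinearMap.ext fun x => Subtype.ext (by simp)
      map_smul' := fun c u => LinearMap.ext fun x => Subtype.ext (by simp) }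
    (LinearMap.ext fun x => Subtype.ext (by simp))
    (fun u v => LinearMap.ext fun x => Subtype.ext (by simp))

end Invariance

end UqMod

/-- The functor `ℱ : 𝒮(a) → U_q(sl₂)`-modules, `q = a²`, with `ℱ(n) = V^{⊗ n}`. -/
def tlFunctor {a : ℂ} (ha : IsGeneric a) : TL a ⥤ UqMod (a ^ 2) where
  obj n := UqMod.tpow ha.sq n.strands
  map f := UqMod.skeinHom ha f
  map_id n := UqMod.skeinHom_one ha n.strands
  map_comp f g := UqMod.skeinHom_comp ha g f

/-- The functor `ℱ : 𝒱(a) → U_q(sl₂)`-modules, `q = a²`: the object `s` is sent to the submodule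
`ℱ(f_s) V^{⊗ |s|}` of `V^{⊗ |s|}`, and a morphism `f : s ⟶ t` to the restriction of
`ℱ(f) : V^{⊗ |s|} → V^{⊗ |t|}`. -/
def turaevFunctor {a : ℂ} (ha : IsGeneric a) : TuraevCat a ⥤ UqMod (a ^ 2) where
  obj s := UqMod.image (UqMod.skeinHom ha (TuraevCat.idem a s.seq))
  map {s t} f :=
    ⟨(UqMod.lin (UqMod.skeinHom ha f.1)).restrict
      (p := LinearMap.range (UqMod.lin (UqMod.skeinHom ha (TuraevCat.idem a s.seq))))
      (q := LinearMap.range (UqMod.lin (UqMod.skeinHom ha (TuraevCat.idem a t.seq)))) (by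
        intro x _
        refine ⟨UqMod.lin (UqMod.skeinHom ha f.1) x, ?_⟩
        have h := UqMod.skeinHom_comp ha (TuraevCat.idem a t.seq) f.1
        rw [TuraevCat.idem_comp f.2] at h
        exact (LinearMap.congr_fun (congrArg UqMod.lin h) x).symm),
      fun u x => Subtype.ext (UqMod.lin_comm (UqMod.skeinHom ha f.1) u x.1)⟩
  map_id s := UqMod.hom_ext (LinearMap.ext fun x => Subtype.ext (by
    obtain ⟨_, x, rfl⟩ := x
    have h := UqMod.skeinHom_comp ha (TuraevCat.idem a s.seq) (TuraevCat.idem a s.seq)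
    rw [TuraevCat.idem_comp_idem] at h
    exact (LinearMap.congr_fun (congrArg UqMod.lin h) x).symm))
  map_comp f g := UqMod.hom_ext (LinearMap.ext fun x => Subtype.ext
    (LinearMap.congr_fun (congrArg UqMod.lin (UqMod.skeinHom_comp ha g.1 f.1)) x.1))

namespace UqMod

/-- The tensor product `V_{n₁} ⊗ ⋯ ⊗ V_{n_m}`. -/
def tensorSimple {q : ℂ} (hq : IsGeneric q) : List ℕ → UqMod q
  | [] => triv q
  | n :: l => tensor hq (simple hq n) (tensorSimple hq l)

/-- The objects of `ℛ(q)`: the modules isomorphic to a tensor product of modules `V_n`. -/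
def isTensorSimple {q : ℂ} (hq : IsGeneric q) : ObjectProperty (UqMod q) :=
  fun M => ∃ l : List ℕ, Nonempty (M ≅ tensorSimple hq l)

end UqMod

/-- The category `ℛ(q)`: the full subcategory of the category of finite-dimensional
`U_q(sl₂)`-modules whose objects are the tensor products of modules `V_n`. -/
abbrev RepCat {q : ℂ} (hq : IsGeneric q) := (UqMod.isTensorSimple hq).FullSubcategory

end

/-!
The functor `ℱ` is fully faithful on the whole category `𝒮(a)`; passing to images of idempotents
then gives the statement for `𝒱(a)`. No dimension of a skein space or of a space of invariants is
computed: the proof compares both sides through the Jones–Wenzl idempotents.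

*Jones–Wenzl idempotents.* They are constructed by Wenzl's recursion (`Skein.wenzl`). The induction
carries the value `-[n+2]/[n+1]` of the partial trace of `f_{n+1}` (`Skein.WenzlPair`), which is
nonzero for generic `a`. Uniqueness is formal: two such elements satisfy `f = f g = g`.

*Skeins.* Read backwards, the recursion writes `f_n ⊗ 1` as the sum of `f_{n+1}` and a skein that
factors through `f_{n-1}`, so by induction the identity of every object of `𝒮(a)` is a sum of skeins
`x f_m y` (`Skein.one_mem_wenzlIdeal`). On the other hand every skein is a combination of diagrams
in which all minima lie above all maxima (`Skein.mem_normalSpan`), whence `f_m g f_n = 0` for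
`m ≠ n` and `f_n g f_n ∈ ℂ f_n`.

*Modules.* The vector `v_0` of `V_n` is the only highest weight vector up to scalars and generates
`V_n`, so there are no nonzero morphisms `V_m → V_n` for `m ≠ n`, and the endomorphisms of `V_n` are
scalars. The image of `ℱ(f_n)` is the space of vectors of `V^{⊗ n}` killed by all operators
`1 ⊗ d ⊗ 1`, and an explicit embedding identifies `V_n` with this space (`UqMod.range_symEmb`). Thus
`ℱ(f_n)` is a projection onto a copy of `V_n` (`UqMod.wenzl_splitsAs`), and `ℱ(f_s)` one onto a copy
of `V_{n₁} ⊗ ⋯ ⊗ V_{n_m}` (`UqMod.idem_splitsAs`).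

*Full faithfulness.* Insert the decompositions of the identities of the two objects on both sides of
a skein `x` or of a morphism `φ` of modules. Each middle part is a multiple of `f_n`, respectively
of `ℱ(f_n) ≠ 0`, or zero, so `ℱ(x) = 0` forces `x = 0`, and `φ` is in the image of `ℱ`.
-/

noncomputable section

/-! ### Relations between cups and caps -/

namespace Skein

variable {a : ℂ} {k l m n : ℕ}

/-- A local minimum with `i` vertical strands on its left and `j` on its right. The numbers of
endpoints are kept as free variables, so that no casts between skein spaces are needed. -/
def cup (a : ℂ) {n m : ℕ} (i j : ℕ) (hn : n = i + j) (hm : m = i + 2 + j) : Skein a n m :=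
  of a (.stack (.vert n) i .cup j (by simpa [Piece.src] using hn) hm)

/-- A local maximum with `i` vertical strands on its left and `j` on its right. -/
def cap (a : ℂ) {n m : ℕ} (i j : ℕ) (hm : m = i + 2 + j) (hn : n = i + j) : Skein a m n :=
  of a (.stack (.vert m) i .cap j hm (by simpa [Piece.tgt] using hn))

theorem whiskerRight_cup (p : ℕ) (i j : ℕ) (hn : n = i + j) (hm : m = i + 2 + j) :
    whiskerRight p (cup a i j hn hm) = cup a i (j + p) (by omega) (by omega) :=
  whiskerRight_of _ _

theorem whiskerRight_cap (p : ℕ) (i j : ℕ) (hm : m = i + 2 + j) (hn : n = i + j) :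
    whiskerRight p (cap a i j hm hn) = cap a i (j + p) (by omega) (by omega) :=
  whiskerRight_of _ _

theorem whiskerLeft_cup (p : ℕ) (i j : ℕ) (hn : n = i + j) (hm : m = i + 2 + j) :
    whiskerLeft p (cup a i j hn hm) = cup a (p + i) j (by omega) (by omega) :=
  whiskerLeft_of _ _

theorem whiskerLeft_cap (p : ℕ) (i j : ℕ) (hm : m = i + 2 + j) (hn : n = i + j) :
    whiskerLeft p (cap a i j hm hn) = cap a (p + i) j (by omega) (by omega) :=
  whiskerLeft_of _ _

theorem whiskerRight_one (p n : ℕ) : whiskerRight p (one a n) = one a (n + p) :=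
  whiskerRight_of _ _

theorem whiskerLeft_one (p n : ℕ) : whiskerLeft p (one a n) = one a (p + n) :=
  whiskerLeft_of _ _

theorem whiskerRight_zero (x : Skein a k l) : whiskerRight 0 x = x := by
  induction x using Skein.induction with
  | zero => exact map_zero _
  | add x y hx hy => rw [map_add, hx, hy]
  | smul c D =>
    rw [map_smul, whiskerRight_of]
    have : D.whiskerRight 0 = D := by
      induction D with
      | vert => rfl
      | stack D i g j hn hm ih => simp only [Diagram.whiskerRight, ih]; rfl
    rw [this]

theorem whiskerRight_whiskerRight (x : Skein a k l) :
    whiskerRight 1 (whiskerRight 1 x) = whiskerRight 2 x := by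
  induction x using Skein.induction with
  | zero => simp only [map_zero]
  | add x y hx hy => simp only [map_add, hx, hy]
  | smul c D =>
    simp only [map_smul, whiskerRight_of]
    have : (D.whiskerRight 1).whiskerRight 1 = D.whiskerRight 2 := by
      induction D with
      | vert => rfl
      | stack D i g j hn hm ih => simp only [Diagram.whiskerRight, ih]
    rw [this]

/-- A circle evaluates to `δ = -(a² + a⁻²)`. -/
theorem cap_comp_cup (i j : ℕ) (hn : n = i + j) (hm : m = i + 2 + j) :
    comp (cap a i j hm hn) (cup a i j hn hm) = (-(a ^ 2 + (a ^ 2)⁻¹)) • one a n := by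
  have h : comp (cap a 0 0 rfl rfl) (cup a 0 0 rfl rfl)
      = (-(a ^ 2 + (a ^ 2)⁻¹)) • one a 0 := by
    have := proj_eq_zero (SkeinRel.circle (a := a))
    rw [map_add, map_smul] at this
    rw [neg_smul, ← add_eq_zero_iff_eq_neg]
    exact (comp_of _ _).symm ▸ this
  have h2 := congrArg (fun x => whiskerRight j (whiskerLeft i x)) h
  simp only [map_smul, whiskerLeft_one, whiskerRight_one, whiskerLeft_comp, whiskerRight_comp,
    whiskerLeft_cup, whiskerLeft_cap, whiskerRight_cup, whiskerRight_cap] at h2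
  simp only [Nat.zero_add] at h2
  subst hn hm
  exact h2

theorem cap_comp_cup_right (i j : ℕ) (hn : n = i + 1 + j) (hm : m = i + 2 + (j + 1)) :
    comp (cap a i (j + 1) hm (by omega)) (cup a (i + 1) j hn (by omega)) = one a n := by
  have h : comp (cap a 0 1 rfl rfl) (cup a 1 0 rfl rfl) = one a 1 :=
    (comp_of _ _).trans (of_eq Isotopic.zigzag_left)
  have h2 := congrArg (fun x => whiskerRight j (whiskerLeft i x)) h
  simp only [whiskerLeft_one, whiskerRight_one, whiskerLeft_comp, whiskerRight_comp,
    whiskerLeft_cup, whiskerLeft_cap, whiskerRight_cup, whiskerRight_cap] at h2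
  simp only [Nat.zero_add, Nat.add_comm 1 j] at h2
  have hm' : m = i + 3 + j := by omega
  subst hn hm'
  exact h2

theorem cap_comp_cup_left (i j : ℕ) (hn : n = i + 1 + j) (hm : m = i + 2 + (j + 1)) :
    comp (cap a (i + 1) j (by omega) hn) (cup a i (j + 1) (by omega) hm) = one a n := by
  have h : comp (cap a 1 0 rfl rfl) (cup a 0 1 rfl rfl) = one a 1 :=
    (comp_of _ _).trans (of_eq Isotopic.zigzag_right)
  have h2 := congrArg (fun x => whiskerRight j (whiskerLeft i x)) h
  simp only [whiskerLeft_one, whiskerRight_one, whiskerLeft_comp, whiskerRight_comp,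
    whiskerLeft_cup, whiskerLeft_cap, whiskerRight_cup, whiskerRight_cap] at h2
  simp only [Nat.zero_add, Nat.add_comm 1 j] at h2
  have hm' : m = i + 3 + j := by omega
  subst hn hm'
  exact h2

/-- A minimum to the right of the skein `x` slides past it. -/
theorem whiskerRight_two_comp_cup (x : Skein a k l) :
    comp (whiskerRight 2 x) (cup a k 0 rfl rfl) = comp (cup a l 0 rfl rfl) x := by
  have h := exchange x (cup a 0 0 rfl rfl)
  rw [whiskerLeft_cup, whiskerLeft_cup, whiskerRight_zero] at h
  exact h.symm

/-- A maximum to the right of the skein `x` slides past it. -/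
theorem cap_comp_whiskerRight_two (x : Skein a k l) :
    comp (cap a l 0 rfl rfl) (whiskerRight 2 x) = comp x (cap a k 0 rfl rfl) := by
  have h := exchange x (cap a 0 0 rfl rfl)
  rw [whiskerLeft_cap, whiskerLeft_cap, whiskerRight_zero] at h
  exact h

/-- A maximum and a minimum on its right, at distance `p`, exchange their heights. -/
theorem cap_comp_cup_of_lt (i p j : ℕ) {r n' : ℕ} (hn : n = i + (2 + p + j))
    (hn' : n' = i + (2 + p + j)) (hm : m = i + 2 + (p + 2 + j)) (hr : r = i + p + j) :
    comp (cap a i (p + 2 + j) hm (by omega) : Skein a m n')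
        (cup a (i + 2 + p) j (by omega) (by omega) : Skein a n m) =
      comp (cup a (i + p) j hr (by omega) : Skein a r n')
        (cap a i (p + j) (by omega) (by omega) : Skein a n r) := by
  have h := congrArg (fun x => whiskerRight j (whiskerLeft i x))
    (exchange (cap a 0 p (by omega) (by omega) : Skein a (2 + p) p)
      (cup a 0 0 rfl rfl : Skein a 0 2))
  simp only [whiskerLeft_comp, whiskerRight_comp,
    whiskerLeft_cup, whiskerLeft_cap, whiskerRight_cup, whiskerRight_cap] at h
  simp only [Nat.zero_add] at h
  subst hr
  have hn1 : n = i + (2 + p) + j := by omega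
  have hn'1 : n' = i + (p + 2) + j := by omega
  have hm1 : m = i + (2 + p + 2) + j := by omega
  subst hn1 hn'1 hm1
  simp only [Nat.add_assoc, Nat.zero_add] at h ⊢
  exact h.symm

/-- A maximum and a minimum on its left, at distance `p`, exchange their heights. -/
theorem cap_comp_cup_of_gt (i p j : ℕ) {r n' : ℕ} (hn : n = i + (2 + p + j))
    (hn' : n' = i + (2 + p + j)) (hm : m = i + 2 + (p + 2 + j)) (hr : r = i + p + j) :
    comp (cap a (i + 2 + p) j (by omega) (by omega) : Skein a m n')
        (cup a i (p + 2 + j) (by omega) hm : Skein a n m) =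
      comp (cup a i (p + j) (by omega) (by omega) : Skein a r n')
        (cap a (i + p) j (by omega) hr : Skein a n r) := by
  have h := congrArg (fun x => whiskerRight j (whiskerLeft i x))
    (exchange (cup a 0 p (by omega) (by omega) : Skein a p (2 + p))
      (cap a 0 0 rfl rfl : Skein a 2 0))
  simp only [whiskerLeft_comp, whiskerRight_comp,
    whiskerLeft_cup, whiskerLeft_cap, whiskerRight_cup, whiskerRight_cap] at h
  simp only [Nat.zero_add] at h
  subst hr
  have hn1 : n = i + (p + 2) + j := by omega
  have hn'1 : n' = i + (2 + p) + j := by omega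
  have hm1 : m = i + (2 + p + 2) + j := by omega
  subst hn1 hn'1 hm1
  simp only [Nat.add_assoc, Nat.zero_add] at h ⊢
  exact h

/-- The Kauffman relation inside a slice. -/
theorem of_pos (i j : ℕ) {r : ℕ} (hn : n = i + 2 + j) (hr : r = i + j)
    (D : Diagram k n) :
    of a (.stack D i .pos j hn hn) = a • of a D +
      a⁻¹ • comp (cup a i j hr hn) (comp (cap a i j hn hr) (of a D)) := by
  have h : of a Diagram.crossPos = a • one a 2 + a⁻¹ • comp (cup a 0 0 rfl rfl)
      (cap a 0 0 rfl rfl) := by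
    have := proj_eq_zero (SkeinRel.kauffman_pos (a := a))
    rw [map_sub, map_sub, map_smul, map_smul, sub_sub, sub_eq_zero] at this
    exact this.trans (by rw [cup, cap, comp_of]; rfl)
  have h2 := congrArg (fun x => whiskerRight j (whiskerLeft i x)) h
  simp only [map_add, map_smul, whiskerLeft_one, whiskerRight_one, whiskerLeft_comp,
    whiskerRight_comp, whiskerLeft_cup, whiskerLeft_cap, whiskerRight_cup, whiskerRight_cap] at h2
  simp only [Nat.zero_add] at h2
  subst hr
  cases hn
  have h4 : whiskerRight j (whiskerLeft i (of a Diagram.crossPos)) =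
      of a (.stack (.vert (i + 2 + j)) i .pos (0 + j) (by simp [Piece.src])
        (by simp [Piece.tgt])) :=
    (congrArg (whiskerRight j) (whiskerLeft_of _ _)).trans (whiskerRight_of _ _)
  simp only [h4, Nat.zero_add] at h2
  have h3 := congrArg (fun x => comp x (of a D)) h2
  refine (comp_of _ _).symm.trans (h3.trans ?_)
  rw [add_comp, smul_comp, smul_comp, one_comp, comp_assoc]
  rfl

theorem of_neg (i j : ℕ) {r : ℕ} (hn : n = i + 2 + j) (hr : r = i + j)
    (D : Diagram k n) :
    of a (.stack D i .neg j hn hn) = a⁻¹ • of a D +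
      a • comp (cup a i j hr hn) (comp (cap a i j hn hr) (of a D)) := by
  have h : of a Diagram.crossNeg = a⁻¹ • one a 2 + a • comp (cup a 0 0 rfl rfl)
      (cap a 0 0 rfl rfl) := by
    have := proj_eq_zero (SkeinRel.kauffman_neg (a := a))
    rw [map_sub, map_sub, map_smul, map_smul, sub_sub, sub_eq_zero] at this
    exact this.trans (by rw [cup, cap, comp_of]; rfl)
  have h2 := congrArg (fun x => whiskerRight j (whiskerLeft i x)) h
  simp only [map_add, map_smul, whiskerLeft_one, whiskerRight_one, whiskerLeft_comp,
    whiskerRight_comp, whiskerLeft_cup, whiskerLeft_cap, whiskerRight_cup, whiskerRight_cap] at h2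
  simp only [Nat.zero_add] at h2
  subst hr
  cases hn
  have h4 : whiskerRight j (whiskerLeft i (of a Diagram.crossNeg)) =
      of a (.stack (.vert (i + 2 + j)) i .neg (0 + j) (by simp [Piece.src])
        (by simp [Piece.tgt])) :=
    (congrArg (whiskerRight j) (whiskerLeft_of _ _)).trans (whiskerRight_of _ _)
  simp only [h4, Nat.zero_add] at h2
  have h3 := congrArg (fun x => comp x (of a D)) h2
  refine (comp_of _ _).symm.trans (h3.trans ?_)
  rw [add_comp, smul_comp, smul_comp, one_comp, comp_assoc]
  rfl

theorem of_cup (i j : ℕ) (hn : n = i + 0 + j) (hm : m = i + 2 + j) (D : Diagram k n) :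
    of a (.stack D i .cup j hn hm) = comp (cup a i j hn hm) (of a D) := by
  rw [cup, comp_of]; rfl

theorem of_cap (i j : ℕ) (hn : n = i + 2 + j) (hm : m = i + 0 + j) (D : Diagram k n) :
    of a (.stack D i .cap j hn hm) = comp (cap a i j hn hm) (of a D) := by
  rw [cap, comp_of]; rfl

theorem tlGen_eq (n : ℕ) (i : Fin (n - 1)) {r : ℕ} (hr : r = i + (n - 2 - i))
    (hn : n = i + 2 + (n - 2 - i)) :
    tlGen a n i = comp (cup a i (n - 2 - i) hr hn) (cap a i (n - 2 - i) hn hr) := by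
  subst hr
  rw [cup, cap, comp_of]; rfl

end Skein

/-! ### Jones–Wenzl idempotents -/

theorem IsGeneric.qint_ne_zero {q : ℂ} (hq : IsGeneric q) {n : ℕ} (hn : 0 < n) :
    UqMod.qint q n ≠ 0 := by
  unfold UqMod.qint
  refine div_ne_zero ?_ hq.sub_inv_ne_zero
  intro h
  refine hq.2 (2 * n) (by omega) ?_
  have h1 : q ^ n * q⁻¹ ^ n = 1 := by rw [← mul_pow, mul_inv_cancel₀ hq.1, one_pow]
  have h2 : q ^ (2 * n) = q ^ n * q ^ n := by ring
  rw [h2]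
  linear_combination q ^ n * h + h1

theorem UqMod.qint_add_two {q : ℂ} (hq : IsGeneric q) (n : ℕ) :
    qint q (n + 2) = (q + q⁻¹) * qint q (n + 1) - qint q n := by
  unfold UqMod.qint
  have h := hq.sub_inv_ne_zero
  have h1 : q * q⁻¹ = 1 := mul_inv_cancel₀ hq.1
  generalize q⁻¹ = p at *
  field_simp
  linear_combination -(q ^ n - p ^ n) * h1

namespace Skein

variable {a : ℂ} {k l m n : ℕ}

/-- The value `-[n+2]/[n+1]` of the partial trace of `f_{n+1}`, as a multiple of `f_n`. -/
def jwCoef (a : ℂ) (n : ℕ) : ℂ := -(UqMod.qint (a ^ 2) (n + 2) / UqMod.qint (a ^ 2) (n + 1))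

theorem jwCoef_ne_zero (ha : IsGeneric a) (n : ℕ) : jwCoef a n ≠ 0 :=
  neg_ne_zero.2 (div_ne_zero (ha.sq.qint_ne_zero (by omega)) (ha.sq.qint_ne_zero (by omega)))

theorem jwCoef_zero (ha : IsGeneric a) : jwCoef a 0 = -(a ^ 2 + (a ^ 2)⁻¹) := by
  have h := UqMod.qint_add_two ha.sq 0
  have h0 : UqMod.qint (a ^ 2) 0 = 0 := by simp [UqMod.qint]
  rw [jwCoef, h, zero_add, UqMod.qint_one ha.sq, h0]
  ring

theorem jwCoef_succ (ha : IsGeneric a) (n : ℕ) :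
    jwCoef a (n + 1) = -(a ^ 2 + (a ^ 2)⁻¹) - (jwCoef a n)⁻¹ := by
  have h := UqMod.qint_add_two ha.sq (n + 1)
  have h1 := ha.sq.qint_ne_zero (n := n + 1) (by omega)
  have h2 := ha.sq.qint_ne_zero (n := n + 2) (by omega)
  rw [jwCoef, jwCoef, h]
  generalize (a ^ 2)⁻¹ = p
  field_simp
  ring

/-- The second term `(f ⊗ 1) e (f ⊗ 1)` of the Wenzl recursion, where `e` joins the last two
strands. -/
def sandwich (f : Skein a (n + 1) (n + 1)) : Skein a (n + 2) (n + 2) :=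
  comp (whiskerRight 1 f) (comp (cup a n 0 rfl rfl) (comp (cap a n 0 rfl rfl) (whiskerRight 1 f)))

/-- The Jones–Wenzl idempotents, defined by the Wenzl recursion
`f_{n+2} = f_{n+1} ⊗ 1 + ([n+1]/[n+2]) (f_{n+1} ⊗ 1) e_{n+1} (f_{n+1} ⊗ 1)`. -/
def wenzl (a : ℂ) : (n : ℕ) → Skein a n n
  | 0 => one a 0
  | 1 => one a 1
  | n + 2 => whiskerRight 1 (wenzl a (n + 1)) - (jwCoef a n)⁻¹ • sandwich (wenzl a (n + 1))

/-- The skein `f` vanishes when composed with a minimum below it or a maximum above it. -/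
structure IsUncappable (f : Skein a n n) : Prop where
  comp_cup {m : ℕ} (i j : ℕ) (hm : m = i + j) (hn : n = i + 2 + j) : comp f (cup a i j hm hn) = 0
  cap_comp {m : ℕ} (i j : ℕ) (hn : n = i + 2 + j) (hm : m = i + j) : comp (cap a i j hn hm) f = 0

/-- The invariant of the Wenzl recursion: the relations between `g = f_n` and `f = f_{n+1}`. -/
structure WenzlPair (a : ℂ) (n : ℕ) (g : Skein a n n) (f : Skein a (n + 1) (n + 1)) : Prop where
  uncappable : IsUncappable f
  idem : comp f f = f
  comp_left : comp (whiskerRight 1 g) f = f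
  comp_right : comp f (whiskerRight 1 g) = f
  ptr : comp (cap a n 0 rfl rfl) (comp (whiskerRight 1 f) (cup a n 0 rfl rfl)) = jwCoef a n • g

section wenzlStep

variable {g : Skein a n n} {f : Skein a (n + 1) (n + 1)}

theorem sandwich_comp_whisker (h : WenzlPair a n g f) :
    comp (sandwich f) (whiskerRight 1 f) = sandwich f := by
  simp only [sandwich, comp_assoc, ← whiskerRight_comp, h.idem]

theorem whisker_comp_sandwich (h : WenzlPair a n g f) :
    comp (whiskerRight 1 f) (sandwich f) = sandwich f := by
  simp only [sandwich, ← comp_assoc, ← whiskerRight_comp, h.idem]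

/-- As `g` slides past the minimum and is absorbed by `f`, it can be inserted below it. -/
theorem comp_comp_cup (h : WenzlPair a n g f) :
    comp (whiskerRight 1 f) (comp (cup a n 0 rfl rfl) g) =
      comp (whiskerRight 1 f) (cup a n 0 rfl rfl) := by
  rw [← whiskerRight_two_comp_cup, ← whiskerRight_whiskerRight, ← comp_assoc]
  exact congrArg (fun x => comp x _) ((whiskerRight_comp 1 f (whiskerRight 1 g)).symm.trans
    (congrArg (whiskerRight 1) h.comp_right))

/-- The mirror image of `comp_comp_cup`. -/
theorem comp_cap_comp (h : WenzlPair a n g f) :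
    comp g (comp (cap a n 0 rfl rfl) (whiskerRight 1 f)) =
      comp (cap a n 0 rfl rfl) (whiskerRight 1 f) := by
  rw [← comp_assoc, ← cap_comp_whiskerRight_two, ← whiskerRight_whiskerRight, comp_assoc]
  exact congrArg (comp _) ((whiskerRight_comp 1 (whiskerRight 1 g) f).symm.trans
    (congrArg (whiskerRight 1) h.comp_left))

theorem sandwich_comp_cup (h : WenzlPair a n g f) :
    comp (sandwich f) (cup a n 0 rfl rfl) =
      jwCoef a n • comp (whiskerRight 1 f) (cup a n 0 rfl rfl) := by
  simp only [sandwich, comp_assoc]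
  rw [h.ptr, map_smul, map_smul, comp_comp_cup h]

theorem cap_comp_sandwich (h : WenzlPair a n g f) :
    comp (cap a n 0 rfl rfl) (sandwich f) =
      jwCoef a n • comp (cap a n 0 rfl rfl) (whiskerRight 1 f) := by
  have h1 := h.ptr
  simp only [sandwich, ← comp_assoc] at h1 ⊢
  rw [h1, smul_comp, smul_comp, comp_assoc, comp_cap_comp h]

/-- The partial trace of `(f ⊗ 1) e (f ⊗ 1)` is `f²`. -/
theorem ptr_sandwich (h : WenzlPair a n g f) :
    comp (cap a (n + 1) 0 rfl rfl) (comp (whiskerRight 1 (sandwich f)) (cup a (n + 1) 0 rfl rfl))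
      = f := by
  simp only [sandwich, whiskerRight_comp, whiskerRight_cup, whiskerRight_cap,
    whiskerRight_whiskerRight, comp_assoc]
  rw [whiskerRight_two_comp_cup, ← comp_assoc, cap_comp_whiskerRight_two]
  have h1 := cap_comp_cup_left (a := a) n 0 (n := n + 1) (m := n + 3) rfl rfl
  have h2 := cap_comp_cup_right (a := a) n 0 (n := n + 1) (m := n + 3) rfl rfl
  simp only [comp_assoc]
  rw [← comp_assoc (cap a n (0 + 1) _ _), h2, one_comp, ← comp_assoc (cap a (n + 1) 0 _ _), h1,
    one_comp, h.idem]

/-- The recursion preserves the invariant. The two terms cancel against the last minimum because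
the inverse of the partial trace of `f` is taken as the coefficient; all other minima are killed
by `f ⊗ 1`. -/
theorem WenzlPair.succ (ha : IsGeneric a) (h : WenzlPair a n g f) :
    WenzlPair a (n + 1) f (whiskerRight 1 f - (jwCoef a n)⁻¹ • sandwich f) := by
  have hc := inv_mul_cancel₀ (jwCoef_ne_zero ha n)
  have hr : comp (whiskerRight 1 f - (jwCoef a n)⁻¹ • sandwich f) (whiskerRight 1 f) =
      whiskerRight 1 f - (jwCoef a n)⁻¹ • sandwich f := by
    rw [LinearMap.map_sub₂, LinearMap.map_smul₂, ← whiskerRight_comp, h.idem,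
      sandwich_comp_whisker h]
  have hl : comp (whiskerRight 1 f) (whiskerRight 1 f - (jwCoef a n)⁻¹ • sandwich f) =
      whiskerRight 1 f - (jwCoef a n)⁻¹ • sandwich f := by
    rw [map_sub, map_smul, ← whiskerRight_comp, h.idem, whisker_comp_sandwich h]
  have hcup : ∀ {m : ℕ} (i j : ℕ) (hm : m = i + j) (hn : n + 1 + 1 = i + 2 + j),
      comp (whiskerRight 1 f - (jwCoef a n)⁻¹ • sandwich f) (cup a i j hm hn) = 0 := by
    intro m i j hm hn
    subst hm
    rcases j with _ | j
    -- The minimum joins the last two strands.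
    · obtain rfl : i = n := by omega
      rw [LinearMap.map_sub₂, LinearMap.map_smul₂]
      refine (congrArg (fun x => _ - _ • x) (sandwich_comp_cup h)).trans ?_
      rw [smul_smul, hc, one_smul, sub_self]
    · rw [← hr, comp_assoc]
      have h1 : cup a i (j + 1) rfl hn = whiskerRight 1 (cup a (m := n + 1) i j rfl (by omega)) :=
        (whiskerRight_cup _ _ _ _ _).symm
      have h2 : comp (whiskerRight 1 f) (cup a i (j + 1) rfl hn) = 0 := by
        rw [h1]
        refine (whiskerRight_comp 1 f _).symm.trans ?_
        rw [h.uncappable.comp_cup, map_zero]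
      rw [h2, map_zero]
  have hcap : ∀ {m : ℕ} (i j : ℕ) (hn : n + 1 + 1 = i + 2 + j) (hm : m = i + j),
      comp (cap a i j hn hm) (whiskerRight 1 f - (jwCoef a n)⁻¹ • sandwich f) = 0 := by
    intro m i j hn hm
    subst hm
    rcases j with _ | j
    · obtain rfl : i = n := by omega
      rw [map_sub, map_smul]
      refine (congrArg (fun x => _ - _ • x) (cap_comp_sandwich h)).trans ?_
      rw [smul_smul, hc, one_smul, sub_self]
    · rw [← hl, ← comp_assoc]
      have h1 : cap a i (j + 1) hn rfl = whiskerRight 1 (cap a (m := n + 1) i j (by omega) rfl) :=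
        (whiskerRight_cap _ _ _ _ _).symm
      have h2 : comp (cap a i (j + 1) hn rfl) (whiskerRight 1 f) = 0 := by
        rw [h1]
        refine (whiskerRight_comp 1 _ f).symm.trans ?_
        rw [h.uncappable.cap_comp, map_zero]
      rw [h2, map_zero, LinearMap.zero_apply]
  refine ⟨⟨hcup, hcap⟩, ?_, hl, hr, ?_⟩
  · have h1 : comp (whiskerRight 1 f - (jwCoef a n)⁻¹ • sandwich f) (sandwich f) = 0 := by
      generalize whiskerRight 1 f - (jwCoef a n)⁻¹ • sandwich f = x at hr hcup
      rw [sandwich, ← comp_assoc, hr, ← comp_assoc]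
      have := hcup n 0 rfl rfl
      exact (congrArg (fun y => comp y _) this).trans (by simp)
    rw [map_sub, map_smul, h1, smul_zero, sub_zero, hr]
  · rw [map_sub, map_smul, LinearMap.map_sub₂, LinearMap.map_smul₂, map_sub, map_smul]
    have h1 := ptr_sandwich h
    have h2 : comp (cap a (n + 1) 0 rfl rfl)
        (comp (whiskerRight 1 (whiskerRight 1 f)) (cup a (n + 1) 0 rfl rfl)) =
        (-(a ^ 2 + (a ^ 2)⁻¹)) • f := by
      rw [whiskerRight_whiskerRight, whiskerRight_two_comp_cup, ← comp_assoc, cap_comp_cup,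
        smul_comp, one_comp]
    rw [h1, h2, ← sub_smul, ← jwCoef_succ ha]

end wenzlStep

theorem wenzlPair (ha : IsGeneric a) (n : ℕ) : WenzlPair a n (wenzl a n) (wenzl a (n + 1)) := by
  induction n with
  | zero =>
    refine ⟨⟨by omega, by omega⟩, one_comp _, ?_, ?_, ?_⟩
    · rw [wenzl, wenzl, whiskerRight_one, one_comp]
    · rw [wenzl, wenzl, whiskerRight_one, comp_one]
    · rw [wenzl, wenzl, whiskerRight_one, one_comp, cap_comp_cup, jwCoef_zero ha]
  | succ n ih => exact ih.succ ha

theorem wenzl_uncappable (ha : IsGeneric a) : (n : ℕ) → IsUncappable (wenzl a n)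
  | 0 => ⟨by omega, by omega⟩
  | n + 1 => (wenzlPair ha n).uncappable

theorem wenzl_idem (ha : IsGeneric a) : (n : ℕ) → comp (wenzl a n) (wenzl a n) = wenzl a n
  | 0 => one_comp _
  | n + 1 => (wenzlPair ha n).idem

/-- `x` is a noncommutative polynomial without constant term in the generators `e_i`. -/
def IsReduced (x : Skein a n n) : Prop :=
  (x : End (⟨n⟩ : TL a)) ∈ NonUnitalAlgebra.adjoin ℂ (Set.range (tlGen a n))

namespace IsReduced

variable {x y : Skein a n n}

theorem zero : IsReduced (0 : Skein a n n) :=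
  zero_mem (NonUnitalAlgebra.adjoin ℂ (Set.range (tlGen a n)))

theorem add (hx : IsReduced x) (hy : IsReduced y) : IsReduced (x + y) :=
  add_mem (S := NonUnitalSubalgebra ℂ (End (⟨n⟩ : TL a))) hx hy

theorem smul (c : ℂ) (hx : IsReduced x) : IsReduced (c • x) :=
  (NonUnitalAlgebra.adjoin ℂ (Set.range (tlGen a n))).toSubmodule.smul_mem c hx

theorem comp (hx : IsReduced x) (hy : IsReduced y) : IsReduced (comp x y) :=
  mul_mem (S := NonUnitalSubalgebra ℂ (End (⟨n⟩ : TL a))) hx hy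

theorem cup_comp_cap (i j : ℕ) (hm : m = i + j) (hn : n = i + 2 + j) :
    IsReduced (Skein.comp (cup a i j hm hn) (cap a i j hn hm)) := by
  refine NonUnitalAlgebra.subset_adjoin ℂ ⟨⟨i, by omega⟩, ?_⟩
  obtain rfl : j = n - 2 - i := by omega
  exact tlGen_eq (r := m) n ⟨i, by omega⟩ hm hn

theorem whiskerRight (hx : IsReduced x) : IsReduced (whiskerRight 1 x) := by
  induction hx using NonUnitalAlgebra.adjoin_induction with
  | mem x hx =>
    obtain ⟨i, rfl⟩ := hx
    have hi := i.2
    rw [tlGen_eq (r := n - 2) _ _ (by omega) (by omega), whiskerRight_comp, whiskerRight_cup,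
      whiskerRight_cap]
    exact cup_comp_cap _ _ _ _
  | add x y _ _ hx hy => exact (map_add (Skein.whiskerRight 1) x y).symm ▸ hx.add hy
  | zero => exact (map_zero (Skein.whiskerRight (a := a) 1)).symm ▸ zero
  | mul x y _ _ hx hy => exact (whiskerRight_comp 1 x y).symm ▸ hx.comp hy
  | smul c x _ hx => exact (map_smul (Skein.whiskerRight 1) c x).symm ▸ hx.smul c

end IsReduced

theorem wenzl_sub_one (a : ℂ) (n : ℕ) : IsReduced (wenzl a n - one a n) := by
  induction n using wenzl.induct with
  | case1 => exact (sub_self (one a 0)).symm ▸ .zero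
  | case2 => exact (sub_self (one a 1)).symm ▸ .zero
  | case3 n ih =>
    have hz := ih.whiskerRight
    obtain ⟨z, hz1⟩ : ∃ z, z = whiskerRight 1 (wenzl a (n + 1) - one a (n + 1)) := ⟨_, rfl⟩
    have hf : whiskerRight 1 (wenzl a (n + 1)) = one a (n + 2) + z := by
      rw [hz1, map_sub, whiskerRight_one, add_sub_cancel]
    rw [← hz1] at hz
    have he := IsReduced.cup_comp_cap (a := a) n 0 (m := n) (n := n + 2) rfl rfl
    have hs : IsReduced (sandwich (wenzl a (n + 1))) := by
      have : sandwich (wenzl a (n + 1)) = comp (one a (n + 2) + z)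
          (comp (comp (cup a n 0 rfl rfl) (cap a n 0 rfl rfl)) (one a (n + 2) + z)) := by
        rw [sandwich, hf, comp_assoc]
      rw [this, map_add (comp (comp _ _)), add_comp, one_comp, comp_one]
      exact (he.add (he.comp hz)).add (hz.comp (he.add (he.comp hz)))
    have : wenzl a (n + 2) - one a (n + 2) =
        z + (-(jwCoef a n)⁻¹) • sandwich (wenzl a (n + 1)) := by
      rw [wenzl, hf, neg_smul]; abel
    exact this ▸ hz.add (hs.smul _)

theorem isJonesWenzl_wenzl (ha : IsGeneric a) (n : ℕ) : IsJonesWenzl a n (wenzl a n) := by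
  refine ⟨wenzl_sub_one a n, fun i => ?_⟩
  have hi := i.2
  rw [tlGen_eq (r := n - 2) _ _ (by omega) (by omega)]
  constructor
  · refine (comp_assoc _ _ _).symm.trans ?_
    rw [(wenzl_uncappable ha n).comp_cup, map_zero, LinearMap.zero_apply]
  · refine (comp_assoc _ _ _).trans ?_
    rw [(wenzl_uncappable ha n).cap_comp, map_zero]

end Skein

/-- The reversed form of `IsJonesWenzl.mul_eq`. -/
theorem IsJonesWenzl.mul_eq_right {a : ℂ} {n : ℕ} {f g : End (⟨n⟩ : TL a)}
    (hf : IsJonesWenzl a n f) (hg : IsJonesWenzl a n g) : g * f = f := by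
  have : ∀ x ∈ NonUnitalAlgebra.adjoin ℂ (Set.range (tlGen a n)), x * f = 0 := by
    intro x hx
    induction hx using NonUnitalAlgebra.adjoin_induction with
    | mem x hx => obtain ⟨i, rfl⟩ := hx; exact (hf.2 i).2
    | add x y _ _ hx hy => rw [add_mul, hx, hy, add_zero]
    | zero => rw [zero_mul]
    | mul x y _ _ hx hy => rw [mul_assoc, hy, mul_zero]
    | smul c x _ hx => rw [smul_mul_assoc, hx, smul_zero]
  have h := this _ hg.1
  rwa [sub_mul, one_mul, sub_eq_zero] at h

theorem IsJonesWenzl.unique {a : ℂ} {n : ℕ} {f g : End (⟨n⟩ : TL a)} (hf : IsJonesWenzl a n f)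
    (hg : IsJonesWenzl a n g) : f = g :=
  (hf.mul_eq hg).symm.trans (hg.mul_eq_right hf)

theorem existsUnique_isJonesWenzl {a : ℂ} (ha : IsGeneric a) (n : ℕ) :
    ∃! f : End (⟨n⟩ : TL a), IsJonesWenzl a n f :=
  ⟨Skein.wenzl a n, Skein.isJonesWenzl_wenzl ha n,
    fun _ hf => hf.unique (Skein.isJonesWenzl_wenzl ha n)⟩

theorem jonesWenzl_eq_wenzl {a : ℂ} (ha : IsGeneric a) (n : ℕ) :
    jonesWenzl a n = Skein.wenzl a n := by
  have h : ∃ f : End (⟨n⟩ : TL a), IsJonesWenzl a n f := ⟨_, Skein.isJonesWenzl_wenzl ha n⟩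
  rw [jonesWenzl, dif_pos h]
  exact h.choose_spec.unique (Skein.isJonesWenzl_wenzl ha n)

/-! ### The skein spaces in terms of Jones–Wenzl idempotents -/

namespace Skein

variable {a : ℂ} {k l m n : ℕ}

/-- A stack of minima. -/
inductive IsCups {k : ℕ} : {l : ℕ} → Skein a k l → Prop
  | one : IsCups (one a k)
  | cup {l m : ℕ} (i j : ℕ) (hl : l = i + j) (hm : m = i + 2 + j) {x : Skein a k l} :
      IsCups x → IsCups (comp (cup a i j hl hm) x)

/-- A stack of maxima. -/
inductive IsCaps {k : ℕ} : {l : ℕ} → Skein a k l → Prop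
  | one : IsCaps (one a k)
  | cap {l m : ℕ} (i j : ℕ) (hl : l = i + 2 + j) (hm : m = i + j) {x : Skein a k l} :
      IsCaps x → IsCaps (comp (cap a i j hl hm) x)

/-- The span of the skeins in normal form: all minima above all maxima. -/
def normalSpan (a : ℂ) (k l : ℕ) : Submodule ℂ (Skein a k l) :=
  Submodule.span ℂ {z | ∃ (r : ℕ) (u : Skein a r l) (c : Skein a k r),
    IsCups u ∧ IsCaps c ∧ z = comp u c}

theorem IsCups.comp_mem {r : ℕ} {u : Skein a r l} (hu : IsCups u) {c : Skein a k r}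
    (hc : IsCaps c) : comp u c ∈ normalSpan a k l :=
  Submodule.subset_span ⟨r, u, c, hu, hc, rfl⟩

theorem cup_comp_mem_normalSpan (i j : ℕ) (hl : l = i + j) (hm : m = i + 2 + j)
    {z : Skein a k l} (hz : z ∈ normalSpan a k l) :
    comp (cup a i j hl hm) z ∈ normalSpan a k m := by
  induction hz using Submodule.span_induction with
  | mem z hz =>
    obtain ⟨r, u, c, hu, hc, rfl⟩ := hz
    rw [← comp_assoc]
    exact (hu.cup i j hl hm).comp_mem hc
  | zero => rw [map_zero]; exact zero_mem _
  | add x y _ _ hx hy => rw [map_add]; exact add_mem hx hy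
  | smul c x _ hx => rw [map_smul]; exact Submodule.smul_mem _ c hx

/-- A maximum on top of a stack of minima is pushed down, minimum by minimum, until it joins the
maxima or is consumed by a circle or a zigzag. -/
theorem cap_comp_comp_mem_normalSpan {r : ℕ} {u : Skein a r l} (hu : IsCups u) :
    ∀ {m k : ℕ} (i j : ℕ) (hl : l = i + 2 + j) (hm : m = i + j) {c : Skein a k r}, IsCaps c →
      comp (cap a i j hl hm) (comp u c) ∈ normalSpan a k m := by
  induction hu with
  | one =>
    intro m k i j hl hm c hc
    rw [one_comp, ← one_comp (comp _ c)]
    exact IsCups.one.comp_mem (hc.cap i j hl hm)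
  | @cup l₀ l i' j' hl' hm' u hu ih =>
    intro m k i j hl hm c hc
    rw [comp_assoc, ← comp_assoc (cap a i j hl hm)]
    have hlm : l₀ = m := by omega
    rcases lt_trichotomy i i' with h | h | h
    · rcases (show i' = i + 1 ∨ i + 2 ≤ i' by omega) with h | h
      · subst hlm h
        obtain rfl : j = j' + 1 := by omega
        rw [cap_comp_cup_right i j' hl' hl, one_comp]
        exact hu.comp_mem hc
      · obtain ⟨p, rfl⟩ := Nat.exists_eq_add_of_le h
        obtain rfl : j = p + 2 + j' := by omega
        rw [cap_comp_cup_of_lt (r := i + p + j') i p j' (by omega) (by omega) hl rfl, comp_assoc]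
        exact cup_comp_mem_normalSpan _ _ _ _ (ih _ _ _ _ hc)
    · subst hlm h
      obtain rfl : j = j' := by omega
      rw [cap_comp_cup i j hl' hl, smul_comp, one_comp]
      exact Submodule.smul_mem _ _ (hu.comp_mem hc)
    · rcases (show i = i' + 1 ∨ i' + 2 ≤ i by omega) with h | h
      · subst hlm h
        obtain rfl : j' = j + 1 := by omega
        rw [cap_comp_cup_left i' j hm hm', one_comp]
        exact hu.comp_mem hc
      · obtain ⟨p, rfl⟩ := Nat.exists_eq_add_of_le h
        obtain rfl : j' = p + 2 + j := by omega
        rw [cap_comp_cup_of_gt (r := i' + p + j) i' p j (by omega) (by omega) hm' rfl, comp_assoc]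
        exact cup_comp_mem_normalSpan _ _ _ _ (ih _ _ _ _ hc)

theorem cap_comp_mem_normalSpan (i j : ℕ) (hl : l = i + 2 + j) (hm : m = i + j)
    {z : Skein a k l} (hz : z ∈ normalSpan a k l) :
    comp (cap a i j hl hm) z ∈ normalSpan a k m := by
  induction hz using Submodule.span_induction with
  | mem z hz =>
    obtain ⟨r, u, c, hu, hc, rfl⟩ := hz
    exact cap_comp_comp_mem_normalSpan hu i j hl hm hc
  | zero => rw [map_zero]; exact zero_mem _
  | add x y _ _ hx hy => rw [map_add]; exact add_mem hx hy
  | smul c x _ hx => rw [map_smul]; exact Submodule.smul_mem _ c hx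

theorem of_mem_normalSpan (D : Diagram k l) : of a D ∈ normalSpan a k l := by
  induction D with
  | vert =>
    have := (IsCups.one (a := a) (k := k)).comp_mem IsCaps.one
    rwa [one_comp] at this
  | @stack n m D i g j hn hm ih =>
    cases g with
    | cup => rw [of_cup i j hn hm D]; exact cup_comp_mem_normalSpan _ _ _ _ ih
    | cap => rw [of_cap i j hn hm D]; exact cap_comp_mem_normalSpan _ _ _ _ ih
    | pos =>
      obtain rfl : n = m := hn.trans hm.symm
      rw [of_pos (r := i + j) i j hn rfl]
      exact add_mem (Submodule.smul_mem _ _ ih) (Submodule.smul_mem _ _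
        (cup_comp_mem_normalSpan _ _ _ _ (cap_comp_mem_normalSpan _ _ _ _ ih)))
    | neg =>
      obtain rfl : n = m := hn.trans hm.symm
      rw [of_neg (r := i + j) i j hn rfl]
      exact add_mem (Submodule.smul_mem _ _ ih) (Submodule.smul_mem _ _
        (cup_comp_mem_normalSpan _ _ _ _ (cap_comp_mem_normalSpan _ _ _ _ ih)))

/-- Every skein is a linear combination of skeins in normal form. -/
theorem mem_normalSpan (x : Skein a k l) : x ∈ normalSpan a k l := by
  induction x using Skein.induction with
  | zero => exact zero_mem _
  | add x y hx hy => exact add_mem hx hy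
  | smul c D => exact Submodule.smul_mem _ c (of_mem_normalSpan D)

theorem IsUncappable.comp_cups {f : Skein a l l} (hf : IsUncappable f) {u : Skein a k l}
    (hu : IsCups u) : comp f u = 0 ∨ k = l ∧ HEq u (one a l) := by
  cases hu with
  | one => exact .inr ⟨rfl, HEq.rfl⟩
  | cup i j hl hm hx =>
    rw [← comp_assoc, hf.comp_cup]
    simp

theorem IsUncappable.caps_comp {f : Skein a k k} (hf : IsUncappable f) {c : Skein a k l}
    (hc : IsCaps c) : comp c f = 0 ∨ k = l ∧ HEq c (one a k) := by
  induction hc with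
  | one => exact .inr ⟨rfl, HEq.rfl⟩
  | cap i j hl hm hx ih =>
    left
    rw [comp_assoc]
    rcases ih with h | ⟨h, h'⟩
    · rw [h, map_zero]
    · subst h
      rw [eq_of_heq h', one_comp, hf.cap_comp]

/-- There are no nonzero skeins between uncappable skeins with different numbers of strands. -/
theorem IsUncappable.comp_comp_eq_zero {f : Skein a l l} {g : Skein a k k} (hf : IsUncappable f)
    (hg : IsUncappable g) (hkl : k ≠ l) (x : Skein a k l) : comp f (comp x g) = 0 := by
  induction mem_normalSpan x using Submodule.span_induction with
  | mem z hz =>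
    obtain ⟨r, u, c, hu, hc, rfl⟩ := hz
    rcases hf.comp_cups hu with h | ⟨rfl, -⟩
    · rw [← comp_assoc, ← comp_assoc, h]; simp
    · rcases hg.caps_comp hc with h | ⟨rfl, -⟩
      · rw [comp_assoc, h]; simp
      · exact absurd rfl hkl
  | zero => simp
  | add x y _ _ hx hy => simp only [map_add, LinearMap.add_apply, hx, hy, add_zero]
  | smul c x _ hx => simp only [map_smul, LinearMap.smul_apply, hx, smul_zero]

/-- Skeins between two copies of an uncappable skein `f` are multiples of `f²`. -/
theorem IsUncappable.exists_comp_comp_eq {f : Skein a n n} (hf : IsUncappable f)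
    (x : Skein a n n) : ∃ c : ℂ, comp f (comp x f) = c • comp f f := by
  induction mem_normalSpan x using Submodule.span_induction with
  | mem z hz =>
    obtain ⟨r, u, c, hu, hc, rfl⟩ := hz
    rcases hf.comp_cups hu with h | ⟨rfl, h⟩
    · refine ⟨0, ?_⟩
      rw [← comp_assoc, ← comp_assoc, h]; simp
    · rcases hf.caps_comp hc with h' | ⟨-, h'⟩
      · refine ⟨0, ?_⟩
        rw [comp_assoc, h']; simp
      · refine ⟨1, ?_⟩
        rw [eq_of_heq h, eq_of_heq h', one_comp, one_comp, one_smul]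
  | zero => exact ⟨0, by simp⟩
  | add x y _ _ hx hy =>
    obtain ⟨c, hc⟩ := hx
    obtain ⟨d, hd⟩ := hy
    exact ⟨c + d, by simp only [map_add, LinearMap.add_apply, hc, hd, add_smul]⟩
  | smul c x _ hx =>
    obtain ⟨d, hd⟩ := hx
    exact ⟨c * d, by simp only [map_smul, LinearMap.smul_apply, hd, smul_smul]⟩

/-- The ideal of the skeins that factor through Jones–Wenzl idempotents. -/
def wenzlIdeal (a : ℂ) (k l : ℕ) : Submodule ℂ (Skein a k l) :=
  Submodule.span ℂ {z | ∃ (m : ℕ) (x : Skein a m l) (y : Skein a k m),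
    z = comp x (comp (wenzl a m) y)}

theorem comp_comp_mem_wenzlIdeal {k' l' : ℕ} {z : Skein a k l} (hz : z ∈ wenzlIdeal a k l)
    (x : Skein a l l') (y : Skein a k' k) : comp x (comp z y) ∈ wenzlIdeal a k' l' := by
  induction hz using Submodule.span_induction with
  | mem z hz =>
    obtain ⟨m, x', y', rfl⟩ := hz
    refine Submodule.subset_span ⟨m, comp x x', comp y' y, ?_⟩
    simp only [comp_assoc]
  | zero => simp
  | add x y _ _ hx hy => simpa only [map_add, LinearMap.add_apply] using add_mem hx hy
  | smul c x _ hx => simpa only [map_smul, LinearMap.smul_apply] using Submodule.smul_mem _ c hx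

theorem wenzl_mem_wenzlIdeal (a : ℂ) (m : ℕ) : wenzl a m ∈ wenzlIdeal a m m :=
  Submodule.subset_span ⟨m, one a m, one a m, by rw [comp_one, one_comp]⟩

/-- Wenzl's recursion decomposes `f_n ⊗ 1` into `f_{n+1}` and a skein that factors through
`f_{n-1}`. -/
theorem whiskerRight_wenzl_mem_wenzlIdeal (ha : IsGeneric a) :
    (n : ℕ) → whiskerRight 1 (wenzl a n) ∈ wenzlIdeal a (n + 1) (n + 1)
  | 0 => (whiskerRight_one 1 0).symm ▸ wenzl_mem_wenzlIdeal a 1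
  | n + 1 => by
    have h : whiskerRight 1 (wenzl a (n + 1)) =
        wenzl a (n + 2) + (jwCoef a n)⁻¹ • sandwich (wenzl a (n + 1)) := by
      rw [wenzl, sub_add_cancel]
    rw [h]
    refine add_mem (wenzl_mem_wenzlIdeal a (n + 2)) (Submodule.smul_mem _ _
      (Submodule.subset_span ⟨n, comp (whiskerRight 1 (wenzl a (n + 1))) (cup a n 0 rfl rfl),
        comp (cap a n 0 rfl rfl) (whiskerRight 1 (wenzl a (n + 1))), ?_⟩))
    rw [comp_cap_comp (wenzlPair ha n), comp_assoc]
    rfl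

/-- The identity is a sum of skeins that factor through Jones–Wenzl idempotents. -/
theorem one_mem_wenzlIdeal (ha : IsGeneric a) (n : ℕ) : one a n ∈ wenzlIdeal a n n := by
  induction n with
  | zero => exact wenzl_mem_wenzlIdeal a 0
  | succ n ih =>
    rw [← whiskerRight_one 1 n]
    generalize one a n = z at ih
    induction ih using Submodule.span_induction with
    | mem z hz =>
      obtain ⟨m, x, y, rfl⟩ := hz
      rw [whiskerRight_comp, whiskerRight_comp]
      exact comp_comp_mem_wenzlIdeal (whiskerRight_wenzl_mem_wenzlIdeal ha m) _ _
    | zero => rw [map_zero]; exact zero_mem _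
    | add x y _ _ hx hy => rw [map_add]; exact add_mem hx hy
    | smul c x _ hx => rw [map_smul]; exact Submodule.smul_mem _ c hx

/-- A bilinear expression in two endomorphism skeins takes a value in `S` at the identities if it
does so at the skeins `x f_m y`. This is how the decomposition of the identities is inserted on
both sides of a morphism. -/
theorem mem_of_sandwich {M : Type*} [AddCommGroup M] [Module ℂ M] (ha : IsGeneric a)
    (Φ : Skein a l l →ₗ[ℂ] Skein a k k →ₗ[ℂ] M) (S : Submodule ℂ M)
    (h : ∀ (m n : ℕ) (x : Skein a m l) (y : Skein a l m) (x' : Skein a n k) (y' : Skein a k n),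
      Φ (comp x (comp (wenzl a m) y)) (comp x' (comp (wenzl a n) y')) ∈ S) :
    Φ (one a l) (one a k) ∈ S := by
  have key : ∀ z ∈ wenzlIdeal a l l, ∀ w ∈ wenzlIdeal a k k, Φ z w ∈ S := by
    intro z hz w hw
    induction hz using Submodule.span_induction with
    | mem z hz =>
      obtain ⟨m, x, y, rfl⟩ := hz
      induction hw using Submodule.span_induction with
      | mem w hw =>
        obtain ⟨n, x', y', rfl⟩ := hw
        exact h m n x y x' y'
      | zero => rw [map_zero]; exact zero_mem _
      | add x y _ _ hx hy => rw [map_add]; exact add_mem hx hy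
      | smul c x _ hx => rw [map_smul]; exact Submodule.smul_mem _ c hx
    | zero => rw [map_zero]; exact zero_mem _
    | add x y _ _ hx hy => rw [map_add]; exact add_mem hx hy
    | smul c x _ hx => rw [map_smul]; exact Submodule.smul_mem _ c hx
  exact key _ (one_mem_wenzlIdeal ha l) _ (one_mem_wenzlIdeal ha k)

end Skein

/-! ### Morphisms between the simple modules -/

namespace UqMod

variable {q : ℂ} (hq : IsGeneric q)

theorem simple_K (n : ℕ) (w : Fin (n + 1) → ℂ) (i : Fin (n + 1)) :
    ((simple hq n).ρ (Uq.gen q .K) w : Fin (n + 1) → ℂ) i = q ^ ((n : ℤ) - 2 * i) * w i := by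
  rw [simple_ρ]; rfl

theorem simple_Kinv (n : ℕ) (w : Fin (n + 1) → ℂ) (i : Fin (n + 1)) :
    ((simple hq n).ρ (Uq.gen q .Kinv) w : Fin (n + 1) → ℂ) i = q ^ (2 * i - (n : ℤ)) * w i := by
  rw [simple_ρ]; rfl

theorem simple_X (n : ℕ) (w : Fin (n + 1) → ℂ) (i : Fin (n + 1)) :
    ((simple hq n).ρ (Uq.gen q .X) w : Fin (n + 1) → ℂ) i =
      if h : (i : ℕ) + 1 < n + 1 then qint q (n - i) * w ⟨i + 1, h⟩ else 0 := by
  rw [simple_ρ]; rfl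

theorem simple_Y (n : ℕ) (w : Fin (n + 1) → ℂ) (i : Fin (n + 1)) :
    ((simple hq n).ρ (Uq.gen q .Y) w : Fin (n + 1) → ℂ) i =
      if 0 < (i : ℕ) then qint q i * w ⟨i - 1, by omega⟩ else 0 := by
  rw [simple_ρ]; rfl

/-- The vector `v_0` generates `V_m`. -/
theorem eq_zero_of_highest {m : ℕ} {M : UqMod q} (φ : simple hq m ⟶ M)
    (h : lin φ (Pi.single 0 1 : Fin (m + 1) → ℂ) = 0) : φ = 0 := by
  have key : ∀ i : ℕ, ∀ hi : i < m + 1, lin φ (Pi.single ⟨i, hi⟩ 1 : Fin (m + 1) → ℂ) = 0 := by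
    intro i
    induction i with
    | zero => intro hi; exact h
    | succ i ih =>
      intro hi
      have h1 := lin_comm φ (Uq.gen q .Y) (Pi.single ⟨i, by omega⟩ 1 : Fin (m + 1) → ℂ)
      rw [ih, map_zero] at h1
      have h2 : (simple hq m).ρ (Uq.gen q .Y) (Pi.single ⟨i, by omega⟩ 1 : Fin (m + 1) → ℂ) =
          qint q (i + 1) • (Pi.single ⟨i + 1, hi⟩ 1 : Fin (m + 1) → ℂ) := by
        refine funext (α := Fin (m + 1)) fun j => ?_
        rw [simple_Y]
        simp only [Pi.smul_apply, smul_eq_mul, Pi.single_apply, Fin.ext_iff]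
        by_cases hj : (j : ℕ) = i + 1
        · simp [hj]
        · rw [if_neg hj, mul_zero]
          split_ifs with h3 h4
          · omega
          · exact mul_zero _
          · rfl
      rw [h2, map_smul] at h1
      exact (smul_eq_zero.1 h1).resolve_left (hq.qint_ne_zero (by omega))
  refine hom_ext (LinearMap.pi_ext' fun i => LinearMap.ext_ring ?_)
  exact key i i.2

/-- The image of `v_0` is a highest weight vector, hence proportional to `v_0`. -/
theorem highest_apply {m n : ℕ} (φ : simple hq m ⟶ simple hq n) :
    ∃ c : ℂ, lin φ (Pi.single 0 1 : Fin (m + 1) → ℂ) = c • (Pi.single 0 1 : Fin (n + 1) → ℂ) ∧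
      (m ≠ n → c = 0) := by
  obtain ⟨y, hy⟩ : ∃ y : Fin (n + 1) → ℂ, lin φ (Pi.single 0 1 : Fin (m + 1) → ℂ) = y := ⟨_, rfl⟩
  have hX : (simple hq m).ρ (Uq.gen q .X) (Pi.single 0 1 : Fin (m + 1) → ℂ) = 0 := by
    refine funext (α := Fin (m + 1)) fun j => ?_
    rw [simple_X]
    split_ifs with h
    · have : (⟨j + 1, h⟩ : Fin (m + 1)) ≠ 0 := fun h' => by simpa using congrArg Fin.val h'
      rw [Pi.single_eq_of_ne this, mul_zero]
      rfl
    · rfl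
  have hK : (simple hq m).ρ (Uq.gen q .K) (Pi.single 0 1 : Fin (m + 1) → ℂ) =
      q ^ m • (Pi.single 0 1 : Fin (m + 1) → ℂ) := by
    refine funext (α := Fin (m + 1)) fun j => ?_
    rw [simple_K]
    by_cases h : j = 0
    · subst h; simp
    · simp [h]
  have h1 := lin_comm φ (Uq.gen q .X) (Pi.single 0 1 : Fin (m + 1) → ℂ)
  have h2 := lin_comm φ (Uq.gen q .K) (Pi.single 0 1 : Fin (m + 1) → ℂ)
  rw [hX, map_zero, hy] at h1
  rw [hK, map_smul, hy] at h2
  refine ⟨y 0, ?_, fun hmn => ?_⟩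
  · rw [hy]
    refine funext (α := Fin (n + 1)) fun j => ?_
    obtain ⟨j, hj⟩ := j
    rcases j with _ | j
    · simp
    · have h3 := congrFun (α := Fin (n + 1)) h1 ⟨j, by omega⟩
      rw [simple_X, dif_pos (show j + 1 < n + 1 by omega)] at h3
      have h4 := (mul_eq_zero.1 h3.symm).resolve_left (hq.qint_ne_zero (by simp only; omega))
      rw [h4]
      simp [Fin.ext_iff]
  · have h3 := congrFun (α := Fin (n + 1)) h2 0
    rw [simple_K] at h3
    have h4 : q ^ m * y 0 = q ^ n * y 0 := by simpa using h3
    by_contra h0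
    have h5 := mul_right_cancel₀ h0 h4
    rcases lt_or_gt_of_ne hmn with h | h
    · refine hq.2 (n - m) (by omega) ?_
      rw [pow_sub₀ q hq.1 h.le, h5, mul_inv_cancel₀ (pow_ne_zero n hq.1)]
    · refine hq.2 (m - n) (by omega) ?_
      rw [pow_sub₀ q hq.1 h.le, h5, mul_inv_cancel₀ (pow_ne_zero n hq.1)]

theorem simple_hom_eq_zero {m n : ℕ} (hmn : m ≠ n) (φ : simple hq m ⟶ simple hq n) : φ = 0 := by
  obtain ⟨c, hc, h0⟩ := highest_apply hq φ
  refine eq_zero_of_highest hq φ ?_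
  rw [hc, h0 hmn, zero_smul]

theorem simple_hom_eq_smul {n : ℕ} (φ : simple hq n ⟶ simple hq n) :
    ∃ c : ℂ, φ = c • 𝟙 (simple hq n) := by
  obtain ⟨c, hc, -⟩ := highest_apply hq φ
  refine ⟨c, ?_⟩
  have h : φ + (-c) • 𝟙 (simple hq n) = 0 := by
    refine eq_zero_of_highest hq _ ?_
    rw [lin_add, lin_smul, LinearMap.add_apply, hc, LinearMap.smul_apply, lin_id,
      LinearMap.id_apply, ← add_smul, add_neg_cancel, zero_smul]
  rwa [neg_smul, add_neg_eq_zero] at h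

/-! ### The embedding of `V_n` into `V^{⊗ n}` -/

/-- The linear map `w ↦ (w_0, …, w_n)` from `ℂ^{n+2}` to `ℂ^{n+1}`. -/
def initLin (n : ℕ) : (Fin (n + 2) → ℂ) →ₗ[ℂ] (Fin (n + 1) → ℂ) :=
  LinearMap.funLeft ℂ ℂ Fin.castSucc

/-- The linear map `v_i ↦ q^{-(n+1-i)} v_{i-1}`, `v_0 ↦ 0` from `ℂ^{n+2}` to `ℂ^{n+1}`. -/
def tailLin (q : ℂ) (n : ℕ) : (Fin (n + 2) → ℂ) →ₗ[ℂ] (Fin (n + 1) → ℂ) where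
  toFun w i := q ^ ((i : ℤ) - n) * w i.succ
  map_add' w w' := by ext i; simp [mul_add]
  map_smul' r w := by ext i; simp; ring

theorem initLin_apply (n : ℕ) (w : Fin (n + 2) → ℂ) (i : Fin (n + 1)) :
    initLin n w i = w i.castSucc := rfl

theorem tailLin_apply (q : ℂ) (n : ℕ) (w : Fin (n + 2) → ℂ) (i : Fin (n + 1)) :
    tailLin q n w i = q ^ ((i : ℤ) - n) * w i.succ := rfl

section equivariance

variable (n : ℕ) (w : Fin (n + 2) → ℂ)

theorem initLin_K : initLin n ((simple hq (n + 1)).ρ (Uq.gen q .K) w) =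
    q • (simple hq n).ρ (Uq.gen q .K) (initLin n w) := by
  refine funext (α := Fin (n + 1)) fun i => ?_
  rw [initLin_apply, simple_K, Pi.smul_apply, simple_K, initLin_apply, smul_eq_mul, ← mul_assoc,
    ← zpow_one_add₀ hq.1]
  congr 2
  push_cast [Fin.val_castSucc]; ring

theorem tailLin_K : tailLin q n ((simple hq (n + 1)).ρ (Uq.gen q .K) w) =
    q⁻¹ • (simple hq n).ρ (Uq.gen q .K) (tailLin q n w) := by
  refine funext (α := Fin (n + 1)) fun i => ?_
  rw [tailLin_apply, simple_K, Pi.smul_apply, simple_K, tailLin_apply, smul_eq_mul, ← mul_assoc,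
    ← mul_assoc, ← mul_assoc, ← zpow_add₀ hq.1, ← zpow_neg_one, ← zpow_add₀ hq.1,
    ← zpow_add₀ hq.1]
  congr 2
  push_cast [Fin.val_succ]; ring

theorem initLin_Kinv : initLin n ((simple hq (n + 1)).ρ (Uq.gen q .Kinv) w) =
    q⁻¹ • (simple hq n).ρ (Uq.gen q .Kinv) (initLin n w) := by
  refine funext (α := Fin (n + 1)) fun i => ?_
  rw [initLin_apply, simple_Kinv, Pi.smul_apply, simple_Kinv, initLin_apply, smul_eq_mul,
    ← mul_assoc, ← zpow_neg_one, ← zpow_add₀ hq.1]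
  congr 2
  push_cast [Fin.val_castSucc]; ring

theorem tailLin_Kinv : tailLin q n ((simple hq (n + 1)).ρ (Uq.gen q .Kinv) w) =
    q • (simple hq n).ρ (Uq.gen q .Kinv) (tailLin q n w) := by
  refine funext (α := Fin (n + 1)) fun i => ?_
  rw [tailLin_apply, simple_Kinv, Pi.smul_apply, simple_Kinv, tailLin_apply, smul_eq_mul,
    ← mul_assoc, ← mul_assoc, ← mul_assoc, ← zpow_add₀ hq.1, ← zpow_one_add₀ hq.1,
    ← zpow_add₀ hq.1]
  congr 2
  push_cast [Fin.val_succ]; ring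

/-- The addition formula `[m + 1] = q [m] + q^{-m}`. -/
theorem qint_succ {q : ℂ} (hq : IsGeneric q) (m : ℕ) :
    qint q (m + 1) = q * qint q m + q ^ (-(m : ℤ)) := by
  have h := hq.sub_inv_ne_zero
  have h1 : q * q⁻¹ = 1 := mul_inv_cancel₀ hq.1
  rw [qint, qint, zpow_neg, zpow_natCast, ← inv_pow]
  generalize q⁻¹ = p at *
  field_simp
  ring

/-- The addition formula `[m + 1] = q^{-1} [m] + q^m`. -/
theorem qint_succ' {q : ℂ} (hq : IsGeneric q) (m : ℕ) :
    qint q (m + 1) = q⁻¹ * qint q m + q ^ (m : ℤ) := by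
  have h := hq.sub_inv_ne_zero
  have h1 : q * q⁻¹ = 1 := mul_inv_cancel₀ hq.1
  rw [qint, qint, zpow_natCast]
  generalize q⁻¹ = p at *
  field_simp
  ring

theorem initLin_X : initLin n ((simple hq (n + 1)).ρ (Uq.gen q .X) w) =
    q • (simple hq n).ρ (Uq.gen q .X) (initLin n w) + tailLin q n w := by
  refine funext (α := Fin (n + 1)) fun i => ?_
  obtain ⟨i, hi⟩ := i
  obtain ⟨j, rfl⟩ : ∃ j, n = i + j := ⟨n - i, by omega⟩
  rw [initLin_apply, simple_X, Pi.add_apply, Pi.smul_apply, simple_X, tailLin_apply, smul_eq_mul,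
    dif_pos (show ((⟨i, hi⟩ : Fin _).castSucc : ℕ) + 1 < i + j + 1 + 1 by
      simp only [Fin.val_castSucc]; omega)]
  have e1 : i + j + 1 - i = j + 1 := by omega
  have e2 : i + j - i = j := by omega
  have e3 : ((i : ℤ) - ((i + j : ℕ) : ℤ)) = -(j : ℤ) := by push_cast; ring
  simp only [e1, e2, e3, initLin_apply, qint_succ hq, Fin.succ_mk,
    Fin.castSucc_mk]
  split_ifs with h
  · ring
  · obtain rfl : j = 0 := by omega
    simp [qint]

theorem tailLin_X : tailLin q n ((simple hq (n + 1)).ρ (Uq.gen q .X) w) =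
    q⁻¹ • (simple hq n).ρ (Uq.gen q .X) (tailLin q n w) := by
  refine funext (α := Fin (n + 1)) fun i => ?_
  obtain ⟨i, hi⟩ := i
  rw [tailLin_apply, simple_X, Pi.smul_apply, simple_X, smul_eq_mul]
  have e1 : n + 1 - (i + 1) = n - i := by omega
  simp only [Fin.succ_mk, e1, tailLin_apply]
  split_ifs with h h'
  · have : q ^ (((i + 1 : ℕ) : ℤ) - n) = q ^ ((i : ℤ) - n) * q := by
      rw [← zpow_add_one₀ hq.1]; congr 1; push_cast; ring
    have h1 : q⁻¹ * q = 1 := inv_mul_cancel₀ hq.1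
    rw [this]
    linear_combination (-(qint q (n - i) * (q ^ ((i : ℤ) - n) * w ⟨i + 1 + 1, by omega⟩))) * h1
  · omega
  · omega
  · simp

theorem initLin_Y : initLin n ((simple hq (n + 1)).ρ (Uq.gen q .Y) w) =
    (simple hq n).ρ (Uq.gen q .Y) (initLin n w) := by
  refine funext (α := Fin (n + 1)) fun i => ?_
  rw [initLin_apply, simple_Y, simple_Y]
  rfl

theorem tailLin_Y : tailLin q n ((simple hq (n + 1)).ρ (Uq.gen q .Y) w) =
    (simple hq n).ρ (Uq.gen q .Kinv) (initLin n w) +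
      (simple hq n).ρ (Uq.gen q .Y) (tailLin q n w) := by
  refine funext (α := Fin (n + 1)) fun i => ?_
  obtain ⟨i, hi⟩ := i
  rw [tailLin_apply, simple_Y, Pi.add_apply, simple_Kinv, simple_Y, initLin_apply]
  simp only [Fin.succ_mk, Nat.add_sub_cancel, Fin.castSucc_mk, if_pos (Nat.succ_pos i),
    tailLin_apply]
  have e1 : q ^ (2 * (i : ℤ) - n) = q ^ ((i : ℤ) - n) * q ^ (i : ℤ) := by
    rw [← zpow_add₀ hq.1]; congr 1; ring
  rw [e1]
  split_ifs with h
  · obtain ⟨k, rfl⟩ : ∃ k, i = k + 1 := ⟨i - 1, by omega⟩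
    have e2 : q ^ (((k + 1 : ℕ) : ℤ) - n) = q ^ ((k : ℤ) - n) * q := by
      rw [← zpow_add_one₀ hq.1]; congr 1; push_cast; ring
    have h1 : q⁻¹ * q = 1 := inv_mul_cancel₀ hq.1
    simp only [Nat.add_sub_cancel, qint_succ' hq (k + 1), e2]
    linear_combination (q ^ ((k : ℤ) - n) * qint q (k + 1) * w ⟨k + 1, by omega⟩) * h1
  · obtain rfl : i = 0 := by omega
    simp [qint_one hq]

end equivariance

theorem fund_basis (g : UqGen) :
    ((fund hq).ρ (Uq.gen q g) (v0 hq) = match g with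
      | .K => q • v0 hq | .Kinv => q⁻¹ • v0 hq | .X => 0 | .Y => v1 hq) ∧
    ((fund hq).ρ (Uq.gen q g) (v1 hq) = match g with
      | .K => q⁻¹ • v1 hq | .Kinv => q • v1 hq | .X => v0 hq | .Y => 0) := by
  cases g
  · rw [v0, v1, fund_K, fund_K]
    constructor <;> refine funext (α := Fin 2) fun i => ?_ <;> fin_cases i <;> simp
  · rw [v0, v1, fund_Kinv, fund_Kinv]
    constructor <;> refine funext (α := Fin 2) fun i => ?_ <;> fin_cases i <;> simp
  · rw [v0, v1, fund_X, fund_X]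
    constructor <;> refine funext (α := Fin 2) fun i => ?_ <;> fin_cases i <;> simp <;> rfl
  · rw [v0, v1, fund_Y, fund_Y]
    constructor <;> refine funext (α := Fin 2) fun i => ?_ <;> fin_cases i <;> simp <;> rfl

/-- The embedding `V_{n+1} → V_n ⊗ V`, `v_i ↦ v_i ⊗ v_0 + q^{-(n+1-i)} v_{i-1} ⊗ v_1`. -/
def splitHom (n : ℕ) : simple hq (n + 1) ⟶ tensor hq (simple hq n) (fund hq) :=
  ofGens ((TensorProduct.mk ℂ (simple hq n) (fund hq)).flip (v0 hq) ∘ₗ initLin n +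
    (TensorProduct.mk ℂ (simple hq n) (fund hq)).flip (v1 hq) ∘ₗ tailLin q n) (by
    intro g w
    have h0 := (fund_basis hq g).1
    have h1 := (fund_basis hq g).2
    change (initLin n ((simple hq (n + 1)).ρ (Uq.gen q g) w) ⊗ₜ[ℂ] v0 hq +
        tailLin q n ((simple hq (n + 1)).ρ (Uq.gen q g) w) ⊗ₜ[ℂ] v1 hq :
        simple hq n ⊗[ℂ] fund hq) = (tensor hq (simple hq n) (fund hq)).ρ (Uq.gen q g)
        (initLin n w ⊗ₜ[ℂ] v0 hq + tailLin q n w ⊗ₜ[ℂ] v1 hq : simple hq n ⊗[ℂ] fund hq)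
    rw [map_add]
    cases g with
    | K =>
      rw [tensor_K, tensor_K, h0, h1, initLin_K, tailLin_K]
      simp only [TensorProduct.smul_tmul', TensorProduct.tmul_smul]
    | Kinv =>
      rw [tensor_Kinv, tensor_Kinv, h0, h1, initLin_Kinv, tailLin_Kinv]
      simp only [TensorProduct.smul_tmul', TensorProduct.tmul_smul]
    | X =>
      have k0 := (fund_basis hq .K).1
      have k1 := (fund_basis hq .K).2
      rw [tensor_X, tensor_X, h0, h1, k0, k1, initLin_X, tailLin_X]
      simp only [TensorProduct.smul_tmul', TensorProduct.tmul_smul, TensorProduct.add_tmul,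
        TensorProduct.tmul_zero]
      abel
    | Y =>
      rw [tensor_Y, tensor_Y, h0, h1, initLin_Y, tailLin_Y]
      simp only [TensorProduct.add_tmul, TensorProduct.tmul_zero]
      abel)

/-- The embedding `V_n → V^{⊗ n}`. -/
def symEmb : (n : ℕ) → (simple hq n ⟶ tpow hq n)
  | 0 => ofGens (LinearMap.proj (R := ℂ) (φ := fun _ : Fin 1 => ℂ) 0) (by
      intro g w
      refine Eq.trans ?_ (triv_ρ g (w 0)).symm
      cases g
      · exact (simple_K hq 0 w 0).trans (by simp)
      · exact (simple_Kinv hq 0 w 0).trans (by simp)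
      · exact (simple_X hq 0 w 0).trans (by simp)
      · exact (simple_Y hq 0 w 0).trans (by simp))
  | n + 1 => splitHom hq n ≫ tensorHom hq (symEmb n) (𝟙 (fund hq))

end UqMod

/-! ### The image of a Jones–Wenzl idempotent -/

namespace UqMod

section range

variable {a : ℂ} (ha : IsGeneric a)

/-- The coordinates of `V^{⊗ (k+1)} = V^{⊗ k} ⊗ V` with respect to the basis of the last factor:
`snoc x₀ v_0 + snoc x₁ v_1 ↦ x_i`. -/
def lastCoord (k : ℕ) (i : Fin 2) : tpow ha.sq (k + 1) →ₗ[ℂ] tpow ha.sq k :=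
  LinearMap.proj i ∘ₗ TensorProduct.piScalarRightHom ℂ ℂ (tpow ha.sq k) (Fin 2)

theorem lastCoord_snoc (k : ℕ) (i : Fin 2) (x : tpow ha.sq k) (w : Fin 2 → ℂ) :
    lastCoord ha k i (snoc ha k x w) = w i • x :=
  congrFun (TensorProduct.piScalarRightHom_tmul ℂ ℂ (tpow ha.sq k) (Fin 2) x w) i

theorem lastCoord_ext {k : ℕ} {x y : tpow ha.sq (k + 1)}
    (h : ∀ i, lastCoord ha k i x = lastCoord ha k i y) : x = y :=
  (TensorProduct.piScalarRight ℂ ℂ (tpow ha.sq k) (Fin 2)).injective (funext h)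

theorem lastCoord_strandT {k l : ℕ} (f : tpow ha.sq k ⟶ tpow ha.sq l) (i : Fin 2)
    (x : tpow ha.sq (k + 1)) :
    lastCoord ha l i (lin (strandT ha f) x) = lin f (lastCoord ha k i x) := by
  refine LinearMap.congr_fun (f := lastCoord ha l i ∘ₗ lin (strandT ha f))
    (g := lin f ∘ₗ lastCoord ha k i) (snoc_ext ha fun x w => ?_) x
  rw [LinearMap.comp_apply, strandT_apply, lastCoord_snoc, LinearMap.comp_apply, lastCoord_snoc,
    map_smul]

/-- The operator `1 ⊗ d` in coordinates, from `d(v_0 ⊗ v_1) = 1` and `d(v_1 ⊗ v_0) = -q⁻¹`. -/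
theorem capT_eq_lastCoord (k : ℕ) (x : tpow ha.sq (k + 2)) : lin (capT ha k) x =
    lastCoord ha k 0 (lastCoord ha (k + 1) 1 x)
      - (a ^ 2)⁻¹ • lastCoord ha k 1 (lastCoord ha (k + 1) 0 x) := by
  refine LinearMap.congr_fun (f := lin (capT ha k)) (g := lastCoord ha k 0 ∘ₗ
    lastCoord ha (k + 1) 1 - (a ^ 2)⁻¹ • lastCoord ha k 1 ∘ₗ lastCoord ha (k + 1) 0)
    (snoc_ext ha fun y w' => ?_) x
  refine LinearMap.congr_fun (f := lin (capT ha k) ∘ₗ (snoc ha (k + 1)).flip w')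
    (g := (lastCoord ha k 0 ∘ₗ lastCoord ha (k + 1) 1 -
      (a ^ 2)⁻¹ • lastCoord ha k 1 ∘ₗ lastCoord ha (k + 1) 0) ∘ₗ (snoc ha (k + 1)).flip w')
    (snoc_ext ha fun x w => ?_) y
  refine (capT_apply ha k x w w').trans ?_
  simp only [LinearMap.comp_apply, LinearMap.flip_apply, LinearMap.sub_apply,
    LinearMap.smul_apply]
  rw [lastCoord_snoc, lastCoord_snoc, map_smul, map_smul]
  have h0 := lastCoord_snoc ha k 0 x w
  have h1 := lastCoord_snoc ha k 1 x w
  refine Eq.trans ?_ (congrArg₂ (fun y z => w' 1 • y - (a ^ 2)⁻¹ • w' 0 • z) h0 h1).symm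
  simp only [smul_smul, ← sub_smul]
  congr 1
  simp only [dForm, LinearMap.mk₂_apply]
  ring

/-- The operator `1 ⊗ d ⊗ 1` with `i` factors `V` on the left of `d` and `j` on the right. -/
def capSlice {n m : ℕ} (i j : ℕ) (hn : n = i + 2 + j) (hm : m = i + j) :
    tpow ha.sq n ⟶ tpow ha.sq m :=
  sliceHom ha i .cap j hn hm

theorem capSlice_zero (k : ℕ) : capSlice ha (n := k + 2) (m := k) k 0 rfl rfl = capT ha k :=
  (Category.id_comp _).trans (Category.comp_id _)

theorem capSlice_succ {n m : ℕ} (i j : ℕ) (hn : n = i + 2 + j) (hm : m = i + j) :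
    capSlice ha (n := n + 1) (m := m + 1) i (j + 1) (congrArg (· + 1) hn) (congrArg (· + 1) hm) =
      strandT ha (capSlice ha i j hn hm) :=
  sliceHom_succ ha i .cap j hn hm

/-- The vectors of `V^{⊗ n}` on which all operators `1 ⊗ d ⊗ 1` vanish. -/
def capKer (n : ℕ) : Submodule ℂ (tpow ha.sq n) where
  carrier := {x | ∀ (m i j : ℕ) (hn : n = i + 2 + j) (hm : m = i + j),
    lin (capSlice ha i j hn hm) x = 0}
  add_mem' hx hy m i j hn hm := by rw [map_add, hx m i j hn hm, hy m i j hn hm, add_zero]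
  zero_mem' m i j hn hm := map_zero _
  smul_mem' c x hx m i j hn hm := by rw [map_smul, hx m i j hn hm, smul_zero]

theorem mem_capKer_succ {n : ℕ} {x : tpow ha.sq (n + 1)} : x ∈ capKer ha (n + 1) ↔
    (∀ i, lastCoord ha n i x ∈ capKer ha n) ∧
      ∀ (k : ℕ) (h : n = k + 1), lin (capSlice ha (n := n + 1) (m := k) k 0
        (congrArg (· + 1) h) rfl) x = 0 := by
  constructor
  · intro hx
    refine ⟨fun s m i j hn hm => ?_, fun k h => hx _ _ _ _ _⟩
    rw [← lastCoord_strandT, ← capSlice_succ, hx, map_zero]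
  · rintro ⟨h1, h2⟩ m i j hn hm
    rcases j with _ | j
    · obtain rfl : m = i := hm
      exact h2 m (by omega)
    · obtain ⟨m, rfl⟩ : ∃ m', m = m' + 1 := ⟨i + j, hm⟩
      refine lastCoord_ext ha fun s => ?_
      have := capSlice_succ ha (n := n) (m := m) i j (by omega) (by omega)
      rw [this, lastCoord_strandT, map_zero]
      exact h1 s m i j (by omega) (by omega)

theorem symEmb_succ_apply (n : ℕ) (w : Fin (n + 2) → ℂ) : lin (symEmb ha.sq (n + 1)) w =
    snoc ha n (lin (symEmb ha.sq n) (initLin n w)) (v0 ha.sq) +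
      snoc ha n (lin (symEmb ha.sq n) (tailLin (a ^ 2) n w)) (v1 ha.sq) :=
  map_add (TensorProduct.map (lin (symEmb ha.sq n)) (LinearMap.id (M := fund ha.sq)))
    (initLin n w ⊗ₜ[ℂ] v0 ha.sq) (tailLin (a ^ 2) n w ⊗ₜ[ℂ] v1 ha.sq)

theorem lastCoord_symEmb_zero (n : ℕ) (w : Fin (n + 2) → ℂ) :
    lastCoord ha n 0 (lin (symEmb ha.sq (n + 1)) w) = lin (symEmb ha.sq n) (initLin n w) := by
  rw [symEmb_succ_apply ha, map_add, lastCoord_snoc ha n 0, lastCoord_snoc ha n 0]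
  simp [v0, v1]

theorem lastCoord_symEmb_one (n : ℕ) (w : Fin (n + 2) → ℂ) :
    lastCoord ha n 1 (lin (symEmb ha.sq (n + 1)) w) =
      lin (symEmb ha.sq n) (tailLin (a ^ 2) n w) := by
  rw [symEmb_succ_apply ha, map_add, lastCoord_snoc ha n 1, lastCoord_snoc ha n 1]
  simp [v0, v1]

theorem symEmb_injective (n : ℕ) : Function.Injective (lin (symEmb ha.sq n)) := by
  induction n with
  | zero =>
    intro w w' h
    refine funext (α := Fin 1) fun i => ?_
    rw [Subsingleton.elim i 0]
    exact h
  | succ n ih =>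
    refine (injective_iff_map_eq_zero _).2 fun w hw => ?_
    have h0 := lastCoord_symEmb_zero ha n w
    have h1 := lastCoord_symEmb_one ha n w
    rw [hw, map_zero] at h0 h1
    replace h0 := (injective_iff_map_eq_zero _).1 ih _ h0.symm
    replace h1 := (injective_iff_map_eq_zero _).1 ih _ h1.symm
    refine funext (α := Fin (n + 2)) fun i => ?_
    refine Fin.lastCases ?_ (fun i => ?_) i
    · have := congrFun (α := Fin (n + 1)) h1 (Fin.last n)
      rw [tailLin_apply] at this
      simp only [Fin.val_last, sub_self, zpow_zero, one_mul] at this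
      exact this
    · exact congrFun (α := Fin (n + 1)) h0 i

/-- The two ways of dropping the first and the last coordinate differ by the factor `q⁻¹` of `d`;
this is why `1 ⊗ d` vanishes on the image of `V_{m+2}` in `V_m ⊗ V ⊗ V`. -/
theorem initLin_tailLin {q : ℂ} (hq : IsGeneric q) (m : ℕ) (w : Fin (m + 3) → ℂ) :
    initLin m (tailLin q (m + 1) w) = q⁻¹ • tailLin q m (initLin (m + 1) w) := by
  funext i
  rw [initLin_apply, tailLin_apply, Pi.smul_apply, tailLin_apply, initLin_apply, smul_eq_mul,
    ← mul_assoc, ← zpow_neg_one, ← zpow_add₀ hq.1]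
  congr 2
  push_cast [Fin.val_castSucc]; ring

/-- The image of `V_n` in `V^{⊗ n}` consists of the vectors on which all `1 ⊗ d ⊗ 1` vanish. By
induction the two coordinates of a vector of `V^{⊗ n} ⊗ V` killed by these operators come from
`s, t ∈ V_n`, and the operator at the last two factors vanishes iff `t_i = q^{i-n} s_{i+1}` for
`i < n`, that is, iff `s` and `t` glue to a vector of `V_{n+1}`. -/
theorem range_symEmb (n : ℕ) : LinearMap.range (lin (symEmb ha.sq n)) = capKer ha n := by
  induction n with
  | zero =>
    refine le_antisymm (fun x _ m i j hn hm => by omega) fun x _ => ?_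
    exact ⟨(fun _ => x : Fin 1 → ℂ), rfl⟩
  | succ n ih =>
    apply le_antisymm
    · rintro _ ⟨w, rfl⟩
      refine (mem_capKer_succ ha).2 ⟨fun s => ?_, fun k h => ?_⟩
      · rw [← ih]
        fin_cases s
        · exact ⟨_, (lastCoord_symEmb_zero ha n w).symm⟩
        · exact ⟨_, (lastCoord_symEmb_one ha n w).symm⟩
      · subst h
        have e1 := (congrArg (lastCoord ha k 0) (lastCoord_symEmb_one ha (k + 1) w)).trans
          (lastCoord_symEmb_zero ha k _)
        have e2 := (congrArg (lastCoord ha k 1) (lastCoord_symEmb_zero ha (k + 1) w)).trans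
          (lastCoord_symEmb_one ha k _)
        have h3 := capSlice_zero ha k
        refine (congrArg (fun f => lin f (lin (symEmb ha.sq (k + 2)) w)) h3).trans
          ((capT_eq_lastCoord ha k _).trans ?_)
        rw [initLin_tailLin ha.sq, map_smul] at e1
        exact (congrArg₂ (fun y z => y - (a ^ 2)⁻¹ • z) e1 e2).trans (sub_self _)
    · intro x hx
      obtain ⟨h1, h2⟩ := (mem_capKer_succ ha).1 hx
      rw [← ih] at h1
      obtain ⟨s, hs⟩ := h1 0
      obtain ⟨t, ht⟩ := h1 1
      change Fin (n + 1) → ℂ at s t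
      -- The vector of `V_{n+1}` with first part `s` and last coordinate that of `t`.
      have hi : initLin n (Fin.snoc s (t (Fin.last n)) : Fin (n + 2) → ℂ) = s := by
        funext i
        rw [initLin_apply]; exact Fin.snoc_castSucc (α := fun _ => ℂ) _ _ i
      have ht' : tailLin (a ^ 2) n (Fin.snoc s (t (Fin.last n)) : Fin (n + 2) → ℂ) = t := by
        funext i
        rw [tailLin_apply]
        refine Fin.lastCases ?_ (fun i => ?_) i
        · rw [Fin.succ_last]
          have := Fin.snoc_last (α := fun _ => ℂ) (t (Fin.last n)) s
          simp only [Fin.val_last, sub_self, zpow_zero, one_mul]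
          exact this
        · obtain ⟨k, rfl⟩ : ∃ k, n = k + 1 := ⟨n - 1, by have := i.2; omega⟩
          have h3 := (congrArg (fun f => lin f x) (capSlice_zero ha k)).symm.trans (h2 k rfl)
          rw [capT_eq_lastCoord, sub_eq_zero] at h3
          have e1 : lin (symEmb ha.sq k) (initLin k t) =
              lin (symEmb ha.sq k) ((a ^ 2)⁻¹ • tailLin (a ^ 2) k s) := by
            rw [map_smul]
            exact (lastCoord_symEmb_zero ha k t).symm.trans ((congrArg (lastCoord ha k 0) ht).trans
              (h3.trans (congrArg ((a ^ 2)⁻¹ • ·) ((congrArg (lastCoord ha k 1) hs).symm.trans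
                (lastCoord_symEmb_one ha k s)))))
          have e2 := congrFun (symEmb_injective ha k e1) i
          rw [initLin_apply, Pi.smul_apply, tailLin_apply, smul_eq_mul, ← mul_assoc,
            ← zpow_neg_one, ← zpow_add₀ ha.sq.1] at e2
          rw [e2]
          have := Fin.snoc_castSucc (α := fun _ => ℂ) (t (Fin.last (k + 1))) s i.succ
          refine congrArg₂ (fun c d => (a ^ 2) ^ c * d) ?_ this
          push_cast [Fin.val_castSucc]; ring
      refine ⟨(Fin.snoc s (t (Fin.last n)) : Fin (n + 2) → ℂ), lastCoord_ext ha fun i => ?_⟩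
      fin_cases i
      · exact (lastCoord_symEmb_zero ha n _).trans ((congrArg _ hi).trans hs)
      · exact (lastCoord_symEmb_one ha n _).trans ((congrArg _ ht').trans ht)

end range

end UqMod

namespace UqMod

/-! ### Split idempotents of modules -/

/-- The endomorphism `p` of `M` is a projection onto a direct summand isomorphic to `N`. -/
def SplitsAs {q : ℂ} {M : UqMod q} (p : M ⟶ M) (N : UqMod q) : Prop :=
  ∃ (ι : N ⟶ M) (r : M ⟶ N), ι ≫ r = 𝟙 N ∧ r ≫ ι = p

section splits

variable {q : ℂ} {M N : UqMod q}

/-- A bijective morphism is an isomorphism. -/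
def isoOfBijective (f : M ⟶ N) (hf : Function.Bijective (lin f)) : M ≅ N :=
  let e := LinearEquiv.ofBijective (lin f) hf
  have h1 : ∀ x, e.symm (lin f x) = x := e.symm_apply_apply
  have h2 : ∀ y, lin f (e.symm y) = y := e.apply_symm_apply
  { hom := f
    inv := ofGens e.symm.toLinearMap fun g y => hf.1 (by
      change lin f (e.symm _) = lin f (M.ρ _ (e.symm y))
      rw [lin_comm, h2, h2])
    hom_inv_id := hom_ext (LinearMap.ext h1)
    inv_hom_id := hom_ext (LinearMap.ext h2) }

/-- The inclusion of the image of an endomorphism. -/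
def imageι (p : M ⟶ M) : image p ⟶ M :=
  ⟨(LinearMap.range (lin p)).subtype, fun _ _ => rfl⟩

/-- An endomorphism, as a map onto its image. -/
def imageProj (p : M ⟶ M) : M ⟶ image p :=
  ⟨(lin p).rangeRestrict, fun u x => Subtype.ext (lin_comm p u x)⟩

theorem imageProj_ι (p : M ⟶ M) : imageProj p ≫ imageι p = p := rfl

theorem imageι_proj {p : M ⟶ M} (hp : p ≫ p = p) : imageι p ≫ imageProj p = 𝟙 (image p) :=
  hom_ext (LinearMap.ext fun x => Subtype.ext (by
    obtain ⟨_, y, rfl⟩ := x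
    exact LinearMap.congr_fun (congrArg lin hp) y))

theorem imageι_comp {p : M ⟶ M} (hp : p ≫ p = p) : imageι p ≫ p = imageι p :=
  hom_ext (LinearMap.ext fun x => by
    obtain ⟨_, y, rfl⟩ := x
    exact LinearMap.congr_fun (congrArg lin hp) y)

/-- A morphism between the images of idempotents is induced by a morphism of the modules. -/
theorem imageι_comp_conj {p : M ⟶ M} (hp : p ≫ p = p) {p' : N ⟶ N} (hp' : p' ≫ p' = p')
    (ψ : image p ⟶ image p') :
    imageι p ≫ (p ≫ (imageProj p ≫ ψ ≫ imageι p')) ≫ p' = ψ ≫ imageι p' := by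
  have h := imageι_proj hp
  have h1 := imageι_comp hp
  have h2 := imageι_comp hp'
  simp only [Category.assoc, reassoc_of% h1, reassoc_of% h, h2]

/-- An injective morphism onto the image of an idempotent exhibits its source as the summand. -/
theorem splitsAs_of_injective {p : M ⟶ M} (hp : p ≫ p = p) {ι : N ⟶ M}
    (hι : Function.Injective (lin ι)) (h : LinearMap.range (lin ι) = LinearMap.range (lin p)) :
    SplitsAs p N := by
  have hpι : ι ≫ p = ι := hom_ext (LinearMap.ext fun x => by
    obtain ⟨y, hy⟩ := h ▸ LinearMap.mem_range_self (lin ι) x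
    have := LinearMap.congr_fun (congrArg lin hp) y
    change lin p (lin ι x) = lin ι x
    rw [← hy]
    exact this)
  let e := isoOfBijective (ι ≫ imageProj p) (by
    constructor
    · intro x y hxy
      exact hι (((LinearMap.congr_fun (congrArg lin hpι) x).symm.trans
        (congrArg Subtype.val hxy)).trans (LinearMap.congr_fun (congrArg lin hpι) y))
    · rintro ⟨y, hy⟩
      obtain ⟨x, rfl⟩ := h ▸ hy
      exact ⟨x, Subtype.ext (LinearMap.congr_fun (congrArg lin hpι) x)⟩)
  have he : e.hom ≫ imageι p = ι := hpι
  refine ⟨ι, imageProj p ≫ e.inv, ?_, ?_⟩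
  · rw [← Category.assoc]
    exact e.hom_inv_id
  · rw [← he, Category.assoc, e.inv_hom_id_assoc, imageProj_ι]

theorem SplitsAs.image_iso {p : M ⟶ M} (h : SplitsAs p N) : Nonempty (image p ≅ N) := by
  obtain ⟨ι, r, h1, rfl⟩ := h
  have hp : (r ≫ ι) ≫ r ≫ ι = r ≫ ι := by
    rw [Category.assoc, ← Category.assoc ι, h1, Category.id_comp]
  refine ⟨⟨imageι _ ≫ r, ι ≫ imageProj _, ?_, ?_⟩⟩
  · have : (imageι (r ≫ ι) ≫ r) ≫ ι ≫ imageProj (r ≫ ι) =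
        (imageι (r ≫ ι) ≫ imageProj (r ≫ ι)) ≫ imageι (r ≫ ι) ≫ imageProj (r ≫ ι) := by
      simp only [Category.assoc]
      rw [← Category.assoc (imageProj _), imageProj_ι]
      simp only [Category.assoc]
    rw [this, imageι_proj hp, Category.id_comp]
  · have : (ι ≫ imageProj (r ≫ ι)) ≫ imageι (r ≫ ι) ≫ r = ι ≫ (r ≫ ι) ≫ r := by
      simp only [Category.assoc]
      rw [← Category.assoc (imageProj _), imageProj_ι, Category.assoc]
    rw [this, Category.assoc, h1, Category.comp_id, h1]

theorem tensorHom_comp (hq : IsGeneric q) {M₁ M₂ M₃ N₁ N₂ N₃ : UqMod q} (f : M₁ ⟶ M₂)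
    (f' : M₂ ⟶ M₃) (g : N₁ ⟶ N₂) (g' : N₂ ⟶ N₃) :
    tensorHom hq (f ≫ f') (g ≫ g') = tensorHom hq f g ≫ tensorHom hq f' g' :=
  hom_ext (TensorProduct.map_comp (lin f') (lin g') (lin f) (lin g))

theorem tensorHom_id (hq : IsGeneric q) (M N : UqMod q) :
    tensorHom hq (𝟙 M) (𝟙 N) = 𝟙 (tensor hq M N) :=
  hom_ext TensorProduct.map_id

theorem SplitsAs.tensor (hq : IsGeneric q) {M' N' : UqMod q} {p : M ⟶ M} {p' : M' ⟶ M'}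
    (h : SplitsAs p N) (h' : SplitsAs p' N') :
    SplitsAs (tensorHom hq p p') (UqMod.tensor hq N N') := by
  obtain ⟨ι, r, h1, h2⟩ := h
  obtain ⟨ι', r', h1', h2'⟩ := h'
  refine ⟨tensorHom hq ι ι', tensorHom hq r r', ?_, ?_⟩
  · rw [← tensorHom_comp, h1, h1', tensorHom_id]
  · rw [← tensorHom_comp, h2, h2']

theorem SplitsAs.conj {M' : UqMod q} {p : M ⟶ M} (h : SplitsAs p N) (e : M ≅ M') :
    SplitsAs (e.inv ≫ p ≫ e.hom) N := by
  obtain ⟨ι, r, h1, h2⟩ := h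
  refine ⟨ι ≫ e.hom, e.inv ≫ r, ?_, ?_⟩
  · rw [Category.assoc, e.hom_inv_id_assoc, h1]
  · rw [← h2]; simp only [Category.assoc]

end splits

/-! ### Jones–Wenzl idempotents split off the simple modules -/

section

variable {a : ℂ} (ha : IsGeneric a)

theorem skeinHom_cap {n m : ℕ} (i j : ℕ) (hn : n = i + 2 + j) (hm : m = i + j) :
    skeinHom ha (Skein.cap a i j hn hm) = capSlice ha i j hn hm :=
  (skeinHom_of ha _).trans (Category.id_comp _)

theorem skeinHom_comp_apply {k l m : ℕ} (x : Skein a l m) (y : Skein a k l) (v : tpow ha.sq k) :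
    lin (skeinHom ha (Skein.comp x y)) v = lin (skeinHom ha x) (lin (skeinHom ha y) v) := by
  rw [skeinHom_comp]; rfl

/-- Each `ℱ(e_i)` factors through an operator `1 ⊗ d ⊗ 1`. -/
theorem skeinHom_reduced_apply {n : ℕ} {z : Skein a n n} (hz : z.IsReduced) {x : tpow ha.sq n}
    (hx : x ∈ capKer ha n) : lin (skeinHom ha z) x = 0 := by
  induction hz using NonUnitalAlgebra.adjoin_induction with
  | mem z hz =>
    obtain ⟨i, rfl⟩ := hz
    have hi := i.2
    have h := Skein.tlGen_eq (a := a) (r := n - 2) n i (by omega) (by omega)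
    refine (congrArg (fun f => lin (skeinHom ha f) x) h).trans ?_
    rw [skeinHom_comp_apply, skeinHom_cap, hx, map_zero]
  | add z z' _ _ h h' =>
    refine (congrArg (fun f => lin f x) (map_add (skeinHom ha) z z')).trans ?_
    rw [lin_add, LinearMap.add_apply, h, h', add_zero]
  | zero => exact congrArg (fun f => lin f x) (map_zero (skeinHom ha))
  | mul z z' _ _ h h' =>
    refine (skeinHom_comp_apply ha z z' x).trans ?_
    rw [h', map_zero]
  | smul c z _ h =>
    refine (congrArg (fun f => lin f x) (map_smul (skeinHom ha) c z)).trans ?_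
    rw [lin_smul, LinearMap.smul_apply, h, smul_zero]

/-- The relation `d f_n = 0` gives one inclusion; the other holds since `f_n - 1` is a polynomial
without constant term in the `e_i`, which factor through the maxima. -/
theorem range_skeinHom_wenzl (n : ℕ) :
    LinearMap.range (lin (skeinHom ha (Skein.wenzl a n))) = capKer ha n := by
  apply le_antisymm
  · rintro _ ⟨x, rfl⟩ m i j hn hm
    rw [← skeinHom_cap, ← skeinHom_comp_apply, (Skein.wenzl_uncappable ha n).cap_comp, map_zero]
    rfl
  · intro x hx
    have h := skeinHom_reduced_apply ha (Skein.wenzl_sub_one a n) hx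
    rw [map_sub, skeinHom_one] at h
    exact ⟨x, sub_eq_zero.1 h⟩

theorem wenzl_splitsAs (n : ℕ) : SplitsAs (skeinHom ha (Skein.wenzl a n)) (simple ha.sq n) := by
  refine splitsAs_of_injective ?_ (symEmb_injective ha n)
    ((range_symEmb ha n).trans (range_skeinHom_wenzl ha n).symm)
  rw [← skeinHom_comp, Skein.wenzl_idem ha]

theorem skeinHom_wenzl_ne_zero (n : ℕ) : skeinHom ha (Skein.wenzl a n) ≠ 0 := by
  obtain ⟨ι, r, h1, h2⟩ := wenzl_splitsAs ha n
  intro h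
  rw [h] at h2
  have h3 : 𝟙 (simple ha.sq n) = 0 := by
    rw [← Category.id_comp (𝟙 (simple ha.sq n)), ← h1, Category.assoc, ← Category.assoc r, h2,
      Limits.zero_comp, Limits.comp_zero]
  have h4 := congrFun (α := Fin (n + 1)) (LinearMap.congr_fun (congrArg lin h3)
    (Pi.single 0 1 : Fin (n + 1) → ℂ)) 0
  exact one_ne_zero ((Pi.single_eq_same (M := fun _ : Fin (n + 1) => ℂ) 0 1).symm.trans h4)

/-! ### Full faithfulness on the Temperley–Lieb category -/

theorem skeinHom_injective (k l : ℕ) :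
    Function.Injective (skeinHom ha : Skein a k l →ₗ[ℂ] (tpow ha.sq k ⟶ tpow ha.sq l)) := by
  refine (injective_iff_map_eq_zero _).2 fun x hx => ?_
  have h := Skein.mem_of_sandwich ha ((Skein.comp (k := k)).compl₂ (Skein.comp x)) ⊥ ?_
  · have h' : Skein.comp (Skein.one a l) (Skein.comp x (Skein.one a k)) = 0 := h
    rwa [Skein.one_comp, Skein.comp_one] at h'
  · intro m n u y u' y'
    rw [Submodule.mem_bot]
    have h0 : skeinHom ha (Skein.comp y (Skein.comp x u')) = 0 := by
      rw [skeinHom_comp, skeinHom_comp, hx, Limits.comp_zero, Limits.zero_comp]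
    have h1 : Skein.comp (Skein.wenzl a m) (Skein.comp (Skein.comp y (Skein.comp x u'))
        (Skein.wenzl a n)) = 0 := by
      rcases eq_or_ne n m with rfl | hmn
      · obtain ⟨c, hc⟩ := (Skein.wenzl_uncappable ha n).exists_comp_comp_eq
          (Skein.comp y (Skein.comp x u'))
        rw [Skein.wenzl_idem ha] at hc
        have h2 := congrArg (skeinHom ha) hc
        rw [skeinHom_comp, skeinHom_comp, h0, Limits.comp_zero, Limits.zero_comp, map_smul] at h2
        rw [hc, (smul_eq_zero.1 h2.symm).resolve_right (skeinHom_wenzl_ne_zero ha n), zero_smul]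
      · exact (Skein.wenzl_uncappable ha m).comp_comp_eq_zero (Skein.wenzl_uncappable ha n) hmn _
    have h2 : Skein.comp (Skein.comp u (Skein.comp (Skein.wenzl a m) y))
        (Skein.comp x (Skein.comp u' (Skein.comp (Skein.wenzl a n) y'))) =
        Skein.comp u (Skein.comp (Skein.comp (Skein.wenzl a m)
          (Skein.comp (Skein.comp y (Skein.comp x u')) (Skein.wenzl a n))) y') := by
      simp only [Skein.comp_assoc]
    refine h2.trans ?_
    rw [h1]
    simp

theorem skeinHom_surjective (k l : ℕ) :
    Function.Surjective (skeinHom ha : Skein a k l →ₗ[ℂ] (tpow ha.sq k ⟶ tpow ha.sq l)) := by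
  intro φ
  have h := Skein.mem_of_sandwich ha (LinearMap.mk₂ ℂ
    (fun (z : Skein a l l) (w : Skein a k k) => skeinHom ha w ≫ φ ≫ skeinHom ha z)
    (fun z z' w => by simp) (fun c z w => by simp) (fun z w w' => by simp)
    (fun c z w => by simp)) (LinearMap.range (skeinHom ha)) ?_
  · rw [LinearMap.mk₂_apply, skeinHom_one, skeinHom_one, Category.comp_id, Category.id_comp] at h
    exact h
  · intro m n u y u' y'
    rw [LinearMap.mk₂_apply]
    simp only [skeinHom_comp, Category.assoc]
    -- One splitting of each `ℱ(f_n)` is fixed, so that for `n = m` the composite `r n ≫ ι n` below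
    -- is `ℱ(f_n)` again.
    choose ι r _ hιr using wenzl_splitsAs ha
    have h1 : ∃ z : Skein a n m, skeinHom ha (Skein.wenzl a n) ≫ skeinHom ha u' ≫ φ ≫
        skeinHom ha y ≫ skeinHom ha (Skein.wenzl a m) = skeinHom ha z := by
      have h2 : skeinHom ha (Skein.wenzl a n) ≫ skeinHom ha u' ≫ φ ≫
          skeinHom ha y ≫ skeinHom ha (Skein.wenzl a m) =
          r n ≫ (ι n ≫ skeinHom ha u' ≫ φ ≫ skeinHom ha y ≫ r m) ≫ ι m := by
        rw [← hιr, ← hιr]; simp only [Category.assoc]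
      rw [h2]
      rcases eq_or_ne n m with rfl | hmn
      · obtain ⟨c, hc⟩ := simple_hom_eq_smul ha.sq
          (ι n ≫ skeinHom ha u' ≫ φ ≫ skeinHom ha y ≫ r n)
        refine ⟨c • Skein.wenzl a n, ?_⟩
        rw [hc, Linear.smul_comp, Linear.comp_smul, Category.id_comp, hιr, map_smul]
      · refine ⟨0, ?_⟩
        rw [simple_hom_eq_zero ha.sq hmn (ι n ≫ skeinHom ha u' ≫ φ ≫ skeinHom ha y ≫ r m),
          Limits.zero_comp, Limits.comp_zero, map_zero]
    obtain ⟨z, hz⟩ := h1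
    refine ⟨Skein.comp u (Skein.comp z y'), ?_⟩
    rw [skeinHom_comp, skeinHom_comp, ← hz]
    simp only [Category.assoc]

/-! ### Tensor products of skeins -/

/-- The identification `V^{⊗ p} ⊗ V^{⊗ k} = V^{⊗ (p + k)}`, as a morphism of modules. -/
def mulHom (p : ℕ) : (k : ℕ) → (tensor ha.sq (tpow ha.sq p) (tpow ha.sq k) ⟶ tpow ha.sq (p + k))
  | 0 => rightUnit ha.sq (tpow ha.sq p)
  | k + 1 => assocInv ha.sq (tpow ha.sq p) (tpow ha.sq k) (fund ha.sq) ≫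
      tensorHom ha.sq (mulHom p k) (𝟙 (fund ha.sq))

theorem lin_mulHom (p k : ℕ) : lin (mulHom ha p k) = (mulEquiv ha p k).toLinearMap := by
  induction k with
  | zero => rfl
  | succ k ih =>
    change TensorProduct.map (lin (mulHom ha p k)) LinearMap.id ∘ₗ
      (TensorProduct.assoc ℂ (tpow ha.sq p) (tpow ha.sq k) (fund ha.sq)).symm.toLinearMap = _
    rw [ih]
    rfl

/-- `mulHom` as an isomorphism. -/
def mulIso (p k : ℕ) : tensor ha.sq (tpow ha.sq p) (tpow ha.sq k) ≅ tpow ha.sq (p + k) :=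
  isoOfBijective (mulHom ha p k) (by rw [lin_mulHom]; exact (mulEquiv ha p k).bijective)

theorem lin_skeinHom_whiskerRight {k l : ℕ} (x : Skein a k l) (p : ℕ) :
    lin (skeinHom ha (Skein.whiskerRight p x)) ∘ₗ (mulEquiv ha k p).toLinearMap =
      (mulEquiv ha l p).toLinearMap ∘ₗ TensorProduct.map (lin (skeinHom ha x)) LinearMap.id := by
  rw [← rightHom_mulEquiv]
  congr 1
  obtain ⟨x, rfl⟩ := Submodule.mkQ_surjective _ x
  exact lin_evalLin_whiskerRight ha p x

theorem lin_skeinHom_whiskerLeft {k l : ℕ} (x : Skein a k l) (p : ℕ) :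
    lin (skeinHom ha (Skein.whiskerLeft p x)) ∘ₗ (mulEquiv ha p k).toLinearMap =
      (mulEquiv ha p l).toLinearMap ∘ₗ TensorProduct.map LinearMap.id (lin (skeinHom ha x)) := by
  obtain ⟨x, rfl⟩ := Submodule.mkQ_surjective _ x
  refine (congrArg (fun f => f ∘ₗ (mulEquiv ha p k).toLinearMap)
    (lin_evalLin_whiskerLeft ha p x)).trans (LinearMap.ext fun y => ?_)
  simp only [leftLin, LinearMap.comp_apply, LinearEquiv.coe_coe, LinearEquiv.symm_apply_apply]
  rfl

theorem mulIso_hom_comp_skeinHom_tensor {k l m n : ℕ} (x : Skein a k l) (y : Skein a m n) :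
    (mulIso ha k m).hom ≫ skeinHom ha (Skein.tensor x y) =
      tensorHom ha.sq (skeinHom ha x) (skeinHom ha y) ≫ (mulIso ha l n).hom := by
  refine hom_ext ?_
  change lin (skeinHom ha (Skein.tensor x y)) ∘ₗ lin (mulHom ha k m) =
    lin (mulHom ha l n) ∘ₗ TensorProduct.map (lin (skeinHom ha x)) (lin (skeinHom ha y))
  rw [lin_mulHom, lin_mulHom, Skein.tensor, skeinHom_comp, lin_comp, LinearMap.comp_assoc,
    lin_skeinHom_whiskerRight, ← LinearMap.comp_assoc, lin_skeinHom_whiskerLeft,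
    LinearMap.comp_assoc, ← TensorProduct.map_comp, LinearMap.id_comp, LinearMap.comp_id]

theorem idem_splitsAs (s : List ℕ+) : SplitsAs (skeinHom ha (TuraevCat.idem a s))
    (tensorSimple ha.sq (s.map fun n : ℕ+ => (n : ℕ))) := by
  induction s with
  | nil =>
    exact ⟨𝟙 (tpow ha.sq 0), 𝟙 (tpow ha.sq 0), Category.id_comp (𝟙 (tpow ha.sq 0)),
      (Category.id_comp (𝟙 (tpow ha.sq 0))).trans (skeinHom_one ha 0).symm⟩
  | cons n s ih =>
    have h : skeinHom ha (TuraevCat.idem a (n :: s)) =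
        (mulIso ha n (TuraevCat.size s)).inv ≫ tensorHom ha.sq (skeinHom ha (Skein.wenzl a n))
          (skeinHom ha (TuraevCat.idem a s)) ≫ (mulIso ha n (TuraevCat.size s)).hom := by
      refine (Iso.eq_inv_comp (mulIso ha n (TuraevCat.size s))).2 ?_
      rw [← mulIso_hom_comp_skeinHom_tensor, ← jonesWenzl_eq_wenzl ha]
      rfl
    rw [h]
    exact ((wenzl_splitsAs ha n).tensor ha.sq ih).conj _

end

end UqMod

/-! ### Full faithfulness on Turaev's category -/

section

variable {a : ℂ} (ha : IsGeneric a)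

theorem isTensorSimple_turaevFunctor (s : TuraevCat a) :
    UqMod.isTensorSimple ha.sq ((turaevFunctor ha).obj s) :=
  ⟨_, (UqMod.idem_splitsAs ha s.seq).image_iso⟩

theorem turaevFunctor_map_injective {s t : TuraevCat a} :
    Function.Injective fun f : s ⟶ t => (turaevFunctor ha).map f := by
  intro f g hfg
  refine Subtype.ext (UqMod.skeinHom_injective ha _ _ ?_)
  rw [← TuraevCat.comp_idem f.2, ← TuraevCat.comp_idem g.2, UqMod.skeinHom_comp,
    UqMod.skeinHom_comp]
  refine UqMod.hom_ext (LinearMap.ext fun x => ?_)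
  exact congrArg Subtype.val (LinearMap.congr_fun (congrArg UqMod.lin hfg)
    ⟨UqMod.lin (UqMod.skeinHom ha (TuraevCat.idem a s.seq)) x, x, rfl⟩)

theorem turaevFunctor_map_surjective {s t : TuraevCat a} :
    Function.Surjective fun f : s ⟶ t => (turaevFunctor ha).map f := by
  intro ψ
  obtain ⟨g, hg⟩ := UqMod.skeinHom_surjective ha _ _ (UqMod.imageProj
    (UqMod.skeinHom ha (TuraevCat.idem a s.seq)) ≫ ψ ≫ UqMod.imageι
    (UqMod.skeinHom ha (TuraevCat.idem a t.seq)))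
  refine ⟨⟨TuraevCat.hat a s.seq t.seq g, g, rfl⟩, UqMod.hom_ext (LinearMap.ext fun x =>
    Subtype.ext ?_)⟩
  have hp : ∀ s : List ℕ+, UqMod.skeinHom ha (TuraevCat.idem a s) ≫
      UqMod.skeinHom ha (TuraevCat.idem a s) = UqMod.skeinHom ha (TuraevCat.idem a s) := fun s => by
    rw [← UqMod.skeinHom_comp, TuraevCat.idem_comp_idem]
  have h := UqMod.imageι_comp_conj (hp s.seq) (hp t.seq) ψ
  have h' : UqMod.skeinHom ha (TuraevCat.hat a s.seq t.seq g) = _ ≫ _ :=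
    UqMod.skeinHom_comp ha (TuraevCat.idem a t.seq) (Skein.comp g (TuraevCat.idem a s.seq))
  rw [UqMod.skeinHom_comp, hg] at h'
  replace h := (congrArg (fun f =>
    UqMod.imageι (UqMod.skeinHom ha (TuraevCat.idem a s.seq)) ≫ f) h').trans h
  exact LinearMap.congr_fun (congrArg UqMod.lin h) x

end

end

theorem mainTheorem2 (a : ℂ) (ha : IsGeneric a) :
    (∀ n : ℕ, ∃! f : End (⟨n⟩ : TL a), IsJonesWenzl a n f) ∧
    ∃ h : ∀ s : TuraevCat a, UqMod.isTensorSimple ha.sq ((turaevFunctor ha).obj s),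
      ∀ s t : TuraevCat a,
        ∃ e : (s ⟶ t) ≃ₗ[ℂ]
            ((((UqMod.isTensorSimple ha.sq).lift (turaevFunctor ha) h).obj s : RepCat ha.sq) ⟶
              ((UqMod.isTensorSimple ha.sq).lift (turaevFunctor ha) h).obj t),
          ∀ f : s ⟶ t, e f = ((UqMod.isTensorSimple ha.sq).lift (turaevFunctor ha) h).map f := by
  refine ⟨existsUnique_isJonesWenzl ha, isTensorSimple_turaevFunctor ha, fun s t => ?_⟩
  refine ⟨LinearEquiv.ofBijective
    { toFun := fun f => ((UqMod.isTensorSimple ha.sq).lift (turaevFunctor ha)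
        (isTensorSimple_turaevFunctor ha)).map f
      map_add' := fun f g => ?_
      map_smul' := fun c f => ?_ } ⟨fun f g hfg => ?_, fun ψ => ?_⟩, fun f => rfl⟩
  · refine ObjectProperty.hom_ext _ (UqMod.hom_ext (LinearMap.ext fun x => Subtype.ext ?_))
    exact LinearMap.congr_fun (congrArg UqMod.lin (map_add (UqMod.skeinHom ha) f.1 g.1)) x.1
  · refine ObjectProperty.hom_ext _ (UqMod.hom_ext (LinearMap.ext fun x => Subtype.ext ?_))
    exact LinearMap.congr_fun (congrArg UqMod.lin (map_smul (UqMod.skeinHom ha) c f.1)) x.1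
  · exact turaevFunctor_map_injective ha (congrArg (fun f => f.hom) hfg)
  · obtain ⟨f, hf⟩ := turaevFunctor_map_surjective ha ψ.hom
    exact ⟨f, ObjectProperty.hom_ext _ hf⟩
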